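/- **Theorem 3 (Convergence of En-BlendedBDF).** *Setting.* Let $\Omega\subset\mathbb R^d$ ($d=2$ or $3$) be open and bounded, $X=H^1_0(\Omega)^d$, $Q=L^2_0(\Omega)$; $\|\cdot\|$ and $(\cdot,\cdot)$ are the $L^2(\Omega)$ norm and inner product, $\|\cdot\|_m$ is the norm of $H^m(\Omega)$, and $b^*(u,v,w)=\tfrac12(u\cdot\nabla v,w)-\tfrac12(u\cdot\nabla w,v)$. Let $k\ge 1$, $s\ge 0$, $\nu>0$, $T>0$, and for $j=1,\dots,J$ let $(u_j,p_j)$ solve the Navier–Stokes equations $$u_{j,t}+u_j\cdot\nabla u_j-\nu\Delta u_j+\nabla p_j=f_j,\qquad \nabla\cdot u_j=0 \quad\text{in }\Omega,\qquad u_j=0\ \text{on }\partial\Omega,\qquad t\in[0,T],$$ (weakly, tested with $v\in X$, at every $t\in[0,T]$; $p_j(t)\in Q$) with $u_j\in H^3(0,T;H^{k+1}(\Omega))$, $p_j\in L^2(0,T;H^{s+1}(\Omega))$, $f_j\in L^2(0,T;L^2(\Omega))$, where $p_j$ and $f_j$ are defined at every time. *Discretization.* Let $X_h\subset X$, $Q_h\subset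 Q$ be conforming finite element spaces (finite dimensional, mesh width $0<h\le\operatorname{diam}\Omega$) which satisfy, with constants $\beta,C_{\rm inv},C_{\rm app}>0$ independent of $h$: the discrete inf-sup condition $\beta\|q_h\|\le\sup_{0\ne v_h\in X_h}(q_h,\nabla\cdot v_h)/\|\nabla v_h\|$ for $q_h\in Q_h$; the inverse inequality $h\|\nabla v_h\|\le C_{\rm inv}\|v_h\|$ for $v_h\in X_h$; and the approximation orders $k$ and $s$: $\inf_{v_h\in X_h}\|\nabla(w-v_h)\|\le C_{\rm app}h^k\|w\|_{k+1}$ for $w\in X\cap H^{k+1}(\Omega)^d$ and $\inf_{q_h\in Q_h}\|r-q_h\|\le C_{\rm app}h^{s+1}\|r\|_{s+1}$ for $r\in Q\cap H^{s+1}(\Omega)$. Let $\Delta t>0$, $N_T\Delta t=T$, $t^n=n\Delta t$, $v^n=v(t^n)$. For any sequence write $\mathcal E(u)^n=3u^n-3u^{n-1}+u^{n-2}$; let $\langle u_h\rangle^n=\frac1J\sum_j\mathcal E(u_{j,h})^n$ and $u_{j,h}'^{\,n}=\mathcal E(u_{j,h})^n-\langle u_h\rangle^n$. Given $u_{j,h}^0,u_{j,h}^1,u_{j,h}^2\in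 X_h$, let $u_{j,h}^{n+1}\in X_h$, $p_{j,h}^{n+1}\in Q_h$ satisfy, for $2\le n\le N_T-1$, all $v_h\in X_h$ and all $q_h\in Q_h$, $$\Big(\tfrac{10u_{j,h}^{n+1}-15u_{j,h}^n+6u_{j,h}^{n-1}-u_{j,h}^{n-2}}{6\Delta t},v_h\Big)+b^*(\langle u_h\rangle^n,u_{j,h}^{n+1},v_h)+b^*(u_{j,h}'^{\,n},\mathcal E(u_{j,h})^n,v_h)-(p_{j,h}^{n+1},\nabla\cdot v_h)+\nu(\nabla u_{j,h}^{n+1},\nabla v_h)=(f_j^{n+1},v_h),$$ $$(\nabla\cdot u_{j,h}^{n+1},q_h)=0 .$$ Put $e_j^n=u_j^n-u_{j,h}^n$ and $$\mathcal L_j^n=\tfrac12\|e_j^n\|^2+\tfrac12\|3e_j^n-e_j^{n-1}\|^2+\tfrac12\|3e_j^n-3e_j^{n-1}+e_j^{n-2}\|^2+\tfrac{3\nu\Delta t}{16}\|\nabla e_j^n\|^2+\tfrac{3\nu\Delta t}{8}\big(\|\nabla e_j^n\|^2+\|\nabla e_j^{n-1}\|^2\big)+\tfrac{3\nu\Delta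 t}{16}\|\nabla e_j^{n-2}\|^2 .$$ Let $\||v|\|_{\infty,m}=\max_{0\le n\le N_T}\|v^n\|_m$, $\||v|\|_{2,m}^2=\sum_{n=0}^{N_T}\Delta t\,\|v^n\|_m^2$, $\|v\|_{2,m}^2=\int_0^T\|v(t)\|_m^2\,dt$. *Claim.* There is a constant $C_e>0$ depending only on $\Omega$ and $C_{\rm inv}$ such that the following holds. For all data as above there is a constant $C>0$, independent of $h$, of $\Delta t$, and of the particular spaces, starting values and discrete solutions (for fixed $\beta,C_{\rm inv},C_{\rm app}$), such that whenever $$C_e\frac{\Delta t}{\nu h}\|\nabla u_{j,h}'^{\,n}\|^2\le 1,\qquad j=1,\dots,J,\quad 2\le n\le N_T-1,$$ then for every $j$ and every $N$ with $2<N\le N_T$ $$\begin{aligned} &\mathcal L_j^N+\tfrac14\sum_{n=2}^{N-1}\|e_j^{n+1}-3e_j^n+3e_j^{n-1}-e_j^{n-2}\|^2+\nu\sum_{n=2}^{N-1}\Delta t\|\nabla e_j^{n+1}\|^2\\ &\le \exp\Big(\frac{CT}{\nu^2}\Big)\Big\{\mathcal L_j^2+C\frac{h^{2k}}{\nu}\||\nabla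 u_j|\|_{\infty,0}^2\||u_j|\|_{2,k+1}^2+C\frac{\Delta t^6}{\nu}\|\nabla u_{j,ttt}\|_{2,0}^2+C\frac{h^{2k}}{\nu}\||\nabla u_j|\|_{2,k}^2\\ &\quad+C\Delta t^4h^{2k+1}\|\nabla u_{j,ttt}\|_{2,k}^2+C\Delta t^5h\|\nabla u_{j,ttt}\|_{2,0}^2+C\frac{h^{2s+2}}{\nu}\||p_j|\|_{2,s+1}^2\\ &\quad+C\frac{h^{2k+2}}{\nu}\|u_{j,t}\|_{2,k+1}^2+C\nu h^{2k}\||\nabla u_j|\|_{2,k}^2+C\frac{\Delta t^4}{\nu}\|u_{j,ttt}\|_{2,0}^2\Big\}. \end{aligned}$$ -/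

import Mathlib

open MeasureTheory Finset
open scoped ContDiff

noncomputable section

namespace EnBDF

/-! ### Sobolev spaces on an open set `Ω ⊆ ℝ^d` -/

abbrev Pt (d : ℕ) := EuclideanSpace ℝ (Fin d)

/-- `L²(Ω)`. -/
abbrev L2 {d : ℕ} (Ω : Set (Pt d)) := Lp ℝ 2 ((volume : Measure (Pt d)).restrict Ω)

/-- Test functions: `φ ∈ C_c^∞(Ω)`. -/
def IsTestFun {d : ℕ} (Ω : Set (Pt d)) (φ : Pt d → ℝ) : Prop :=
  ContDiff ℝ ∞ φ ∧ HasCompactSupport φ ∧ tsupport φ ⊆ Ω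

/-- The classical partial derivative `∂_i φ`. -/
def pd {d : ℕ} (i : Fin d) (φ : Pt d → ℝ) (x : Pt d) : ℝ :=
  fderiv ℝ φ x (EuclideanSpace.single i 1)

/-- `g` is the weak partial derivative `∂_i f` on `Ω`. -/
def HasWeakPartial {d : ℕ} (Ω : Set (Pt d)) (i : Fin d) (f g : L2 Ω) : Prop :=
  ∀ φ : Pt d → ℝ, IsTestFun Ω φ →
    ∫ x in Ω, f x * pd i φ x = - ∫ x in Ω, g x * φ x

/-- The multi-indices `α ∈ ℕ^d` with `|α| ≤ m`. -/
def multiIdx (d m : ℕ) : Finset (Fin d → ℕ) :=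
  (Fintype.piFinset fun _ => Finset.range (m + 1)).filter fun α => ∑ i, α i ≤ m

theorem mem_multiIdx {d m : ℕ} {α : Fin d → ℕ} : α ∈ multiIdx d m ↔ ∑ i, α i ≤ m := by
  simp only [multiIdx, Finset.mem_filter, Fintype.mem_piFinset, Finset.mem_range,
    and_iff_right_iff_imp]
  intro h i
  exact Nat.lt_succ_of_le
    ((Finset.single_le_sum (f := α) (fun _ _ => Nat.zero_le _) (Finset.mem_univ i)).trans h)

theorem zero_mem_multiIdx (d m : ℕ) : (0 : Fin d → ℕ) ∈ multiIdx d m := by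
  simp [mem_multiIdx]

theorem multiIdx_mono {d m n : ℕ} (h : m ≤ n) {α : Fin d → ℕ} (hα : α ∈ multiIdx d m) :
    α ∈ multiIdx d n :=
  mem_multiIdx.2 ((mem_multiIdx.1 hα).trans h)

theorem add_single_mem_multiIdx {d m : ℕ} (i : Fin d) {α : Fin d → ℕ}
    (hα : α ∈ multiIdx d m) : α + Pi.single i 1 ∈ multiIdx d (m + 1) := by
  rw [mem_multiIdx] at *
  simp only [Pi.add_apply, Finset.sum_add_distrib, Finset.sum_pi_single', Finset.mem_univ, if_true]
  omega

theorem IsTestFun.memLp {d : ℕ} {Ω : Set (Pt d)} {φ : Pt d → ℝ} (h : IsTestFun Ω φ) :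
    MemLp φ 2 ((volume : Measure (Pt d)).restrict Ω) :=
  (h.1.continuous.memLp_of_hasCompactSupport h.2.1).restrict Ω

theorem IsTestFun.memLp_pd {d : ℕ} {Ω : Set (Pt d)} {φ : Pt d → ℝ} (h : IsTestFun Ω φ)
    (i : Fin d) : MemLp (pd i φ) 2 ((volume : Measure (Pt d)).restrict Ω) := by
  have hc : Continuous (pd i φ) :=
    (h.1.continuous_fderiv (by simp)).clm_apply continuous_const
  have hs : HasCompactSupport (pd i φ) :=
    (h.2.1.fderiv (𝕜 := ℝ)).comp_left
      (g := fun L : Pt d →L[ℝ] ℝ => L (EuclideanSpace.single i 1)) (by simp)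
  exact (hc.memLp_of_hasCompactSupport hs).restrict Ω

/-- The weak partial derivative in terms of the `L²` inner product. -/
theorem hasWeakPartial_iff {d : ℕ} {Ω : Set (Pt d)} {i : Fin d} {f g : L2 Ω} :
    HasWeakPartial Ω i f g ↔ ∀ (φ : Pt d → ℝ) (h : IsTestFun Ω φ),
      inner ℝ ((h.memLp_pd i).toLp) f = - inner ℝ (h.memLp.toLp) g := by
  refine forall₂_congr fun φ h => ?_
  rw [L2.inner_def, L2.inner_def]
  have e1 : ∫ x in Ω, f x * pd i φ x
      = ∫ x in Ω, inner ℝ ((h.memLp_pd i).toLp (pd i φ) x) (f x) := by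
    refine integral_congr_ae ?_
    filter_upwards [(h.memLp_pd i).coeFn_toLp] with x hx
    simp [hx]
  have e2 : ∫ x in Ω, g x * φ x
      = ∫ x in Ω, inner ℝ (h.memLp.toLp φ x) (g x) := by
    refine integral_congr_ae ?_
    filter_upwards [h.memLp.coeFn_toLp] with x hx
    simp [hx]
  rw [e1, e2]

/-- The Sobolev space `H^m(Ω)`. A function `w ∈ H^m(Ω)` is recorded together with its weak
derivatives as the family `(∂^α w)_{|α| ≤ m}` in `L²(Ω)` (they are determined by `w = ∂^0 w`),
so that the norm inherited by the subspace is the usual one,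
`‖w‖_m² = ∑_{|α| ≤ m} ‖∂^α w‖²`. -/
def Sobolev {d : ℕ} (Ω : Set (Pt d)) (m : ℕ) :
    Submodule ℝ (PiLp 2 fun _ : multiIdx d m => L2 Ω) where
  carrier := {g | ∀ (α β : multiIdx d m) (i : Fin d),
    (β : Fin d → ℕ) = (α : Fin d → ℕ) + Pi.single i 1 → HasWeakPartial Ω i (g α) (g β)}
  zero_mem' := by
    intro α β i _
    rw [hasWeakPartial_iff]
    intro φ h
    simp
  add_mem' := by
    intro a b ha hb α β i hβ
    rw [hasWeakPartial_iff]
    intro φ h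
    have h1 := hasWeakPartial_iff.1 (ha α β i hβ) φ h
    have h2 := hasWeakPartial_iff.1 (hb α β i hβ) φ h
    rw [PiLp.add_apply, PiLp.add_apply, inner_add_right, inner_add_right, h1, h2]
    ring
  smul_mem' := by
    intro c a ha α β i hβ
    rw [hasWeakPartial_iff]
    intro φ h
    have h1 := hasWeakPartial_iff.1 (ha α β i hβ) φ h
    rw [PiLp.smul_apply, PiLp.smul_apply, real_inner_smul_right, real_inner_smul_right, h1]
    ring

/-- `H^m(Ω)` is complete, so that Bochner integrals of `H^m(Ω)`-valued functions make sense. -/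
instance {d : ℕ} (Ω : Set (Pt d)) (m : ℕ) : CompleteSpace (Sobolev Ω m) := by
  have hc : IsClosed ((Sobolev Ω m : Submodule ℝ _) :
      Set (PiLp 2 fun _ : multiIdx d m => L2 Ω)) := by
    have : ((Sobolev Ω m : Submodule ℝ _) : Set (PiLp 2 fun _ : multiIdx d m => L2 Ω))
        = ⋂ (α : multiIdx d m) (β : multiIdx d m) (i : Fin d)
            (_ : (β : Fin d → ℕ) = (α : Fin d → ℕ) + Pi.single i 1) (φ : Pt d → ℝ) (h : IsTestFun Ω φ),
          {g | inner ℝ ((h.memLp_pd i).toLp) (g α) = - inner ℝ (h.memLp.toLp) (g β)} := by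
      ext g
      simp only [Set.mem_iInter, Set.mem_ofPred_eq]
      exact forall₄_congr fun α β i _ => hasWeakPartial_iff
    rw [this]
    refine isClosed_iInter fun α => isClosed_iInter fun β => isClosed_iInter fun i =>
      isClosed_iInter fun _ => isClosed_iInter fun φ => isClosed_iInter fun h => ?_
    exact isClosed_eq (by fun_prop) (by fun_prop)
  exact hc.completeSpace_coe

/-- The underlying `L²` function of `w ∈ H^m(Ω)`. -/
def val {d : ℕ} {Ω : Set (Pt d)} {m : ℕ} (w : Sobolev Ω m) : L2 Ω :=
  w.1 ⟨0, zero_mem_multiIdx d m⟩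

/-- The inclusion `H^n(Ω) ⊆ H^m(Ω)` for `m ≤ n`. -/
def incl {d : ℕ} {Ω : Set (Pt d)} {m n : ℕ} (h : m ≤ n) (w : Sobolev Ω n) : Sobolev Ω m :=
  ⟨WithLp.toLp 2 fun α => w.1 ⟨α, multiIdx_mono h α.2⟩,
    fun α β i hβ => w.2 ⟨α, multiIdx_mono h α.2⟩ ⟨β, multiIdx_mono h β.2⟩ i hβ⟩

/-- The weak partial derivative `∂_i : H^{m+1}(Ω) → H^m(Ω)`. -/
def wpd {d : ℕ} {Ω : Set (Pt d)} {m : ℕ} (i : Fin d) (w : Sobolev Ω (m + 1)) : Sobolev Ω m :=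
  ⟨WithLp.toLp 2 fun α => w.1 ⟨(α : Fin d → ℕ) + Pi.single i 1, add_single_mem_multiIdx i α.2⟩,
    fun α β l hβ => w.2 ⟨(α : Fin d → ℕ) + Pi.single i 1, add_single_mem_multiIdx i α.2⟩
      ⟨(β : Fin d → ℕ) + Pi.single i 1, add_single_mem_multiIdx i β.2⟩ l
      (by simp only [hβ]; exact add_right_comm _ _ _)⟩

/-- `H_0^1(Ω)`: the closure of `C_c^∞(Ω)` in `H^1(Ω)`. -/
def H10 {d : ℕ} (Ω : Set (Pt d)) : Submodule ℝ (Sobolev Ω 1) :=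
  (Submodule.span ℝ {w : Sobolev Ω 1 | ∃ φ : Pt d → ℝ, IsTestFun Ω φ ∧
    (val w : Pt d → ℝ) =ᵐ[(volume : Measure (Pt d)).restrict Ω] φ}).topologicalClosure

/-! ### Vector fields -/

/-- `L²(Ω)^d`. -/
abbrev L2V {d : ℕ} (Ω : Set (Pt d)) := PiLp 2 fun _ : Fin d => L2 Ω

/-- `H^m(Ω)^d` with its norm `‖·‖_m`. -/
abbrev SobolevV {d : ℕ} (Ω : Set (Pt d)) (m : ℕ) := PiLp 2 fun _ : Fin d => Sobolev Ω m

/-- The underlying `L²` vector field. -/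
def valV {d : ℕ} {Ω : Set (Pt d)} {m : ℕ} (w : SobolevV Ω m) : L2V Ω :=
  WithLp.toLp 2 fun c => val (w c)

/-- The inclusion `H^{m+1}(Ω)^d ⊆ H^1(Ω)^d`. -/
def toH1 {d : ℕ} {Ω : Set (Pt d)} {m : ℕ} (w : SobolevV Ω (m + 1)) : SobolevV Ω 1 :=
  WithLp.toLp 2 fun c => incl (Nat.le_add_left 1 m) (w c)

/-- The velocity space `X = H_0^1(Ω)^d`. -/
def X {d : ℕ} (Ω : Set (Pt d)) : Submodule ℝ (SobolevV Ω 1) where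
  carrier := {v | ∀ c, v c ∈ H10 Ω}
  zero_mem' := fun _ => (H10 Ω).zero_mem
  add_mem' := fun ha hb c => (H10 Ω).add_mem (ha c) (hb c)
  smul_mem' := fun a _ hv c => (H10 Ω).smul_mem a (hv c)

/-- `q` has mean value zero, that is, `q` lies in the pressure space `Q = L_0^2(Ω)`. -/
def MeanZero {d : ℕ} {Ω : Set (Pt d)} (q : L2 Ω) : Prop := ∫ x in Ω, q x = 0

/-- `‖w‖²`, the squared `L²` norm. -/
def nsq {d : ℕ} {Ω : Set (Pt d)} {m : ℕ} (w : SobolevV Ω m) : ℝ := ‖valV w‖ ^ 2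

/-- `‖∇w‖_m²`. For `m = 0` this is the squared `L²` norm of the gradient. -/
def gradNsq {d : ℕ} {Ω : Set (Pt d)} {m : ℕ} (w : SobolevV Ω (m + 1)) : ℝ :=
  ∑ c, ∑ i, ‖wpd i (w c)‖ ^ 2

/-- `(∇v, ∇w)`. -/
def gradInner {d : ℕ} {Ω : Set (Pt d)} (v w : SobolevV Ω 1) : ℝ :=
  ∑ c, ∑ i, inner ℝ (val (wpd i (v c))) (val (wpd i (w c)))

/-- `∇·v`. -/
def dvg {d : ℕ} {Ω : Set (Pt d)} (v : SobolevV Ω 1) : L2 Ω := ∑ i, val (wpd i (v i))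

/-- `(u·∇v, w)`. -/
def conv {d : ℕ} {Ω : Set (Pt d)} (u v w : SobolevV Ω 1) : ℝ :=
  ∫ x in Ω, ∑ c, ∑ i, val (u i) x * val (wpd i (v c)) x * val (w c) x

/-- `b*(u,v,w) = ½ (u·∇v, w) - ½ (u·∇w, v)`. -/
def bStar {d : ℕ} {Ω : Set (Pt d)} (u v w : SobolevV Ω 1) : ℝ :=
  1 / 2 * conv u v w - 1 / 2 * conv u w v

/-! ### Regular solutions of the Navier–Stokes equations -/

/-- On `[0,T]` the function `v` is absolutely continuous with derivative `v'`. -/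
def IsPrimitive {Y : Type*} [NormedAddCommGroup Y] [NormedSpace ℝ Y] (T : ℝ)
    (v v' : ℝ → Y) : Prop :=
  IntegrableOn v' (Set.Icc 0 T) ∧ ∀ t ∈ Set.Icc (0 : ℝ) T, v t = v 0 + ∫ r in (0 : ℝ)..t, v' r

/-- A function `u : [0,T] → Y` with its first three time derivatives. -/
structure TimeJet (Y : Type*) where
  u : ℝ → Y
  ut : ℝ → Y
  utt : ℝ → Y
  uttt : ℝ → Y

/-- `u ∈ H³(0,T;Y)` (continuous representative), with time derivatives `u_t`, `u_tt`, `u_ttt`. -/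
structure TimeJet.IsH3 {Y : Type*} [NormedAddCommGroup Y] [NormedSpace ℝ Y]
    (U : TimeJet Y) (T : ℝ) : Prop where
  prim : IsPrimitive T U.u U.ut
  prim_t : IsPrimitive T U.ut U.utt
  prim_tt : IsPrimitive T U.utt U.uttt
  memLp_ttt : MemLp U.uttt 2 ((volume : Measure ℝ).restrict (Set.Icc 0 T))

/-- `(u, p)` solves the Navier–Stokes equations on `Ω × [0,T]` with homogeneous Dirichlet
boundary values and body force `f`, with `u ∈ H³(0,T;H^{k+1}(Ω))`, `p ∈ L²(0,T;H^{s+1}(Ω))`,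
`f ∈ L²(0,T;L²(Ω))`. The values of `p` and `f` at the time levels enter the method and the error
bound, so `p` and `f` are defined at every time and the equations hold at every time. -/
structure IsNSESolution {d : ℕ} (Ω : Set (Pt d)) (k s : ℕ) (ν T : ℝ)
    (U : TimeJet (SobolevV Ω (k + 1))) (p : ℝ → Sobolev Ω (s + 1)) (f : ℝ → L2V Ω) : Prop where
  regular_u : U.IsH3 T
  regular_p : MemLp p 2 ((volume : Measure ℝ).restrict (Set.Icc 0 T))
  regular_f : MemLp f 2 ((volume : Measure ℝ).restrict (Set.Icc 0 T))
  boundary : ∀ t ∈ Set.Icc 0 T, toH1 (U.u t) ∈ X Ω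
  pressure : ∀ t ∈ Set.Icc 0 T, MeanZero (val (p t))
  divFree : ∀ t ∈ Set.Icc 0 T, dvg (toH1 (U.u t)) = 0
  momentum : ∀ t ∈ Set.Icc 0 T, ∀ v ∈ X Ω,
    inner ℝ (valV (U.ut t)) (valV v) + conv (toH1 (U.u t)) (toH1 (U.u t)) v
      + ν * gradInner (toH1 (U.u t)) v - inner ℝ (val (p t)) (dvg v) = inner ℝ (f t) (valV v)

/-! ### Finite element spaces -/

/-- Conforming finite element spaces `Xh ⊆ X`, `Qh ⊆ Q` with mesh width `h` and approximation
orders `k` (velocity) and `s` (pressure), satisfying the discrete inf-sup condition with constant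
`β` and the inverse inequality with constant `Cinv`. -/
structure IsFEPair {d : ℕ} (Ω : Set (Pt d)) (k s : ℕ) (Cinv β Capp h : ℝ)
    (Xh : Submodule ℝ (SobolevV Ω 1)) (Qh : Submodule ℝ (L2 Ω)) : Prop where
  h_pos : 0 < h
  h_le : h ≤ Metric.diam Ω
  finite_X : FiniteDimensional ℝ Xh
  finite_Q : FiniteDimensional ℝ Qh
  conforming_X : Xh ≤ X Ω
  conforming_Q : ∀ q ∈ Qh, MeanZero q
  /-- `β ‖q‖ ≤ sup_{v ∈ Xh, v ≠ 0} (q, ∇·v) / ‖∇v‖`; the supremum is attained. -/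
  lbb : ∀ q ∈ Qh, ∃ v ∈ Xh, gradNsq v ≤ 1 ∧ β * ‖q‖ ≤ inner ℝ q (dvg v)
  inverse : ∀ v ∈ Xh, h * Real.sqrt (gradNsq v) ≤ Cinv * Real.sqrt (nsq v)
  approx_X : ∀ w : SobolevV Ω (k + 1), toH1 w ∈ X Ω →
    ∃ v ∈ Xh, Real.sqrt (gradNsq (toH1 w - v)) ≤ Capp * h ^ k * ‖w‖
  approx_Q : ∀ r : Sobolev Ω (s + 1), MeanZero (val r) →
    ∃ q ∈ Qh, ‖val r - q‖ ≤ Capp * h ^ (s + 1) * ‖r‖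

/-! ### The method -/

/-- The extrapolation `3 uⁿ - 3 uⁿ⁻¹ + uⁿ⁻²` (for `n ≥ 2`). -/
def extrap {Y : Type*} [AddCommGroup Y] [Module ℝ Y] (u : ℕ → Y) (n : ℕ) : Y :=
  (3 : ℝ) • u n - (3 : ℝ) • u (n - 1) + u (n - 2)

/-- The third difference `uⁿ⁺¹ - 3 uⁿ + 3 uⁿ⁻¹ - uⁿ⁻²` (for `n ≥ 2`). -/
def thirdDiff {Y : Type*} [AddCommGroup Y] [Module ℝ Y] (u : ℕ → Y) (n : ℕ) : Y :=
  u (n + 1) - (3 : ℝ) • u n + (3 : ℝ) • u (n - 1) - u (n - 2)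

/-- The blended difference quotient `(10 uⁿ⁺¹ - 15 uⁿ + 6 uⁿ⁻¹ - uⁿ⁻²) / (6 Δt)` (for `n ≥ 2`). -/
def blendedBDF {Y : Type*} [AddCommGroup Y] [Module ℝ Y] (Δt : ℝ) (u : ℕ → Y) (n : ℕ) : Y :=
  (6 * Δt)⁻¹ • ((10 : ℝ) • u (n + 1) - (15 : ℝ) • u n + (6 : ℝ) • u (n - 1) - u (n - 2))

/-- The ensemble mean `⟨u⟩ⁿ`. -/
def ensMean {Y : Type*} [AddCommGroup Y] [Module ℝ Y] {J : ℕ} (u : Fin J → ℕ → Y) (n : ℕ) : Y :=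
  (J : ℝ)⁻¹ • ∑ j, extrap (u j) n

/-- The fluctuation `u_j'ⁿ`. -/
def fluct {Y : Type*} [AddCommGroup Y] [Module ℝ Y] {J : ℕ} (u : Fin J → ℕ → Y)
    (j : Fin J) (n : ℕ) : Y :=
  extrap (u j) n - ensMean u n

/-- `(uh, ph)` is computed by the fully discrete method with time step `Δt` and `NT` steps, from
arbitrary starting values `uh j 0`, `uh j 1`, `uh j 2` in `Xh`. -/
structure IsEnBlendedBDF {d : ℕ} {Ω : Set (Pt d)} {J : ℕ} (ν Δt : ℝ) (NT : ℕ)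
    (Xh : Submodule ℝ (SobolevV Ω 1)) (Qh : Submodule ℝ (L2 Ω)) (f : Fin J → ℝ → L2V Ω)
    (uh : Fin J → ℕ → SobolevV Ω 1) (ph : Fin J → ℕ → L2 Ω) : Prop where
  mem_X : ∀ j, ∀ n ≤ NT, uh j n ∈ Xh
  mem_Q : ∀ j n, 2 ≤ n → n < NT → ph j (n + 1) ∈ Qh
  momentum : ∀ j n, 2 ≤ n → n < NT → ∀ v ∈ Xh,
    inner ℝ (valV (blendedBDF Δt (uh j) n)) (valV v)
      + bStar (ensMean uh n) (uh j (n + 1)) v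
      + bStar (fluct uh j n) (extrap (uh j) n) v
      - inner ℝ (ph j (n + 1)) (dvg v)
      + ν * gradInner (uh j (n + 1)) v
      = inner ℝ (f j (((n + 1 : ℕ) : ℝ) * Δt)) (valV v)
  divFree : ∀ j n, 2 ≤ n → n < NT → ∀ q ∈ Qh, inner ℝ (dvg (uh j (n + 1))) q = 0

/-! ### The quantities of the error estimate -/

/-- The energy at time level `N ≥ 2`. -/
def levelEnergy {d : ℕ} {Ω : Set (Pt d)} (ν Δt : ℝ) (e : ℕ → SobolevV Ω 1) (N : ℕ) : ℝ :=
  1 / 2 * nsq (e N) + 1 / 2 * nsq ((3 : ℝ) • e N - e (N - 1)) + 1 / 2 * nsq (extrap e N)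
    + 3 * ν * Δt / 16 * gradNsq (e N)
    + 3 * ν * Δt / 8 * (gradNsq (e N) + gradNsq (e (N - 1)))
    + 3 * ν * Δt / 16 * gradNsq (e (N - 2))

/-- The consistency and approximation terms of the error estimate, without the factor `C`.
Sums over `n = 0, …, NT` are squared discrete norms in time, integrals are squared `L²(0,T)`
norms. -/
def dataTerms {d : ℕ} {Ω : Set (Pt d)} {k s : ℕ} (ν T Δt h : ℝ) (NT : ℕ)
    (U : TimeJet (SobolevV Ω (k + 1))) (p : ℝ → Sobolev Ω (s + 1)) : ℝ :=
  h ^ (2 * k) / ν * (⨆ n : Fin (NT + 1), gradNsq (toH1 (U.u (n * Δt))))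
      * (∑ n ∈ range (NT + 1), Δt * ‖U.u (n * Δt)‖ ^ 2)
    + Δt ^ 6 / ν * (∫ t in (0 : ℝ)..T, gradNsq (toH1 (U.uttt t)))
    + h ^ (2 * k) / ν * (∑ n ∈ range (NT + 1), Δt * gradNsq (U.u (n * Δt)))
    + Δt ^ 4 * h ^ (2 * k + 1) * (∫ t in (0 : ℝ)..T, gradNsq (U.uttt t))
    + Δt ^ 5 * h * (∫ t in (0 : ℝ)..T, gradNsq (toH1 (U.uttt t)))
    + h ^ (2 * s + 2) / ν * (∑ n ∈ range (NT + 1), Δt * ‖p (n * Δt)‖ ^ 2)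
    + h ^ (2 * k + 2) / ν * (∫ t in (0 : ℝ)..T, ‖U.ut t‖ ^ 2)
    + ν * h ^ (2 * k) * (∑ n ∈ range (NT + 1), Δt * gradNsq (U.u (n * Δt)))
    + Δt ^ 4 / ν * (∫ t in (0 : ℝ)..T, nsq (U.uttt t))

end EnBDF

end

open EnBDF

/-! The error is split as `e = η + ξ`, where `η = u - P u` is an approximation error and `ξ = P u -
u_h` lies in the finite element space. `P` is the linear projection onto the discretely divergence
free fields that minimises `‖∇(w - P w)‖`. The inf-sup condition gives it the approximation order of
the full velocity space (`exists_of_infSup`, `IsFEPair.exists_discDivFree_approx`).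

The difference of the exact and the discrete equation is tested with the newest `ξ`. The blended
difference quotient is G-stable (`inner_blended`): it yields the increment of an energy plus half
the squared third difference of `ξ`. The viscous term yields `‖∇ξ‖²`. The discrete pressure drops
out, and only `p - q` with `q` in the discrete space remains of the exact one. The forms `b*(·, ξ,
ξ)` vanish, and the convection error falls into nine terms. Two kinds of them are delicate.

The terms containing the extrapolation of `ξ` in the first slot are bounded with `√(‖Eξ‖ ‖∇Eξ‖)`. A
small multiple of `‖∇Eξ‖²` is absorbed by the viscosity of older levels, and `‖Eξ‖²` is left to
Gronwall. Since `½‖Eξ‖²` is part of the energy at the old level, the Gronwall argument is explicit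
and needs no restriction on the time step.

The fluctuation acts on the third difference of `ξ`. Its bound contains `√(‖D‖ ‖∇D‖)` with `D` that
difference. The inverse inequality replaces `‖∇D‖` by `‖D‖/h`, and the time step condition absorbs
the result in the numerical dissipation and the viscosity (`step_absorb`, `energy_step`). This fixes
the constant of the time step condition, which involves only `Cinv` and the constant `B` of the
trilinear form. `B` comes from the Sobolev embedding of `H_0^1` into `L⁶` and Hölder's inequality
(`exists_formBound`).

The temporal consistency errors are Taylor remainders, because both the third difference and the
quotient minus the derivative annihilate quadratic polynomials. Their sums give exactly the terms
with `u_ttt` in the data.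

For the approximation errors, linearity of `P` makes each difference of `η` the approximation error
of the same difference of `u`. Hence each is bounded by `h^k` times a quantity of the fixed
solution. The constant of the theorem may depend on that solution, so it suffices to bound `h^(2k)`
by a multiple of the data terms. This needs a lower bound, uniform in the number of steps, for the
discrete norm of `∇u` together with the integral of `‖∇u_ttt‖²` (`TimeJet.IsH3.exists_le_jetSize`).
Such a bound holds unless `∇u` vanishes identically, and in that case the gradient of `η` is zero as
well (`exists_approxBound`). -/

noncomputable section

namespace EnBDF

variable {d : ℕ} {Ω : Set (Pt d)}

/-! ### The operators of vector calculus as continuous linear maps -/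

/-- The multi-index of `∂_i`, in the form in which it appears in `wpd`. -/
def firstIdx (d m : ℕ) (i : Fin d) : multiIdx d (m + 1) :=
  ⟨(0 : Fin d → ℕ) + Pi.single i 1, add_single_mem_multiIdx i (zero_mem_multiIdx d m)⟩

/-- The `α`-th weak derivative of a Sobolev function. -/
def derivL (m : ℕ) (α : multiIdx d m) : Sobolev Ω m →L[ℝ] L2 Ω :=
  (PiLp.proj 2 (fun _ : multiIdx d m => L2 Ω) α).comp (Sobolev Ω m).subtypeL

/-- `valV` as a continuous linear map. -/
def valL (m : ℕ) : SobolevV Ω m →L[ℝ] L2V Ω :=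
  (PiLp.continuousLinearEquiv 2 ℝ (fun _ : Fin d => L2 Ω)).symm.toContinuousLinearMap.comp
    (ContinuousLinearMap.pi fun c =>
      (derivL m ⟨0, zero_mem_multiIdx d m⟩).comp (PiLp.proj 2 (fun _ : Fin d => Sobolev Ω m) c))

/-- The space of `L²` gradients of vector fields. -/
abbrev GradSpace (Ω : Set (Pt d)) := PiLp 2 fun _ : Fin d × Fin d => L2 Ω

/-- The `L²` gradient of a vector field as a continuous linear map. -/
def gradL (m : ℕ) : SobolevV Ω (m + 1) →L[ℝ] GradSpace Ω :=
  (PiLp.continuousLinearEquiv 2 ℝ (fun _ : Fin d × Fin d => L2 Ω)).symm.toContinuousLinearMap.comp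
    (ContinuousLinearMap.pi fun q =>
      (derivL (m + 1) (firstIdx d m q.2)).comp
        (PiLp.proj 2 (fun _ : Fin d => Sobolev Ω (m + 1)) q.1))

/-- The trace `GradSpace Ω → L²(Ω)`, which maps `∇v` to `∇·v`. -/
def traceL (Ω : Set (Pt d)) : GradSpace Ω →L[ℝ] L2 Ω :=
  ∑ i, PiLp.proj 2 (fun _ : Fin d × Fin d => L2 Ω) (i, i)

/-- The gradient on `H^1` as a linear map. -/
def gradM : SobolevV Ω 1 →ₗ[ℝ] GradSpace Ω where
  toFun v := gradL 0 v
  map_add' := (gradL 0).map_add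
  map_smul' := (gradL 0).map_smul

/-- The underlying `L²` field of an `H^1` field, as a linear map. -/
def valM : SobolevV Ω 1 →ₗ[ℝ] L2V Ω where
  toFun v := valV v
  map_add' := (valL 1).map_add
  map_smul' := (valL 1).map_smul

theorem gradM_apply (w : SobolevV Ω 1) (c i : Fin d) : gradM w (c, i) = val (wpd i (w c)) := rfl

theorem dvg_eq (v : SobolevV Ω 1) : dvg v = traceL Ω (gradM v) := by
  simp [dvg, traceL, gradM_apply]

theorem norm_val_le {m : ℕ} (w : Sobolev Ω m) : ‖val w‖ ≤ ‖w‖ :=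
  PiLp.norm_apply_le (p := 2) (w : PiLp 2 fun _ : multiIdx d m => L2 Ω) ⟨0, zero_mem_multiIdx d m⟩

/-- The zero multi-index is the only one of order zero, so the sum defining the norm has a single
term. -/
theorem norm_eq_norm_val (w : Sobolev Ω 0) : ‖w‖ = ‖val w‖ := by
  have hu : ∀ α : multiIdx d 0, α = ⟨0, zero_mem_multiIdx d 0⟩ := by
    intro α
    apply Subtype.ext
    have := mem_multiIdx.1 α.2
    funext i
    exact Nat.le_zero.1 ((Finset.single_le_sum (f := (α : Fin d → ℕ)) (fun _ _ => Nat.zero_le _)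
      (Finset.mem_univ i)).trans this)
  refine le_antisymm ?_ (norm_val_le w)
  have : ‖(w : PiLp 2 fun _ : multiIdx d 0 => L2 Ω)‖ ^ 2 ≤ ‖val w‖ ^ 2 := by
    rw [PiLp.norm_sq_eq_of_L2]
    rw [Finset.sum_eq_single (⟨0, zero_mem_multiIdx d 0⟩ : multiIdx d 0)]
    · rfl
    · intro b _ hb
      exact absurd (hu b) hb
    · intro h
      exact absurd (Finset.mem_univ _) h
  exact (sq_le_sq₀ (norm_nonneg _) (norm_nonneg _)).1 this

theorem nsq_eq {m : ℕ} (w : SobolevV Ω m) : nsq w = ‖valL m w‖ ^ 2 := rfl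

theorem gradNsq_eq (w : SobolevV Ω 1) : gradNsq w = ‖gradM w‖ ^ 2 := by
  rw [PiLp.norm_sq_eq_of_L2, Fintype.sum_prod_type]
  simp only [gradNsq, gradM_apply, norm_eq_norm_val]

theorem gradNsq_nonneg {m : ℕ} (w : SobolevV Ω (m + 1)) : 0 ≤ gradNsq w :=
  Finset.sum_nonneg fun _ _ => Finset.sum_nonneg fun _ _ => by positivity

theorem nsq_nonneg {m : ℕ} (w : SobolevV Ω m) : 0 ≤ nsq w := by
  rw [nsq_eq]; positivity

theorem gradNsq_toH1_le {m : ℕ} (w : SobolevV Ω (m + 1)) : gradNsq (toH1 w) ≤ gradNsq w := by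
  refine Finset.sum_le_sum fun c _ => Finset.sum_le_sum fun i _ => ?_
  rw [norm_eq_norm_val]
  exact pow_le_pow_left₀ (norm_nonneg _) (norm_val_le (wpd i (w c))) 2

theorem gradInner_eq (v w : SobolevV Ω 1) : gradInner v w = inner ℝ (gradM v) (gradM w) := by
  rw [PiLp.inner_apply, Fintype.sum_prod_type]
  rfl

/-- `toH1` as a linear map. -/
def toH1L (m : ℕ) : SobolevV Ω (m + 1) →ₗ[ℝ] SobolevV Ω 1 where
  toFun := toH1
  map_add' _ _ := rfl
  map_smul' _ _ := rfl

end EnBDF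
end

noncomputable section

namespace EnBDF

variable {d : ℕ} {Ω : Set (Pt d)}

/-! ### Test functions and weak derivatives -/

theorem IsTestFun.zero : IsTestFun Ω (0 : Pt d → ℝ) :=
  ⟨contDiff_const, HasCompactSupport.zero, by simp [tsupport]⟩

theorem IsTestFun.add {φ ψ : Pt d → ℝ} (hφ : IsTestFun Ω φ) (hψ : IsTestFun Ω ψ) :
    IsTestFun Ω (φ + ψ) :=
  ⟨hφ.1.add hψ.1, hφ.2.1.add hψ.2.1,
    (tsupport_add φ ψ).trans (Set.union_subset hφ.2.2 hψ.2.2)⟩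

theorem IsTestFun.const_smul {φ : Pt d → ℝ} (a : ℝ) (hφ : IsTestFun Ω φ) :
    IsTestFun Ω (a • φ) :=
  ⟨contDiff_const.smul hφ.1, hφ.2.1.smul_left (f := fun _ => a),
    (closure_mono (Function.support_const_smul_subset a φ)).trans hφ.2.2⟩

theorem IsTestFun.mul {φ ψ : Pt d → ℝ} (hφ : IsTestFun Ω φ) (hψ : IsTestFun Ω ψ) :
    IsTestFun Ω (φ * ψ) :=
  ⟨hφ.1.mul hψ.1, hφ.2.1.mul_right, (tsupport_mul_subset_left).trans hφ.2.2⟩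

theorem IsTestFun.continuous_pd {φ : Pt d → ℝ} (hφ : IsTestFun Ω φ) (i : Fin d) :
    Continuous (pd i φ) :=
  (hφ.1.continuous_fderiv (by simp)).clm_apply continuous_const

theorem IsTestFun.differentiable {φ : Pt d → ℝ} (hφ : IsTestFun Ω φ) : Differentiable ℝ φ :=
  hφ.1.differentiable (by simp)

theorem IsTestFun.pd_mul {φ ψ : Pt d → ℝ} (hφ : IsTestFun Ω φ) (hψ : IsTestFun Ω ψ) (i : Fin d)
    (x : Pt d) : pd i (φ * ψ) x = φ x * pd i ψ x + pd i φ x * ψ x := by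
  simp only [pd]
  rw [fderiv_mul (hφ.differentiable x) (hψ.differentiable x)]
  simp
  ring

/-- Integration by parts for test functions. -/
theorem IsTestFun.integral_mul_pd {φ ψ : Pt d → ℝ} (hφ : IsTestFun Ω φ) (hψ : IsTestFun Ω ψ)
    (i : Fin d) : ∫ x in Ω, φ x * pd i ψ x = - ∫ x in Ω, pd i φ x * ψ x := by
  have e1 : ∫ x in Ω, φ x * pd i ψ x = ∫ x, φ x * pd i ψ x := by
    apply setIntegral_eq_integral_of_forall_compl_eq_zero
    intro x hx
    have : φ x = 0 := by
      by_contra h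
      exact hx (hφ.2.2 (subset_tsupport _ h))
    simp [this]
  have e2 : ∫ x in Ω, pd i φ x * ψ x = ∫ x, pd i φ x * ψ x := by
    apply setIntegral_eq_integral_of_forall_compl_eq_zero
    intro x hx
    have : ψ x = 0 := by
      by_contra h
      exact hx (hψ.2.2 (subset_tsupport _ h))
    simp [this]
  rw [e1, e2]
  have c1 := hφ.1.continuous
  have c2 := hψ.1.continuous
  have c3 := hφ.continuous_pd i
  have c4 := hψ.continuous_pd i
  refine integral_mul_fderiv_eq_neg_fderiv_mul_of_integrable ?_ ?_ ?_
    (fun x _ => hφ.differentiable x) (fun x _ => hψ.differentiable x)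
  · exact (c3.mul c2).integrable_of_hasCompactSupport (hψ.2.1.mul_left)
  · exact (c1.mul c4).integrable_of_hasCompactSupport (hφ.2.1.mul_right)
  · exact (c1.mul c2).integrable_of_hasCompactSupport (hφ.2.1.mul_right)

theorem hasWeakPartial_wpd (i : Fin d) (w : Sobolev Ω 1) :
    HasWeakPartial Ω i (val w) (val (wpd i w)) :=
  w.2 ⟨0, zero_mem_multiIdx d 1⟩ (firstIdx d 0 i) i rfl

/-- The Sobolev function `w` is represented by a test function. -/
def IsTestRep (w : Sobolev Ω 1) (φ : Pt d → ℝ) : Prop :=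
  IsTestFun Ω φ ∧ (val w : Pt d → ℝ) =ᵐ[(volume : Measure (Pt d)).restrict Ω] φ

/-- The weak derivative of a test function is its classical derivative. -/
theorem IsTestRep.wpd_ae_eq (hΩo : IsOpen Ω) (hΩb : Bornology.IsBounded Ω) {w : Sobolev Ω 1}
    {φ : Pt d → ℝ} (h : IsTestRep w φ) (i : Fin d) :
    (val (wpd i w) : Pt d → ℝ) =ᵐ[(volume : Measure (Pt d)).restrict Ω] pd i φ := by
  have : IsFiniteMeasure ((volume : Measure (Pt d)).restrict Ω) :=
    ⟨by simpa using hΩb.measure_lt_top⟩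
  have hintegrable : Integrable (fun x => val (wpd i w) x - pd i φ x)
      ((volume : Measure (Pt d)).restrict Ω) :=
    ((Lp.memLp _).integrable (by norm_num)).sub ((h.1.memLp_pd i).integrable (by norm_num))
  -- Fundamental lemma of the calculus of variations: the weak and the classical derivative have the
  -- same integral against every test function.
  have key := hΩo.ae_eq_zero_of_integral_contDiff_smul_eq_zero (μ := volume)
    (f := fun x => val (wpd i w) x - pd i φ x)
    (IntegrableOn.locallyIntegrableOn (show IntegrableOn _ Ω volume from hintegrable)) ?_
  · have := (ae_restrict_iff' hΩo.measurableSet).2 key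
    filter_upwards [this] with x hx
    linarith
  · intro ψ h1 h2 h3
    have hψ : IsTestFun Ω ψ := ⟨h1, h2, h3⟩
    have e0 : ∫ x, ψ x • (val (wpd i w) x - pd i φ x)
        = ∫ x in Ω, ψ x • (val (wpd i w) x - pd i φ x) := by
      refine (setIntegral_eq_integral_of_forall_compl_eq_zero ?_).symm
      intro x hx
      have : ψ x = 0 := by
        by_contra h
        exact hx (h3 (subset_tsupport _ h))
      simp [this]
    have e1 := hasWeakPartial_wpd i w ψ hψ
    have e2 := h.1.integral_mul_pd hψ i
    have e3 : ∫ x in Ω, val w x * pd i ψ x = ∫ x in Ω, φ x * pd i ψ x := by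
      refine integral_congr_ae ?_
      filter_upwards [h.2] with x hx
      rw [hx]
    rw [e0]
    have i1 : Integrable (fun x => val (wpd i w) x * ψ x)
        ((volume : Measure (Pt d)).restrict Ω) :=
      (Lp.memLp (val (wpd i w))).integrable_mul hψ.memLp
    have i2 : Integrable (fun x => pd i φ x * ψ x)
        ((volume : Measure (Pt d)).restrict Ω) :=
      (h.1.memLp_pd i).integrable_mul hψ.memLp
    have e4 : ∫ x in Ω, ψ x • (val (wpd i w) x - pd i φ x)
        = ∫ x in Ω, val (wpd i w) x * ψ x - pd i φ x * ψ x := by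
      congr 1
      funext x
      simp only [smul_eq_mul]
      ring
    rw [e4, integral_sub i1 i2]
    linarith

theorem val_add {m : ℕ} (a b : Sobolev Ω m) : val (a + b) = val a + val b := rfl

theorem wpd_add {m : ℕ} (i : Fin d) (a b : Sobolev Ω (m + 1)) :
    wpd i (a + b) = wpd i a + wpd i b := rfl

/-- The span of the test functions consists of test functions. -/
theorem exists_isTestRep_of_mem_span {w : Sobolev Ω 1}
    (hw : w ∈ Submodule.span ℝ {w : Sobolev Ω 1 | ∃ φ : Pt d → ℝ, IsTestFun Ω φ ∧
      (val w : Pt d → ℝ) =ᵐ[(volume : Measure (Pt d)).restrict Ω] φ}) :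
    ∃ φ, IsTestRep w φ := by
  induction hw using Submodule.span_induction with
  | mem x hx => exact hx
  | zero => exact ⟨0, IsTestFun.zero, Lp.coeFn_zero _ _ _⟩
  | add x y _ _ hx hy =>
    obtain ⟨φ, h1, h2⟩ := hx
    obtain ⟨ψ, h3, h4⟩ := hy
    exact ⟨φ + ψ, h1.add h3, (Lp.coeFn_add (val x) (val y)).trans (h2.add h4)⟩
  | smul a x _ hx =>
    obtain ⟨φ, h1, h2⟩ := hx
    exact ⟨a • φ, h1.const_smul a, (Lp.coeFn_smul a (val x)).trans (h2.const_smul a)⟩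

/-- Every `H_0^1` function is a limit of test functions. -/
theorem exists_seq_isTestRep {w : Sobolev Ω 1} (hw : w ∈ H10 Ω) :
    ∃ a : ℕ → Sobolev Ω 1, (∀ n, a n ∈ H10 Ω ∧ ∃ φ, IsTestRep (a n) φ) ∧
      Filter.Tendsto a Filter.atTop (nhds w) := by
  rw [H10, ← SetLike.mem_coe, Submodule.topologicalClosure_coe, mem_closure_iff_seq_limit] at hw
  obtain ⟨a, h1, h2⟩ := hw
  exact ⟨a, fun n => ⟨Submodule.le_topologicalClosure _ (h1 n),
    exists_isTestRep_of_mem_span (h1 n)⟩, h2⟩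

/-- A bounded additive functional on `H_0^1` that vanishes on test functions is zero. -/
theorem eq_zero_of_forall_isTestRep {F : Sobolev Ω 1 → ℝ} {K : ℝ}
    (hsub : ∀ a ∈ H10 Ω, ∀ b ∈ H10 Ω, F (a - b) = F a - F b)
    (hbd : ∀ a ∈ H10 Ω, |F a| ≤ K * ‖a‖)
    (hF : ∀ a ∈ H10 Ω, ∀ φ, IsTestRep a φ → F a = 0) {w : Sobolev Ω 1} (hw : w ∈ H10 Ω) :
    F w = 0 := by
  obtain ⟨a, ha, hlim⟩ := exists_seq_isTestRep hw
  have h1 : ∀ n, |F w| ≤ K * ‖w - a n‖ := by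
    intro n
    obtain ⟨hn, φ, hφ⟩ := ha n
    have := hbd _ ((H10 Ω).sub_mem hw hn)
    rwa [hsub _ hw _ hn, hF _ hn φ hφ, sub_zero] at this
  have h2 : Filter.Tendsto (fun n => K * ‖w - a n‖) Filter.atTop (nhds 0) := by
    have := ((tendsto_const_nhds (x := w)).sub hlim).norm.const_mul K
    simpa using this
  have := ge_of_tendsto' h2 h1
  exact abs_eq_zero.1 (le_antisymm this (abs_nonneg _))

end EnBDF
end

noncomputable section

namespace EnBDF

variable {d : ℕ} {Ω : Set (Pt d)}

/-! ### The Sobolev embedding of `H_0^1` into `L⁶` -/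

theorem norm_fderiv_le_sum_pd (φ : Pt d → ℝ) (x : Pt d) :
    ‖fderiv ℝ φ x‖ ≤ ∑ i, ‖pd i φ x‖ := by
  refine ContinuousLinearMap.opNorm_le_bound _ (Finset.sum_nonneg fun _ _ => norm_nonneg _) ?_
  intro y
  have hy : y = ∑ i, y i • EuclideanSpace.single i (1 : ℝ) := by
    ext l
    simp [Finset.sum_apply, Pi.single_apply]
  conv_lhs => rw [hy, map_sum]
  refine (norm_sum_le _ _).trans ?_
  rw [Finset.sum_mul]
  refine Finset.sum_le_sum fun i _ => ?_
  rw [map_smul, norm_smul, mul_comm]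
  exact mul_le_mul_of_nonneg_left (PiLp.norm_apply_le y i) (norm_nonneg _)

/-- The Gagliardo–Nirenberg–Sobolev inequality for test functions. -/
theorem exists_eLpNorm_six_le_of_isTestFun (hd : d = 2 ∨ d = 3) (hΩb : Bornology.IsBounded Ω) :
    ∃ C : NNReal, ∀ φ : Pt d → ℝ, IsTestFun Ω φ →
      eLpNorm φ 6 ((volume : Measure (Pt d)).restrict Ω)
        ≤ C * ∑ i, eLpNorm (pd i φ) 2 ((volume : Measure (Pt d)).restrict Ω) := by
  -- The exponent whose Sobolev conjugate is 6. In the plane `p = 2` is not admissible, since `p <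
  -- d` is required; `p = 3/2` is used there and raised to 2 on the bounded set afterwards.
  obtain ⟨p, hp1, hp2, hp3, hp4⟩ : ∃ p : NNReal, 1 ≤ p ∧ p < d ∧
      ((p : ℝ)⁻¹ - (d : ℝ)⁻¹ ≤ (6 : ℝ)⁻¹) ∧ p ≤ 2 := by
    rcases hd with rfl | rfl
    · refine ⟨3 / 2, ?_, ?_, ?_, ?_⟩
      · rw [← NNReal.coe_le_coe]; norm_num
      · rw [← NNReal.coe_lt_coe]; norm_num
      · norm_num
      · rw [← NNReal.coe_le_coe]; norm_num
    · refine ⟨2, by norm_num, ?_, ?_, le_rfl⟩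
      · rw [← NNReal.coe_lt_coe]; norm_num
      · norm_num
  have hfin : Module.finrank ℝ (Pt d) = d := by simp
  have : IsFiniteMeasure ((volume : Measure (Pt d)).restrict Ω) :=
    ⟨by simpa using hΩb.measure_lt_top⟩
  set μ := (volume : Measure (Pt d)).restrict Ω with hμ
  set A := eLpNormLESNormFDerivOfLeConst ℝ (volume : Measure (Pt d)) Ω p 6 with hA
  set B : NNReal := (μ Set.univ).toNNReal ^ (1 / (p : ℝ) - 1 / 2) with hB
  refine ⟨A * B, fun φ hφ => ?_⟩
  have h1 : eLpNorm φ ((6 : NNReal) : ENNReal) volume ≤ A * eLpNorm (fderiv ℝ φ) p volume := by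
    refine eLpNorm_le_eLpNorm_fderiv_of_le (μ := volume) (F := ℝ) (s := Ω) (p := p) (q := 6)
      (hφ.1.of_le (by simp)) ((subset_tsupport φ).trans hφ.2.2) hp1 ?_ ?_ hΩb
    · rw [hfin]; exact hp2
    · rw [hfin]
      exact hp3
  rw [show ((6 : NNReal) : ENNReal) = 6 by norm_num] at h1
  have h2 : eLpNorm (fderiv ℝ φ) p volume = eLpNorm (fderiv ℝ φ) p μ := by
    have hsub : Function.support (fun x => ‖fderiv ℝ φ x‖) ⊆ Ω := by
      intro x hx
      exact hφ.2.2 (tsupport_fderiv_subset ℝ (f := φ)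
        (subset_tsupport _ fun h0 => hx (by simp [h0])))
    rw [hμ, ← eLpNorm_norm (fderiv ℝ φ), ← eLpNorm_norm (fderiv ℝ φ),
      eLpNorm_restrict_eq_of_support_subset hsub]
  have hc : Continuous (fderiv ℝ φ) := hφ.1.continuous_fderiv (by simp)
  have h3 : eLpNorm (fderiv ℝ φ) p μ ≤ eLpNorm (fderiv ℝ φ) 2 μ * B := by
    have hp2' : (p : ENNReal) ≤ 2 := by exact_mod_cast hp4
    have := eLpNorm_le_eLpNorm_mul_rpow_measure_univ hp2'
      (hc.aestronglyMeasurable (μ := μ))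
    refine this.trans (le_of_eq ?_)
    congr 1
    have hne : 0 ≤ 1 / (p : ℝ) - 1 / 2 := by
      have : (0 : ℝ) < p := lt_of_lt_of_le one_pos (by exact_mod_cast hp1)
      have : (p : ℝ) ≤ 2 := by exact_mod_cast hp4
      rw [sub_nonneg]
      exact one_div_le_one_div_of_le (by positivity) this
    rw [hB, ENNReal.coe_rpow_of_nonneg _ hne, ENNReal.coe_toNNReal (measure_ne_top _ _)]
    simp
  have h4 : eLpNorm (fderiv ℝ φ) 2 μ ≤ ∑ i, eLpNorm (pd i φ) 2 μ := by
    calc eLpNorm (fderiv ℝ φ) 2 μ ≤ eLpNorm (∑ i, fun x => ‖pd i φ x‖) 2 μ := by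
          refine eLpNorm_mono_real fun x => ?_
          simpa using norm_fderiv_le_sum_pd φ x
      _ ≤ ∑ i, eLpNorm (fun x => ‖pd i φ x‖) 2 μ :=
          eLpNorm_sum_le (fun i _ => (hφ.continuous_pd i).norm.aestronglyMeasurable)
            (by norm_num)
      _ = ∑ i, eLpNorm (pd i φ) 2 μ := by simp only [eLpNorm_norm]
  calc eLpNorm φ 6 μ ≤ eLpNorm φ 6 volume := eLpNorm_mono_measure _ Measure.restrict_le_self
    _ ≤ A * (eLpNorm (fderiv ℝ φ) 2 μ * B) := h1.trans (by rw [h2]; gcongr)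
    _ = (A * B : NNReal) * eLpNorm (fderiv ℝ φ) 2 μ := by push_cast; ring
    _ ≤ _ := by gcongr

/-- `∑_i ‖∂_i w‖`. -/
def gsum (w : Sobolev Ω 1) : ℝ := ∑ i, ‖val (wpd i w)‖

theorem gsum_nonneg (w : Sobolev Ω 1) : 0 ≤ gsum w :=
  Finset.sum_nonneg fun _ _ => norm_nonneg _

theorem continuous_gsum : Continuous (gsum : Sobolev Ω 1 → ℝ) :=
  continuous_finsetSum _ fun i _ => (derivL 1 (firstIdx d 0 i)).continuous.norm

theorem norm_val_wpd_le (w : Sobolev Ω 1) (i : Fin d) : ‖val (wpd i w)‖ ≤ ‖w‖ :=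
  PiLp.norm_apply_le (p := 2) (w : PiLp 2 fun _ : multiIdx d 1 => L2 Ω) (firstIdx d 0 i)

theorem gsum_le (w : Sobolev Ω 1) : gsum w ≤ d * ‖w‖ := by
  refine (Finset.sum_le_sum fun i _ => norm_val_wpd_le w i).trans ?_
  simp

/-- `H_0^1 ⊆ L⁶`. -/
theorem exists_eLpNorm_six_le (hd : d = 2 ∨ d = 3) (hΩo : IsOpen Ω)
    (hΩb : Bornology.IsBounded Ω) :
    ∃ C : NNReal, ∀ w ∈ H10 Ω, eLpNorm (val w) 6 ((volume : Measure (Pt d)).restrict Ω)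
      ≤ C * ENNReal.ofReal (gsum w) := by
  obtain ⟨C, hC⟩ := exists_eLpNorm_six_le_of_isTestFun hd hΩb
  refine ⟨C, fun w hw => ?_⟩
  set μ := (volume : Measure (Pt d)).restrict Ω with hμ
  have htest : ∀ a : Sobolev Ω 1, ∀ φ, IsTestRep a φ →
      eLpNorm (val a) 6 μ ≤ C * ENNReal.ofReal (gsum a) := by
    intro a φ h
    rw [eLpNorm_congr_ae h.2]
    refine (hC φ h.1).trans (le_of_eq ?_)
    rw [gsum, ENNReal.ofReal_sum_of_nonneg fun _ _ => norm_nonneg _]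
    congr 1
    refine Finset.sum_congr rfl fun i _ => ?_
    rw [Lp.norm_def, ENNReal.ofReal_toReal (Lp.eLpNorm_ne_top _)]
    exact eLpNorm_congr_ae (h.wpd_ae_eq hΩo hΩb i).symm
  obtain ⟨a, ha, hlim⟩ := exists_seq_isTestRep hw
  have hval : Filter.Tendsto (fun n => val (a n)) Filter.atTop (nhds (val w)) :=
    ((derivL 1 ⟨0, zero_mem_multiIdx d 1⟩).continuous.tendsto w).comp hlim
  -- The approximating test functions converge in `H^1`, hence almost everywhere along a
  -- subsequence, and Fatou's lemma carries the `L⁶` bound to the limit.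
  obtain ⟨ns, hns, hae⟩ := (tendstoInMeasure_of_tendsto_Lp hval).exists_seq_tendsto_ae
  have h1 := Lp.eLpNorm_lim_le_liminf_eLpNorm (p := 6) (μ := μ) (f := fun n => val (a (ns n)))
    (fun n => Lp.aestronglyMeasurable _) (val w) hae
  refine h1.trans ?_
  have h2 : Filter.Tendsto (fun n => (C : ENNReal) * ENNReal.ofReal (gsum (a (ns n)))) Filter.atTop
      (nhds (C * ENNReal.ofReal (gsum w))) := by
    refine ENNReal.Tendsto.const_mul ?_ (Or.inr ENNReal.coe_ne_top)
    refine ENNReal.tendsto_ofReal ?_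
    exact (continuous_gsum.tendsto w).comp (hlim.comp hns.tendsto_atTop)
  rw [← h2.liminf_eq]
  refine Filter.liminf_le_liminf (Filter.Eventually.of_forall fun n => ?_)
  obtain ⟨_, φ, hφ⟩ := ha (ns n)
  exact htest _ φ hφ

/-! ### Hölder's inequality for three factors -/

/-- Hölder with exponents 6, 2, 3, in which the `L³` norm of the last factor is interpolated between
`L²` and `L⁶`. Writing `|h| = |h|^(1/2) |h|^(1/2)` makes this a single application with the four
weights 1/6, 1/2, 1/4, 1/12. -/
theorem lintegral_enorm_mul_mul_le {α : Type*} [MeasurableSpace α] {μ : Measure α}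
    {f g h : α → ℝ} (hf : AEStronglyMeasurable f μ) (hg : AEStronglyMeasurable g μ)
    (hh : AEStronglyMeasurable h μ) :
    ∫⁻ x, ‖f x * g x * h x‖ₑ ∂μ
      ≤ eLpNorm f 6 μ * eLpNorm g 2 μ * (eLpNorm h 2 μ * eLpNorm h 6 μ) ^ (1 / 2 : ℝ) := by
  have key := ENNReal.lintegral_prod_norm_pow_le (μ := μ) (Finset.univ : Finset (Fin 4))
    (f := ![fun x => ‖f x‖ₑ ^ (6 : ℝ), fun x => ‖g x‖ₑ ^ (2 : ℝ), fun x => ‖h x‖ₑ ^ (2 : ℝ),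
      fun x => ‖h x‖ₑ ^ (6 : ℝ)]) (p := ![1 / 6, 1 / 2, 1 / 4, 1 / 12]) ?_ ?_ ?_
  · have e1 : ∀ x, ∏ i : Fin 4, (![fun x => ‖f x‖ₑ ^ (6 : ℝ), fun x => ‖g x‖ₑ ^ (2 : ℝ),
        fun x => ‖h x‖ₑ ^ (2 : ℝ), fun x => ‖h x‖ₑ ^ (6 : ℝ)] i x)
          ^ ((![1 / 6, 1 / 2, 1 / 4, 1 / 12] : Fin 4 → ℝ) i) = ‖f x * g x * h x‖ₑ := by
      intro x
      simp only [Fin.prod_univ_four, Matrix.cons_val]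
      simp only [← ENNReal.rpow_mul]
      rw [mul_assoc, ← ENNReal.rpow_add_of_nonneg _ _ (by norm_num) (by norm_num)]
      norm_num [enorm_mul]
    simp only [e1] at key
    refine key.trans (le_of_eq ?_)
    simp only [Fin.prod_univ_four, Matrix.cons_val]
    have n6 : ∀ g : α → ℝ, ∫⁻ x, ‖g x‖ₑ ^ (6 : ℝ) ∂μ = eLpNorm g 6 μ ^ (6 : ℝ) := by
      intro g
      rw [eLpNorm_eq_lintegral_rpow_enorm_toReal (by norm_num) (by norm_num), ← ENNReal.rpow_mul]
      norm_num
    have n2 : ∀ g : α → ℝ, ∫⁻ x, ‖g x‖ₑ ^ (2 : ℝ) ∂μ = eLpNorm g 2 μ ^ (2 : ℝ) := by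
      intro g
      rw [eLpNorm_eq_lintegral_rpow_enorm_toReal (by norm_num) (by norm_num), ← ENNReal.rpow_mul]
      norm_num
    rw [n6, n6, n2, n2]
    simp only [← ENNReal.rpow_mul]
    rw [ENNReal.mul_rpow_of_nonneg _ _ (by norm_num), ← mul_assoc]
    norm_num
  · intro i _
    fin_cases i
    · exact hf.enorm.pow_const _
    · exact hg.enorm.pow_const _
    · exact hh.enorm.pow_const _
    · exact hh.enorm.pow_const _
  · simp [Fin.sum_univ_four]; norm_num
  · intro i _
    fin_cases i <;> simp

/-- `∫_Ω f g h`. -/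
def tri (f g h : L2 Ω) : ℝ := ∫ x in Ω, f x * g x * h x

theorem tri_swap (f g h : L2 Ω) : tri f g h = tri h g f := by
  simp only [tri]
  congr 1
  funext x
  ring

/-- The product of two `H_0^1` functions and an `L²` function is integrable, and the first function
enters the bound with its gradient, the last one with half a derivative. -/
theorem exists_tri_bound (hd : d = 2 ∨ d = 3) (hΩo : IsOpen Ω) (hΩb : Bornology.IsBounded Ω) :
    ∃ C : ℝ, 0 < C ∧ (∀ w ∈ H10 Ω, ‖val w‖ ≤ C * gsum w) ∧
      ∀ u ∈ H10 Ω, ∀ w ∈ H10 Ω, ∀ g : L2 Ω,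
        Integrable (fun x => val u x * g x * val w x) ((volume : Measure (Pt d)).restrict Ω) ∧
        |tri (val u) g (val w)| ≤ C * gsum u * ‖g‖ * Real.sqrt (‖val w‖ * gsum w) := by
  obtain ⟨A, hA⟩ := exists_eLpNorm_six_le hd hΩo hΩb
  have : IsFiniteMeasure ((volume : Measure (Pt d)).restrict Ω) :=
    ⟨by simpa using hΩb.measure_lt_top⟩
  set μ := (volume : Measure (Pt d)).restrict Ω with hμ
  have hA' : ∀ w ∈ H10 Ω, (eLpNorm (val w) 6 μ).toReal ≤ A * gsum w := by
    intro w hw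
    refine ENNReal.toReal_le_of_le_ofReal (mul_nonneg A.coe_nonneg (gsum_nonneg w)) ((hA w hw).trans ?_)
    rw [ENNReal.ofReal_mul A.coe_nonneg]
    simp
  have hfin : ∀ w ∈ H10 Ω, eLpNorm (val w) 6 μ ≠ ⊤ := fun w hw =>
    ((hA w hw).trans_lt (ENNReal.mul_lt_top ENNReal.coe_lt_top ENNReal.ofReal_lt_top)).ne
  set B : ℝ := ((μ Set.univ) ^ (1 / 2 - 1 / 6 : ℝ)).toReal with hB
  have hB0 : 0 ≤ B := ENNReal.toReal_nonneg
  have hP : ∀ w ∈ H10 Ω, ‖val w‖ ≤ A * B * gsum w := by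
    intro w hw
    have h1 := eLpNorm_le_eLpNorm_mul_rpow_measure_univ (μ := μ) (p := 2) (q := 6)
      (by norm_num) (Lp.aestronglyMeasurable (val w))
    have h2 : ‖val w‖ ≤ (eLpNorm (val w) 6 μ).toReal * B := by
      rw [Lp.norm_def, hB, ← ENNReal.toReal_mul]
      refine ENNReal.toReal_mono ?_ ?_
      · refine ENNReal.mul_ne_top (hfin w hw) ?_
        exact ENNReal.rpow_ne_top_of_nonneg (by norm_num) (measure_ne_top _ _)
      · simpa using h1
    refine h2.trans ?_
    have := mul_le_mul_of_nonneg_right (hA' w hw) hB0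
    linarith
  have hA0 : (0 : ℝ) ≤ A := A.coe_nonneg
  -- `A * B` serves Poincaré's inequality, `A * √A` the trilinear bound, and the 1 only makes the
  -- constant positive.
  refine ⟨A * B + A * Real.sqrt A + 1, by positivity, ?_, ?_⟩
  · intro w hw
    refine (hP w hw).trans ?_
    have := gsum_nonneg w
    refine mul_le_mul_of_nonneg_right ?_ this
    have : 0 ≤ A * Real.sqrt A := by positivity
    linarith
  · intro u hu w hw g
    have hm : AEStronglyMeasurable (fun x => val u x * g x * val w x) μ :=
      ((Lp.aestronglyMeasurable _).mul (Lp.aestronglyMeasurable _)).mul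
        (Lp.aestronglyMeasurable _)
    have hl := lintegral_enorm_mul_mul_le (μ := μ) (Lp.aestronglyMeasurable (val u))
      (Lp.aestronglyMeasurable g) (Lp.aestronglyMeasurable (val w))
    have hR : eLpNorm (val u) 6 μ * eLpNorm g 2 μ
        * (eLpNorm (val w) 2 μ * eLpNorm (val w) 6 μ) ^ (1 / 2 : ℝ) ≠ ⊤ := by
      refine ENNReal.mul_ne_top (ENNReal.mul_ne_top (hfin u hu) (Lp.eLpNorm_ne_top _)) ?_
      exact ENNReal.rpow_ne_top_of_nonneg (by norm_num)
        (ENNReal.mul_ne_top (Lp.eLpNorm_ne_top _) (hfin w hw))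
    have hintegrable : Integrable (fun x => val u x * g x * val w x) μ :=
      ⟨hm, (hl.trans_lt (lt_top_iff_ne_top.2 hR))⟩
    refine ⟨hintegrable, ?_⟩
    have h1 : |tri (val u) g (val w)| ≤ (∫⁻ x, ‖val u x * g x * val w x‖ₑ ∂μ).toReal := by
      rw [← Real.norm_eq_abs]
      refine (norm_integral_le_integral_norm _).trans (le_of_eq ?_)
      rw [integral_norm_eq_lintegral_enorm hm]
    refine h1.trans ((ENNReal.toReal_mono hR hl).trans ?_)
    rw [ENNReal.toReal_mul, ENNReal.toReal_mul, ← ENNReal.toReal_rpow, ENNReal.toReal_mul,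
      ← Real.sqrt_eq_rpow, ← Lp.norm_def, ← Lp.norm_def]
    have h2 : Real.sqrt (‖val w‖ * (eLpNorm (val w) 6 μ).toReal)
        ≤ Real.sqrt A * Real.sqrt (‖val w‖ * gsum w) := by
      rw [← Real.sqrt_mul hA0]
      refine Real.sqrt_le_sqrt ?_
      have := mul_le_mul_of_nonneg_left (hA' w hw) (norm_nonneg (val w))
      linarith
    have g0 := gsum_nonneg u
    calc _ ≤ A * gsum u * ‖g‖ * (Real.sqrt A * Real.sqrt (‖val w‖ * gsum w)) := by
          gcongr
          exact hA' u hu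
      _ = (A * Real.sqrt A) * (gsum u * ‖g‖ * Real.sqrt (‖val w‖ * gsum w)) := by ring
      _ ≤ (A * B + A * Real.sqrt A + 1) * (gsum u * ‖g‖ * Real.sqrt (‖val w‖ * gsum w)) := by
          refine mul_le_mul_of_nonneg_right ?_ (by positivity)
          have : 0 ≤ A * B := by positivity
          linarith
      _ = _ := by ring

end EnBDF
end

noncomputable section

namespace EnBDF

variable {d : ℕ} {Ω : Set (Pt d)}

/-! ### The trilinear form on `X` -/

/-- The bounds of `exists_tri_bound` hold with the constant `C`. -/
structure TriBound (Ω : Set (Pt d)) (C : ℝ) : Prop where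
  pos : 0 < C
  poincare : ∀ w ∈ H10 Ω, ‖val w‖ ≤ C * gsum w
  integrable : ∀ u ∈ H10 Ω, ∀ w ∈ H10 Ω, ∀ g : L2 Ω,
    Integrable (fun x => val u x * g x * val w x) ((volume : Measure (Pt d)).restrict Ω)
  bound : ∀ u ∈ H10 Ω, ∀ w ∈ H10 Ω, ∀ g : L2 Ω,
    |tri (val u) g (val w)| ≤ C * gsum u * ‖g‖ * Real.sqrt (‖val w‖ * gsum w)

theorem exists_triBound (hd : d = 2 ∨ d = 3) (hΩo : IsOpen Ω) (hΩb : Bornology.IsBounded Ω) :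
    ∃ C, TriBound Ω C := by
  obtain ⟨C, h0, h1, h2⟩ := exists_tri_bound hd hΩo hΩb
  exact ⟨C, h0, h1, fun u hu w hw g => (h2 u hu w hw g).1, fun u hu w hw g => (h2 u hu w hw g).2⟩

variable {C : ℝ}

theorem TriBound.tri_add_left (hT : TriBound Ω C) {u u' w : Sobolev Ω 1} (hu : u ∈ H10 Ω)
    (hu' : u' ∈ H10 Ω) (hw : w ∈ H10 Ω) (g : L2 Ω) :
    tri (val (u + u')) g (val w) = tri (val u) g (val w) + tri (val u') g (val w) := by
  simp only [tri]
  rw [← integral_add (hT.integrable u hu w hw g) (hT.integrable u' hu' w hw g)]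
  refine integral_congr_ae ?_
  filter_upwards [Lp.coeFn_add (val u) (val u')] with x hx
  rw [val_add, hx, Pi.add_apply]
  ring

theorem TriBound.tri_add_mid (hT : TriBound Ω C) {u w : Sobolev Ω 1} (hu : u ∈ H10 Ω)
    (hw : w ∈ H10 Ω) (g g' : L2 Ω) :
    tri (val u) (g + g') (val w) = tri (val u) g (val w) + tri (val u) g' (val w) := by
  simp only [tri]
  rw [← integral_add (hT.integrable u hu w hw g) (hT.integrable u hu w hw g')]
  refine integral_congr_ae ?_
  filter_upwards [Lp.coeFn_add g g'] with x hx
  rw [hx, Pi.add_apply]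
  ring

theorem TriBound.tri_add_right (hT : TriBound Ω C) {u w w' : Sobolev Ω 1} (hu : u ∈ H10 Ω)
    (hw : w ∈ H10 Ω) (hw' : w' ∈ H10 Ω) (g : L2 Ω) :
    tri (val u) g (val (w + w')) = tri (val u) g (val w) + tri (val u) g (val w') := by
  rw [tri_swap, hT.tri_add_left hw hw' hu, tri_swap, tri_swap (val w')]

theorem tri_zero_mid (u w : L2 Ω) : tri u 0 w = 0 := by
  simp only [tri]
  refine integral_eq_zero_of_ae ?_
  filter_upwards [Lp.coeFn_zero ℝ 2 ((volume : Measure (Pt d)).restrict Ω)] with x hx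
  rw [hx]
  simp

theorem TriBound.tri_sum_mid (hT : TriBound Ω C) {ι : Type*} (s : Finset ι) {u w : Sobolev Ω 1}
    (hu : u ∈ H10 Ω) (hw : w ∈ H10 Ω) (g : ι → L2 Ω) :
    tri (val u) (∑ i ∈ s, g i) (val w) = ∑ i ∈ s, tri (val u) (g i) (val w) := by
  classical
  induction s using Finset.induction_on with
  | empty => simpa using tri_zero_mid _ _
  | insert i s hi ih =>
    rw [Finset.sum_insert hi, Finset.sum_insert hi, hT.tri_add_mid hu hw, ih]

theorem TriBound.sqrt_le (hT : TriBound Ω C) {w : Sobolev Ω 1} (hw : w ∈ H10 Ω) :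
    Real.sqrt (‖val w‖ * gsum w) ≤ Real.sqrt C * gsum w := by
  have h0 := gsum_nonneg w
  rw [show Real.sqrt C * gsum w = Real.sqrt (C * gsum w * gsum w) by
    rw [mul_assoc, Real.sqrt_mul hT.pos.le, Real.sqrt_mul_self h0]]
  exact Real.sqrt_le_sqrt (mul_le_mul_of_nonneg_right (hT.poincare w hw) h0)

/-- Coarser than `TriBound.bound`, but continuity in the full `H^1` norm is all that the density
argument for integration by parts requires. -/
theorem TriBound.bound_norm (hT : TriBound Ω C) {u w : Sobolev Ω 1} (hu : u ∈ H10 Ω)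
    (hw : w ∈ H10 Ω) (g : L2 Ω) :
    |tri (val u) g (val w)| ≤ C * Real.sqrt C * d ^ 2 * ‖g‖ * ‖u‖ * ‖w‖ := by
  have hC := hT.pos
  have h1 := hT.bound u hu w hw g
  have h2 := hT.sqrt_le hw
  have h3 := gsum_le u
  have h4 := gsum_le w
  have h5 := gsum_nonneg u
  have h6 := gsum_nonneg w
  calc _ ≤ C * gsum u * ‖g‖ * Real.sqrt (‖val w‖ * gsum w) := h1
    _ ≤ C * (d * ‖u‖) * ‖g‖ * (Real.sqrt C * (d * ‖w‖)) := by
        gcongr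
        exact h2.trans (by gcongr)
    _ = _ := by ring

/-- The three terms of `∫ ∂_i (u v w)`. -/
def triDeriv (i : Fin d) (u v w : Sobolev Ω 1) : ℝ :=
  tri (val u) (val (wpd i v)) (val w) + tri (val u) (val (wpd i w)) (val v)
    + tri (val v) (val (wpd i u)) (val w)

theorem triDeriv_comm (i : Fin d) (u v w : Sobolev Ω 1) :
    triDeriv i u v w = triDeriv i u w v := by
  simp only [triDeriv]
  rw [tri_swap (val v)]
  ring

theorem TriBound.triDeriv_add (hT : TriBound Ω C) (i : Fin d) {u v v' w : Sobolev Ω 1}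
    (hu : u ∈ H10 Ω) (hv : v ∈ H10 Ω) (hv' : v' ∈ H10 Ω) (hw : w ∈ H10 Ω) :
    triDeriv i u (v + v') w = triDeriv i u v w + triDeriv i u v' w := by
  simp only [triDeriv]
  rw [wpd_add, val_add (wpd i v), hT.tri_add_mid hu hw, hT.tri_add_right hu hv hv',
    hT.tri_add_left hv hv' hw]
  ring

theorem TriBound.triDeriv_sub (hT : TriBound Ω C) (i : Fin d) {u v v' w : Sobolev Ω 1}
    (hu : u ∈ H10 Ω) (hv : v ∈ H10 Ω) (hv' : v' ∈ H10 Ω) (hw : w ∈ H10 Ω) :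
    triDeriv i u (v - v') w = triDeriv i u v w - triDeriv i u v' w := by
  have := hT.triDeriv_add i hu ((H10 Ω).sub_mem hv hv') hv' hw
  rw [sub_add_cancel] at this
  linarith

theorem TriBound.abs_triDeriv_le (hT : TriBound Ω C) (i : Fin d) {u v w : Sobolev Ω 1}
    (hu : u ∈ H10 Ω) (hv : v ∈ H10 Ω) (hw : w ∈ H10 Ω) :
    |triDeriv i u v w| ≤ (3 * (C * Real.sqrt C * d ^ 2) * ‖u‖ * ‖w‖) * ‖v‖ := by
  have hC := hT.pos
  have h1 := hT.bound_norm hu hw (val (wpd i v))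
  have h2 := hT.bound_norm hu hv (val (wpd i w))
  have h3 := hT.bound_norm hv hw (val (wpd i u))
  have k1 := norm_val_wpd_le u i
  have k2 := norm_val_wpd_le v i
  have k3 := norm_val_wpd_le w i
  have l1 : |tri (val u) (val (wpd i v)) (val w)| ≤ C * Real.sqrt C * d ^ 2 * ‖v‖ * ‖u‖ * ‖w‖ :=
    h1.trans (by gcongr)
  have l2 : |tri (val u) (val (wpd i w)) (val v)| ≤ C * Real.sqrt C * d ^ 2 * ‖w‖ * ‖u‖ * ‖v‖ :=
    h2.trans (by gcongr)
  have l3 : |tri (val v) (val (wpd i u)) (val w)| ≤ C * Real.sqrt C * d ^ 2 * ‖u‖ * ‖v‖ * ‖w‖ :=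
    h3.trans (by gcongr)
  refine (abs_add_three _ _ _).trans ?_
  linarith

/-- The product of the two test functions is again a test function, so this is the definition of the
weak derivative of `u` combined with the product rule. No regularity of `u` is needed. -/
theorem triDeriv_eq_zero_of_isTestRep (hΩo : IsOpen Ω) (hΩb : Bornology.IsBounded Ω)
    (hT : TriBound Ω C) (i : Fin d) {u v w : Sobolev Ω 1} {ψ χ : Pt d → ℝ} (hu : u ∈ H10 Ω)
    (hv : v ∈ H10 Ω) (hw : w ∈ H10 Ω) (hψ : IsTestRep v ψ) (hχ : IsTestRep w χ) :
    triDeriv i u v w = 0 := by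
  have h1 := hasWeakPartial_wpd i u (ψ * χ) (hψ.1.mul hχ.1)
  have e1 : ∫ x in Ω, val u x * pd i (ψ * χ) x
      = tri (val u) (val (wpd i v)) (val w) + tri (val u) (val (wpd i w)) (val v) := by
    simp only [tri]
    rw [← integral_add (hT.integrable u hu w hw _) (hT.integrable u hu v hv _)]
    refine integral_congr_ae ?_
    filter_upwards [hψ.2, hχ.2, hψ.wpd_ae_eq hΩo hΩb i, hχ.wpd_ae_eq hΩo hΩb i] with x a1 a2 a3 a4
    rw [a1, a2, a3, a4, hψ.1.pd_mul hχ.1]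
    ring
  have e2 : ∫ x in Ω, val (wpd i u) x * (ψ * χ) x = tri (val v) (val (wpd i u)) (val w) := by
    simp only [tri]
    refine integral_congr_ae ?_
    filter_upwards [hψ.2, hχ.2] with x a1 a2
    rw [a1, a2, Pi.mul_apply]
    ring
  simp only [triDeriv]
  linarith

/-- `∫ ∂_i (u v w) = 0` for `u, v, w ∈ H_0^1`. -/
theorem triDeriv_eq_zero (hΩo : IsOpen Ω) (hΩb : Bornology.IsBounded Ω) (hT : TriBound Ω C)
    (i : Fin d) {u v w : Sobolev Ω 1} (hu : u ∈ H10 Ω) (hv : v ∈ H10 Ω) (hw : w ∈ H10 Ω) :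
    triDeriv i u v w = 0 := by
  refine eq_zero_of_forall_isTestRep (F := fun v => triDeriv i u v w)
    (fun a ha b hb => hT.triDeriv_sub i hu ha hb hw) (fun a ha => hT.abs_triDeriv_le i hu ha hw)
    (fun a ha φ hφ => ?_) hv
  -- After the symmetry the other argument stands in the slot where the density argument applies a
  -- second time.
  rw [triDeriv_comm]
  refine eq_zero_of_forall_isTestRep (F := fun w => triDeriv i u w a)
    (fun b hb b' hb' => hT.triDeriv_sub i hu hb hb' ha)
    (fun b hb => hT.abs_triDeriv_le i hu hb ha) (fun b hb ψ hψ => ?_) hw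
  exact triDeriv_eq_zero_of_isTestRep hΩo hΩb hT i hu hb ha hψ hφ

/-- `((∇·u) v, w)`. -/
def dvgTerm (u v w : SobolevV Ω 1) : ℝ :=
  ∑ c, ∑ i, tri (val (v c)) (val (wpd i (u i))) (val (w c))

theorem TriBound.conv_eq (hT : TriBound Ω C) {u w : SobolevV Ω 1} (hu : u ∈ X Ω)
    (v : SobolevV Ω 1) (hw : w ∈ X Ω) :
    conv u v w = ∑ c, ∑ i, tri (val (u i)) (val (wpd i (v c))) (val (w c)) := by
  simp only [conv, tri]
  rw [integral_finsetSum]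
  · refine Finset.sum_congr rfl fun c _ => ?_
    rw [integral_finsetSum]
    exact fun i _ => hT.integrable _ (hu i) _ (hw c) _
  · exact fun c _ => integrable_finsetSum _ fun i _ => hT.integrable _ (hu i) _ (hw c) _

/-- Integration by parts, `∫ ∂_i(u_i v_c w_c) = 0`, summed over all components. -/
theorem conv_add_conv_swap (hΩo : IsOpen Ω) (hΩb : Bornology.IsBounded Ω) (hT : TriBound Ω C)
    {u v w : SobolevV Ω 1} (hu : u ∈ X Ω) (hv : v ∈ X Ω) (hw : w ∈ X Ω) :
    conv u v w + conv u w v + dvgTerm u v w = 0 := by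
  rw [hT.conv_eq hu v hw, hT.conv_eq hu w hv, dvgTerm, ← Finset.sum_add_distrib,
    ← Finset.sum_add_distrib]
  refine Finset.sum_eq_zero fun c _ => ?_
  rw [← Finset.sum_add_distrib, ← Finset.sum_add_distrib]
  refine Finset.sum_eq_zero fun i _ => ?_
  exact triDeriv_eq_zero hΩo hΩb hT i (hu i) (hv c) (hw c)

theorem TriBound.dvgTerm_eq_zero (hT : TriBound Ω C) {u v w : SobolevV Ω 1} (hv : v ∈ X Ω)
    (hw : w ∈ X Ω) (hdiv : dvg u = 0) : dvgTerm u v w = 0 := by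
  refine Finset.sum_eq_zero fun c _ => ?_
  rw [← hT.tri_sum_mid _ (hv c) (hw c)]
  have : ∑ i, val (wpd i (u i)) = 0 := hdiv
  rw [this, tri_zero_mid]

theorem bStar_self (u v : SobolevV Ω 1) : bStar u v v = 0 := by
  simp [bStar]

/-- Lets the convection term of the exact solution, whose divergence is zero, be compared with the
skew form of the method without a consistency error. -/
theorem bStar_eq_conv (hΩo : IsOpen Ω) (hΩb : Bornology.IsBounded Ω) (hT : TriBound Ω C)
    {u v w : SobolevV Ω 1} (hu : u ∈ X Ω) (hv : v ∈ X Ω) (hw : w ∈ X Ω) (hdiv : dvg u = 0) :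
    bStar u v w = conv u v w := by
  have h1 := conv_add_conv_swap hΩo hΩb hT hu hv hw
  rw [hT.dvgTerm_eq_zero hv hw hdiv] at h1
  simp only [bStar]
  linarith

theorem TriBound.conv_add_left (hT : TriBound Ω C) {u u' v w : SobolevV Ω 1} (hu : u ∈ X Ω)
    (hu' : u' ∈ X Ω) (hw : w ∈ X Ω) : conv (u + u') v w = conv u v w + conv u' v w := by
  rw [hT.conv_eq ((X Ω).add_mem hu hu') v hw, hT.conv_eq hu v hw, hT.conv_eq hu' v hw,
    ← Finset.sum_add_distrib]
  refine Finset.sum_congr rfl fun c _ => ?_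
  rw [← Finset.sum_add_distrib]
  exact Finset.sum_congr rfl fun i _ => hT.tri_add_left (hu i) (hu' i) (hw c) _

theorem TriBound.conv_add_mid (hT : TriBound Ω C) {u v v' w : SobolevV Ω 1} (hu : u ∈ X Ω)
    (hw : w ∈ X Ω) : conv u (v + v') w = conv u v w + conv u v' w := by
  rw [hT.conv_eq hu _ hw, hT.conv_eq hu v hw, hT.conv_eq hu v' hw, ← Finset.sum_add_distrib]
  refine Finset.sum_congr rfl fun c _ => ?_
  rw [← Finset.sum_add_distrib]
  exact Finset.sum_congr rfl fun i _ => hT.tri_add_mid (hu i) (hw c) _ _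

theorem TriBound.conv_add_right (hT : TriBound Ω C) {u v w w' : SobolevV Ω 1} (hu : u ∈ X Ω)
    (hw : w ∈ X Ω) (hw' : w' ∈ X Ω) : conv u v (w + w') = conv u v w + conv u v w' := by
  rw [hT.conv_eq hu _ ((X Ω).add_mem hw hw'), hT.conv_eq hu v hw, hT.conv_eq hu v hw',
    ← Finset.sum_add_distrib]
  refine Finset.sum_congr rfl fun c _ => ?_
  rw [← Finset.sum_add_distrib]
  exact Finset.sum_congr rfl fun i _ => hT.tri_add_right (hu i) (hw c) (hw' c) _

theorem TriBound.bStar_add_left (hT : TriBound Ω C) {u u' v w : SobolevV Ω 1} (hu : u ∈ X Ω)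
    (hu' : u' ∈ X Ω) (hv : v ∈ X Ω) (hw : w ∈ X Ω) :
    bStar (u + u') v w = bStar u v w + bStar u' v w := by
  simp only [bStar]
  rw [hT.conv_add_left hu hu' hw, hT.conv_add_left hu hu' hv]
  ring

theorem TriBound.bStar_add_mid (hT : TriBound Ω C) {u v v' w : SobolevV Ω 1} (hu : u ∈ X Ω)
    (hv : v ∈ X Ω) (hv' : v' ∈ X Ω) (hw : w ∈ X Ω) :
    bStar u (v + v') w = bStar u v w + bStar u v' w := by
  simp only [bStar]
  rw [hT.conv_add_mid hu hw, hT.conv_add_right hu hv hv']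
  ring

theorem TriBound.bStar_sub_left (hT : TriBound Ω C) {u u' v w : SobolevV Ω 1} (hu : u ∈ X Ω)
    (hu' : u' ∈ X Ω) (hv : v ∈ X Ω) (hw : w ∈ X Ω) :
    bStar (u - u') v w = bStar u v w - bStar u' v w := by
  have := hT.bStar_add_left ((X Ω).sub_mem hu hu') hu' hv hw
  rw [sub_add_cancel] at this
  linarith

theorem TriBound.bStar_sub_mid (hT : TriBound Ω C) {u v v' w : SobolevV Ω 1} (hu : u ∈ X Ω)
    (hv : v ∈ X Ω) (hv' : v' ∈ X Ω) (hw : w ∈ X Ω) :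
    bStar u (v - v') w = bStar u v w - bStar u v' w := by
  have := hT.bStar_add_mid hu ((X Ω).sub_mem hv hv') hv' hw
  rw [sub_add_cancel] at this
  linarith

/-- `‖u‖`, the `L²` norm. -/
def vn (u : SobolevV Ω 1) : ℝ := ‖valM u‖

/-- `‖∇u‖`, the `L²` norm of the gradient. -/
def gn (u : SobolevV Ω 1) : ℝ := ‖gradM u‖

theorem vn_nonneg (u : SobolevV Ω 1) : 0 ≤ vn u := norm_nonneg _

theorem gn_nonneg (u : SobolevV Ω 1) : 0 ≤ gn u := norm_nonneg _

theorem nsq_eq_vn (u : SobolevV Ω 1) : nsq u = vn u ^ 2 := rfl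

theorem gradNsq_eq_gn (u : SobolevV Ω 1) : gradNsq u = gn u ^ 2 := gradNsq_eq u

theorem norm_val_le_vn (u : SobolevV Ω 1) (c : Fin d) : ‖val (u c)‖ ≤ vn u :=
  PiLp.norm_apply_le (p := 2) (valM u) c

theorem norm_wpd_le_gn (u : SobolevV Ω 1) (c i : Fin d) :
    ‖val (wpd i (u c))‖ ≤ gn u :=
  PiLp.norm_apply_le (p := 2) (gradM u) (c, i)

theorem gsum_le_gn (u : SobolevV Ω 1) (c : Fin d) : gsum (u c) ≤ d * gn u := by
  refine (Finset.sum_le_sum fun i _ => norm_wpd_le_gn u c i).trans ?_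
  simp

theorem sqrt_val_gsum_le (u : SobolevV Ω 1) (c : Fin d) :
    Real.sqrt (‖val (u c)‖ * gsum (u c)) ≤ d * Real.sqrt (vn u * gn u) := by
  rcases Nat.eq_zero_or_pos d with h0 | h0
  · subst h0
    exact c.elim0
  have h1 : (1 : ℝ) ≤ d := by exact_mod_cast h0
  have v0 := vn_nonneg u
  have g0 := gn_nonneg u
  rw [Real.sqrt_le_left (by positivity), mul_pow, Real.sq_sqrt (by positivity)]
  have a1 := norm_val_le_vn u c
  have a2 := gsum_le_gn u c
  calc ‖val (u c)‖ * gsum (u c) ≤ vn u * (d * gn u) :=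
        mul_le_mul a1 a2 (gsum_nonneg _) v0
    _ = d * (vn u * gn u) := by ring
    _ ≤ d ^ 2 * (vn u * gn u) := by
        refine mul_le_mul_of_nonneg_right ?_ (by positivity)
        nlinarith

theorem abs_sum_sum_le {K : ℝ} {F : Fin d → Fin d → ℝ} (h : ∀ c i, |F c i| ≤ K) :
    |∑ c, ∑ i, F c i| ≤ d ^ 2 * K := by
  refine (Finset.abs_sum_le_sum_abs _ _).trans ?_
  refine (Finset.sum_le_sum fun c _ => (Finset.abs_sum_le_sum_abs _ _).trans
    (Finset.sum_le_sum fun i _ => h c i)).trans ?_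
  simp
  apply le_of_eq
  ring

/-- `|∫ u g w|` for components of vector fields. -/
theorem TriBound.bound_vec (hT : TriBound Ω C) {u w : SobolevV Ω 1} (hu : u ∈ X Ω)
    (hw : w ∈ X Ω) (v : SobolevV Ω 1) (a b c i : Fin d) :
    |tri (val (u a)) (val (wpd i (v b))) (val (w c))|
      ≤ C * d ^ 2 * gn u * gn v * Real.sqrt (vn w * gn w) := by
  have hC := hT.pos
  have g0 := gsum_nonneg (u a)
  have g1 := gn_nonneg u
  have g2 := gn_nonneg v
  calc _ ≤ C * gsum (u a) * ‖val (wpd i (v b))‖ * Real.sqrt (‖val (w c)‖ * gsum (w c)) :=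
        hT.bound _ (hu a) _ (hw c) _
    _ ≤ C * (d * gn u) * gn v
          * (d * Real.sqrt (vn w * gn w)) := by
        gcongr
        · exact gsum_le_gn u a
        · exact norm_wpd_le_gn v b i
        · exact sqrt_val_gsum_le w c
    _ = _ := by ring

/-- The trilinear form and Poincaré's inequality on `X`: the bounds used in the error analysis. -/
structure FormBound (Ω : Set (Pt d)) (B : ℝ) : Prop where
  pos : 0 < B
  poincare : ∀ u ∈ X Ω, vn u ≤ B * gn u
  left : ∀ u ∈ X Ω, ∀ v ∈ X Ω, ∀ w ∈ X Ω, |bStar u v w|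
    ≤ B * Real.sqrt (vn u * gn u) * gn v * gn w
  mid : ∀ u ∈ X Ω, ∀ v ∈ X Ω, ∀ w ∈ X Ω, |bStar u v w|
    ≤ B * gn u * Real.sqrt (vn v * gn v) * gn w
  full : ∀ u ∈ X Ω, ∀ v ∈ X Ω, ∀ w ∈ X Ω, |bStar u v w|
    ≤ B * gn u * gn v * gn w

theorem sqrt_mul_le_of_le {a b K : ℝ} (hK : 0 ≤ K) (hb : 0 ≤ b) (h : a ≤ K * b) :
    Real.sqrt (a * b) ≤ Real.sqrt K * b := by
  rw [show Real.sqrt K * b = Real.sqrt (K * b * b) by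
    rw [mul_assoc, Real.sqrt_mul hK, Real.sqrt_mul_self hb]]
  exact Real.sqrt_le_sqrt (mul_le_mul_of_nonneg_right h hb)

-- Hölder allows one of the two undifferentiated factors to carry only half a derivative. For `left`
-- this factor is the first argument, in both convection terms. For `full` Poincaré's inequality is
-- applied to it afterwards. For `mid` it is the second argument, which must therefore not be
-- differentiated at all.
set_option maxHeartbeats 800000 in
theorem exists_formBound (hd : d = 2 ∨ d = 3) (hΩo : IsOpen Ω) (hΩb : Bornology.IsBounded Ω) :
    ∃ B, FormBound Ω B := by
  obtain ⟨C, hT⟩ := exists_triBound hd hΩo hΩb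
  have hC := hT.pos
  set K : ℝ := d ^ 2 * (C * d ^ 2) with hK
  have hd0 : (0 : ℝ) < d := by
    rcases hd with rfl | rfl <;> norm_num
  have hK0 : 0 < K := by positivity
  have left : ∀ u ∈ X Ω, ∀ v ∈ X Ω, ∀ w ∈ X Ω, |conv u v w|
      ≤ K * Real.sqrt (vn u * gn u) * gn v * gn w := by
    intro u hu v _ w hw
    rw [hT.conv_eq hu v hw]
    refine (abs_sum_sum_le fun c i => ?_).trans_eq (b := d ^ 2 * (C * d ^ 2 * gn w
      * gn v * Real.sqrt (vn u * gn u))) (by rw [hK]; ring)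
    rw [tri_swap]
    exact hT.bound_vec hw hu v c c i i
  have right : ∀ u ∈ X Ω, ∀ v ∈ X Ω, ∀ w ∈ X Ω, |conv u v w|
      ≤ K * gn u * gn v * Real.sqrt (vn w * gn w) := by
    intro u hu v _ w hw
    rw [hT.conv_eq hu v hw]
    refine (abs_sum_sum_le fun c i => ?_).trans_eq (b := d ^ 2 * (C * d ^ 2 * gn u
      * gn v * Real.sqrt (vn w * gn w))) (by rw [hK]; ring)
    exact hT.bound_vec hu hw v i c c i
  have dv : ∀ u ∈ X Ω, ∀ v ∈ X Ω, ∀ w ∈ X Ω, |dvgTerm u v w|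
      ≤ K * gn u * Real.sqrt (vn v * gn v) * gn w := by
    intro u _ v hv w hw
    refine (abs_sum_sum_le fun c i => ?_).trans_eq (b := d ^ 2 * (C * d ^ 2 * gn w
      * gn u * Real.sqrt (vn v * gn v))) (by rw [hK]; ring)
    rw [tri_swap]
    exact hT.bound_vec hw hv u c i c i
  have poin : ∀ u ∈ X Ω, vn u ≤ (C * d ^ 2) * gn u := by
    intro u hu
    have h1 : vn u ≤ ∑ c, ‖val (u c)‖ := by
      have : vn u ^ 2 ≤ (∑ c, ‖val (u c)‖) ^ 2 := by
        rw [vn, PiLp.norm_sq_eq_of_L2]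
        exact Finset.sum_sq_le_sq_sum_of_nonneg fun _ _ => norm_nonneg _
      exact (sq_le_sq₀ (vn_nonneg u) (Finset.sum_nonneg fun _ _ => norm_nonneg _)).1 this
    refine h1.trans ((Finset.sum_le_sum fun c _ => (hT.poincare _ (hu c)).trans
      (mul_le_mul_of_nonneg_left (gsum_le_gn u c) hC.le)).trans (le_of_eq ?_))
    simp
    ring
  have bl : ∀ u ∈ X Ω, ∀ v ∈ X Ω, ∀ w ∈ X Ω, |bStar u v w|
      ≤ K * Real.sqrt (vn u * gn u) * gn v * gn w := by
    intro u hu v hv w hw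
    have h1 := left u hu v hv w hw
    have h2 := left u hu w hw v hv
    rw [abs_le] at *
    simp only [bStar]
    constructor <;> linarith [h1.1, h1.2, h2.1, h2.2]
  have bm : ∀ u ∈ X Ω, ∀ v ∈ X Ω, ∀ w ∈ X Ω, |bStar u v w|
      ≤ (2 * K) * gn u * Real.sqrt (vn v * gn v) * gn w := by
    intro u hu v hv w hw
    have h1 := right u hu w hw v hv
    have h2 := dv u hu v hv w hw
    have h3 := conv_add_conv_swap hΩo hΩb hT hu hv hw
    -- Integration by parts moves the derivative off `v`, at the price of a term with the divergence
    -- of `u`.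
    have h4 : bStar u v w = -conv u w v - 1 / 2 * dvgTerm u v w := by
      simp only [bStar]
      linarith
    rw [h4]
    rw [abs_le] at *
    have h6 : 0 ≤ K * gn u * Real.sqrt (vn v * gn v) * gn w := by
      have := gn_nonneg u
      have := gn_nonneg w
      positivity
    constructor <;> linarith [h1.1, h1.2, h2.1, h2.2]
  set S := Real.sqrt (C * d ^ 2) with hS
  have hS0 : 0 ≤ S := Real.sqrt_nonneg _
  -- One constant for all four bounds: `C * d ^ 2` for Poincaré, `2 * K` for `left` and `mid`, `K *
  -- S` for `full`.
  refine ⟨2 * K + C * d ^ 2 + K * S, by positivity, ?_, ?_, ?_, ?_⟩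
  · intro u hu
    refine (poin u hu).trans (mul_le_mul_of_nonneg_right ?_ (gn_nonneg u))
    have : 0 ≤ K * S := by positivity
    linarith
  · intro u hu v hv w hw
    have g1 := gn_nonneg u
    have g2 := gn_nonneg v
    have g3 := gn_nonneg w
    refine (bl u hu v hv w hw).trans ?_
    gcongr
    have : 0 ≤ K * S := by positivity
    have : 0 < C * d ^ 2 := by positivity
    linarith
  · intro u hu v hv w hw
    have g1 := gn_nonneg u
    have g2 := gn_nonneg v
    have g3 := gn_nonneg w
    refine (bm u hu v hv w hw).trans ?_
    gcongr
    have : 0 ≤ K * S := by positivity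
    have : 0 < C * d ^ 2 := by positivity
    linarith
  · intro u hu v hv w hw
    have g1 := gn_nonneg u
    have g2 := gn_nonneg v
    have g3 := gn_nonneg w
    have h1 := sqrt_mul_le_of_le (by positivity) (gn_nonneg u) (poin u hu)
    calc _ ≤ K * (S * gn u) * gn v * gn w :=
          (bl u hu v hv w hw).trans (by gcongr)
      _ = (K * S) * gn u * gn v * gn w := by ring
      _ ≤ _ := by
          gcongr
          have : 0 < C * d ^ 2 := by positivity
          linarith

end EnBDF
end

noncomputable section

namespace EnBDF

/-! ### The projection onto discretely divergence free fields -/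

section Hilbert

variable {W M : Type*} [NormedAddCommGroup W] [InnerProductSpace ℝ W]
  [NormedAddCommGroup M] [InnerProductSpace ℝ M]

theorem inner_starProjection_left {S : Submodule ℝ W} [S.HasOrthogonalProjection] (x : W) {s : W}
    (hs : s ∈ S) : inner ℝ (S.starProjection x) s = inner ℝ x s := by
  have := S.starProjection_inner_eq_zero x s hs
  rw [inner_sub_left] at this
  linarith

theorem norm_sub_starProjection_le {S : Submodule ℝ W} [S.HasOrthogonalProjection] (x : W) {s : W}
    (hs : s ∈ S) : ‖x - S.starProjection x‖ ≤ ‖x - s‖ := by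
  set y := x - S.starProjection x with hy
  have h1 : inner ℝ y y = inner ℝ y (x - s) := by
    have a1 := S.starProjection_inner_eq_zero x s hs
    have a2 := S.starProjection_inner_eq_zero x (S.starProjection x)
      (S.starProjection_apply_mem x)
    rw [← hy] at a1 a2
    nth_rewrite 2 [hy]
    rw [inner_sub_right, inner_sub_right, a1, a2]
  have h2 : ‖y‖ * ‖y‖ ≤ ‖y‖ * ‖x - s‖ := by
    rw [← real_inner_self_eq_norm_mul_norm, h1]
    exact real_inner_le_norm _ _
  rcases (norm_nonneg y).eq_or_lt with h | h
  · rw [← h]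
    exact norm_nonneg _
  · exact le_of_mul_le_mul_left h2 h

/-- An inf-sup condition on finite dimensional subspaces yields a bounded right inverse. -/
theorem exists_of_infSup [CompleteSpace W] [CompleteSpace M] {S : Submodule ℝ W} [FiniteDimensional ℝ S] {Q : Submodule ℝ M}
    [FiniteDimensional ℝ Q] (A : W →L[ℝ] M) {β : ℝ} (hβ : 0 < β)
    (hlbb : ∀ q ∈ Q, ∃ s ∈ S, ‖s‖ ≤ 1 ∧ β * ‖q‖ ≤ inner ℝ q (A s)) (g : M) :
    ∃ s ∈ S, (∀ q ∈ Q, inner ℝ (A s) q = inner ℝ g q) ∧ β * ‖s‖ ≤ ‖g‖ := by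
  -- `R` is the adjoint of the discrete operator. Since `⟪A R q, q⟫ = ‖R q‖²` and the inf-sup
  -- condition says `β‖q‖ ≤ ‖R q‖`, the compression of `A R` to `Q` is injective, hence bijective in
  -- finite dimension. The solution sought is `R q`.
  set R : M →L[ℝ] W := S.starProjection.comp (ContinuousLinearMap.adjoint A) with hR
  have hRS : ∀ q, R q ∈ S := fun q => S.starProjection_apply_mem _
  have hinner : ∀ q, inner ℝ (A (R q)) q = ‖R q‖ * ‖R q‖ := by
    intro q
    rw [← real_inner_self_eq_norm_mul_norm, real_inner_comm,
      ← ContinuousLinearMap.adjoint_inner_left]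
    exact (inner_starProjection_left _ (hRS q)).symm
  have hbd : ∀ q ∈ Q, β * ‖q‖ ≤ ‖R q‖ := by
    intro q hq
    obtain ⟨s, hs, hs1, hs2⟩ := hlbb q hq
    refine hs2.trans ?_
    rw [← ContinuousLinearMap.adjoint_inner_left, ← inner_starProjection_left _ hs]
    refine (real_inner_le_norm _ _).trans ?_
    exact mul_le_of_le_one_right (norm_nonneg _) hs1
  let L : Q →ₗ[ℝ] Q :=
    (Q.orthogonalProjectionOnto.comp ((A.comp R).comp Q.subtypeL) : Q →L[ℝ] Q).toLinearMap
  have hL : ∀ q q' : Q, inner ℝ ((L q : Q) : M) (q' : M) = inner ℝ (A (R q)) (q' : M) := fun q q' =>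
    inner_starProjection_left (S := Q) _ q'.2
  have hinj : Function.Injective L := by
    rw [← LinearMap.ker_eq_bot, LinearMap.ker_eq_bot']
    intro q hq
    have h1 := hL q q
    rw [hq, hinner] at h1
    have h2 : ‖R q‖ = 0 := by
      simp only [Submodule.coe_zero, inner_zero_left] at h1
      exact mul_self_eq_zero.1 h1.symm
    have h3 := hbd q q.2
    rw [h2] at h3
    have h4 : ‖(q : M)‖ ≤ 0 := by
      by_contra h
      push Not at h
      have := mul_pos hβ h
      linarith
    exact Subtype.ext (norm_le_zero_iff.1 h4)
  obtain ⟨q, hq⟩ := (LinearMap.injective_iff_surjective.1 hinj) (Q.orthogonalProjectionOnto g)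
  have hmain : ∀ q' ∈ Q, inner ℝ (A (R q)) q' = inner ℝ g q' := by
    intro q' hq'
    rw [← hL q ⟨q', hq'⟩, hq]
    exact inner_starProjection_left (S := Q) g hq'
  refine ⟨R q, hRS q, hmain, ?_⟩
  have h1 : ‖R q‖ * ‖R q‖ ≤ ‖g‖ * ‖(q : M)‖ := by
    rw [← hinner, hmain q q.2]
    exact real_inner_le_norm _ _
  have h2 := hbd q q.2
  rcases (norm_nonneg (R (q : M))).eq_or_lt with h | h
  · rw [← h]
    simp
  · refine le_of_mul_le_mul_right ?_ h
    have := mul_le_mul_of_nonneg_left h2 (norm_nonneg g)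
    nlinarith

/-- The projection onto a finite dimensional space `V` with respect to the semi-inner product
`⟪G v, G w⟫`. -/
theorem exists_linear_projection {E : Type*} [AddCommGroup E] [Module ℝ E] (G : E →ₗ[ℝ] W)
    (V : Submodule ℝ E) [FiniteDimensional ℝ V] :
    ∃ P : E →ₗ[ℝ] E, (∀ w, P w ∈ V) ∧
      (∀ w, ∀ v ∈ V, inner ℝ (G (w - P w)) (G v) = 0) ∧
      ∀ w, ∀ v ∈ V, ‖G (w - P w)‖ ≤ ‖G (w - v)‖ := by
  let G' : V →ₗ[ℝ] V.map G := G.restrict fun v hv => Submodule.mem_map_of_mem hv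
  have hG : LinearMap.range G' = ⊤ := by
    rw [LinearMap.range_eq_top]
    rintro ⟨s, hs⟩
    obtain ⟨v, hv, rfl⟩ := hs
    exact ⟨⟨v, hv⟩, rfl⟩
  -- `G` is not assumed injective on `V`, so the orthogonal projection in the image is lifted by a
  -- linear section. Linearity of `P` is what later lets it commute with differences in time.
  obtain ⟨g, hg⟩ := G'.exists_rightInverse_of_surjective hG
  have hg' : ∀ s : V.map G, G ((g s : V) : E) = s := fun s =>
    congrArg Subtype.val (LinearMap.congr_fun hg s)
  let P : E →ₗ[ℝ] E := V.subtype ∘ₗ g ∘ₗ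
    ((V.map G).orthogonalProjectionOnto : W →L[ℝ] V.map G).toLinearMap ∘ₗ G
  have hP : ∀ w, G (P w) = (V.map G).starProjection (G w) := fun w => hg' _
  refine ⟨P, fun w => (g _).2, fun w v hv => ?_, fun w v hv => ?_⟩
  · rw [map_sub, hP]
    exact (V.map G).starProjection_inner_eq_zero _ _ (Submodule.mem_map_of_mem hv)
  · rw [map_sub, map_sub, hP]
    exact norm_sub_starProjection_le _ (Submodule.mem_map_of_mem hv)

end Hilbert

variable {d : ℕ} {Ω : Set (Pt d)}

/-- The discretely divergence free fields. -/
def discDivFree (Xh : Submodule ℝ (SobolevV Ω 1)) (Qh : Submodule ℝ (L2 Ω)) :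
    Submodule ℝ (SobolevV Ω 1) where
  carrier := {v | v ∈ Xh ∧ ∀ q ∈ Qh, inner ℝ (dvg v) q = 0}
  zero_mem' := ⟨Xh.zero_mem, fun q _ => by rw [dvg_eq, map_zero, map_zero, inner_zero_left]⟩
  add_mem' := by
    rintro a b ⟨ha, ha'⟩ ⟨hb, hb'⟩
    refine ⟨Xh.add_mem ha hb, fun q hq => ?_⟩
    have h1 := ha' q hq
    have h2 := hb' q hq
    rw [dvg_eq] at *
    rw [map_add, map_add, inner_add_left, h1, h2, add_zero]
  smul_mem' := by
    rintro r a ⟨ha, ha'⟩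
    refine ⟨Xh.smul_mem r ha, fun q hq => ?_⟩
    have h1 := ha' q hq
    rw [dvg_eq] at *
    rw [map_smul, map_smul, real_inner_smul_left, h1, mul_zero]

/-- Divergence free fields are approximated by discretely divergence free ones. -/
theorem IsFEPair.exists_discDivFree_approx {k s : ℕ} {Cinv β Capp h : ℝ}
    {Xh : Submodule ℝ (SobolevV Ω 1)} {Qh : Submodule ℝ (L2 Ω)}
    (hF : IsFEPair Ω k s Cinv β Capp h Xh Qh) (hβ : 0 < β) {w : SobolevV Ω (k + 1)}
    (hw : toH1 w ∈ X Ω) (hdiv : dvg (toH1 w) = 0) :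
    ∃ v ∈ discDivFree Xh Qh,
      gn (toH1 w - v) ≤ (1 + ‖traceL Ω‖ / β) * (Capp * h ^ k * ‖w‖) := by
  have := hF.finite_X
  have := hF.finite_Q
  obtain ⟨v₀, hv₀, happ⟩ := hF.approx_X w hw
  rw [gradNsq_eq_gn, Real.sqrt_sq (gn_nonneg _)] at happ
  set z := toH1 w - v₀ with hz
  -- The best approximation `v₀` is corrected by a discrete field with the same discrete divergence
  -- as `w - v₀`. Working in the image of the gradient makes the norm in the inf-sup condition equal
  -- to `‖∇v‖`.
  obtain ⟨s, hs, h1, h2⟩ := exists_of_infSup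
    (S := Xh.map gradM) (Q := Qh) (traceL Ω) hβ
    (fun q hq => by
      obtain ⟨v, hv, hv1, hv2⟩ := hF.lbb q hq
      refine ⟨gradM v, Submodule.mem_map_of_mem hv, ?_, by rwa [dvg_eq] at hv2⟩
      rw [gradNsq_eq] at hv1
      exact (sq_le_one_iff₀ (norm_nonneg _)).1 hv1) (dvg z)
  obtain ⟨y, hy, rfl⟩ := hs
  have h2' : β * gn y ≤ ‖dvg z‖ := h2
  refine ⟨v₀ + y, ⟨Xh.add_mem hv₀ hy, fun q hq => ?_⟩, ?_⟩
  · have h3 : inner ℝ (traceL Ω (gradM y)) q = inner ℝ (dvg z) q := h1 q hq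
    rw [dvg_eq, map_add, map_add, inner_add_left, h3, dvg_eq, ← inner_add_left, ← map_add,
      ← map_add, hz, add_sub_cancel, ← dvg_eq, hdiv, inner_zero_left]
  · have h3 : gn (toH1 w - (v₀ + y)) ≤ gn z + gn y := by
      rw [← sub_sub, ← hz, gn, map_sub]
      exact norm_sub_le _ _
    have h4 : ‖dvg z‖ ≤ ‖traceL Ω‖ * gn z := by
      rw [dvg_eq]
      exact (traceL Ω).le_opNorm _
    have h5 : gn y ≤ ‖traceL Ω‖ / β * gn z := by
      rw [div_mul_eq_mul_div, le_div_iff₀ hβ]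
      linarith
    calc _ ≤ (1 + ‖traceL Ω‖ / β) * gn z := by linarith
      _ ≤ _ := by gcongr

end EnBDF
end

noncomputable section

namespace EnBDF

/-! ### Functions of time -/

section Time

variable {Y Z : Type*} [NormedAddCommGroup Y] [NormedSpace ℝ Y]
  [NormedAddCommGroup Z] [NormedSpace ℝ Z]

theorem intervalIntegrable_of_Icc {E : Type*} [NormedAddCommGroup E] {T : ℝ} {f : ℝ → E} (h : IntegrableOn f (Set.Icc 0 T))
    {a b : ℝ} (ha : a ∈ Set.Icc 0 T) (hb : b ∈ Set.Icc 0 T) :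
    IntervalIntegrable f volume a b :=
  (h.mono_set (Set.ordConnected_Icc.uIcc_subset ha hb)).intervalIntegrable

theorem IsPrimitive.sub_eq {T : ℝ} {v v' : ℝ → Y} (h : IsPrimitive T v v') {a b : ℝ}
    (ha : a ∈ Set.Icc 0 T) (hb : b ∈ Set.Icc 0 T) : v b - v a = ∫ r in a..b, v' r := by
  have h0 : (0 : ℝ) ∈ Set.Icc 0 T := ⟨le_rfl, ha.1.trans ha.2⟩
  rw [h.2 a ha, h.2 b hb, add_sub_add_left_eq_sub]
  exact intervalIntegral.integral_interval_sub_left (intervalIntegrable_of_Icc h.1 h0 hb)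
    (intervalIntegrable_of_Icc h.1 h0 ha)

theorem IsPrimitive.continuousOn {T : ℝ} (hT : 0 ≤ T) {v v' : ℝ → Y} (h : IsPrimitive T v v') :
    ContinuousOn v (Set.Icc 0 T) := by
  have h1 : ContinuousOn (fun t => v 0 + ∫ r in (0 : ℝ)..t, v' r) (Set.Icc 0 T) := by
    refine continuousOn_const.add ?_
    have := intervalIntegral.continuousOn_primitive_interval (a := (0 : ℝ)) (b := T) (f := v')
      (μ := volume) (by rw [Set.uIcc_of_le hT]; exact h.1)
    rwa [Set.uIcc_of_le hT] at this
  exact h1.congr h.2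

theorem IsPrimitive.map [CompleteSpace Y] [CompleteSpace Z] {T : ℝ} {v v' : ℝ → Y}
    (h : IsPrimitive T v v') (L : Y →L[ℝ] Z) :
    IsPrimitive T (fun t => L (v t)) fun t => L (v' t) := by
  refine ⟨L.integrable_comp h.1, fun t ht => ?_⟩
  have h0 : (0 : ℝ) ∈ Set.Icc 0 T := ⟨le_rfl, ht.1.trans ht.2⟩
  simp only
  rw [L.intervalIntegral_comp_comm (intervalIntegrable_of_Icc h.1 h0 ht), h.2 t ht, map_add]

/-- The image of a jet under a linear map. -/
def TimeJet.map (U : TimeJet Y) (L : Y →L[ℝ] Z) : TimeJet Z :=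
  ⟨fun t => L (U.u t), fun t => L (U.ut t), fun t => L (U.utt t), fun t => L (U.uttt t)⟩

theorem TimeJet.IsH3.map [CompleteSpace Y] [CompleteSpace Z] {T : ℝ} {U : TimeJet Y}
    (h : U.IsH3 T) (L : Y →L[ℝ] Z) : (U.map L).IsH3 T :=
  ⟨h.prim.map L, h.prim_t.map L, h.prim_tt.map L, L.comp_memLp' h.memLp_ttt⟩

theorem TimeJet.IsH3.integrableOn_sq {T : ℝ} {U : TimeJet Y} (h : U.IsH3 T) :
    IntegrableOn (fun t => ‖U.uttt t‖ ^ 2) (Set.Icc 0 T) :=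
  h.memLp_ttt.integrable_norm_pow (p := 2) (by norm_num)

/-- Cauchy–Schwarz in time. -/
theorem sq_integral_le {f : ℝ → ℝ} {a b : ℝ} (hab : a ≤ b) (hf : IntervalIntegrable f volume a b)
    (hf2 : IntervalIntegrable (fun t => f t ^ 2) volume a b) :
    (∫ t in a..b, f t) ^ 2 ≤ (b - a) * ∫ t in a..b, f t ^ 2 := by
  rcases hab.eq_or_lt with rfl | hlt
  · simp
  set I := ∫ t in a..b, f t with hI
  have hL : 0 < b - a := sub_pos.2 hlt
  -- The integral of the squared deviation from the mean is nonnegative.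
  have h1 : 0 ≤ ∫ t in a..b, (f t - I / (b - a)) ^ 2 :=
    intervalIntegral.integral_nonneg hab fun _ _ => sq_nonneg _
  have h2 : ∫ t in a..b, (f t - I / (b - a)) ^ 2
      = (∫ t in a..b, f t ^ 2) - 2 * (I / (b - a)) * I + (b - a) * (I / (b - a)) ^ 2 := by
    have e : ∀ t, (f t - I / (b - a)) ^ 2
        = f t ^ 2 - 2 * (I / (b - a)) * f t + (I / (b - a)) ^ 2 := fun t => by ring
    simp only [e]
    rw [intervalIntegral.integral_add (hf2.sub (hf.const_mul _)) intervalIntegrable_const,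
      intervalIntegral.integral_sub hf2 (hf.const_mul _), intervalIntegral.integral_const_mul,
      intervalIntegral.integral_const, smul_eq_mul]
  rw [h2] at h1
  have h3 : (b - a) * ((∫ t in a..b, f t ^ 2) - 2 * (I / (b - a)) * I
      + (b - a) * (I / (b - a)) ^ 2) = (b - a) * (∫ t in a..b, f t ^ 2) - I ^ 2 := by
    field_simp
    ring
  have := mul_nonneg hL.le h1
  rw [h3] at this
  linarith

variable {T : ℝ} {U : TimeJet Y}

/-- The integral extends to `b` rather than `t`, so that the remainders at all time levels of a
window share the same bound. -/
theorem TimeJet.IsH3.norm_utt_sub_le (h : U.IsH3 T) {a t b : ℝ} (ha : 0 ≤ a) (hat : a ≤ t)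
    (htb : t ≤ b) (hb : b ≤ T) : ‖U.utt t - U.utt a‖ ≤ ∫ r in a..b, ‖U.uttt r‖ := by
  have ha' : a ∈ Set.Icc 0 T := ⟨ha, by linarith⟩
  have ht' : t ∈ Set.Icc 0 T := ⟨by linarith, by linarith⟩
  have hb' : b ∈ Set.Icc 0 T := ⟨by linarith, by linarith⟩
  rw [h.prim_tt.sub_eq ha' ht']
  refine (intervalIntegral.norm_integral_le_integral_norm hat).trans ?_
  exact intervalIntegral.integral_mono_interval le_rfl hat htb
    (Filter.Eventually.of_forall fun _ => norm_nonneg _)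
    (intervalIntegrable_of_Icc h.prim_tt.1.norm ha' hb')

theorem TimeJet.IsH3.norm_taylor_ut_le [CompleteSpace Y] (h : U.IsH3 T) {a t b : ℝ} (ha : 0 ≤ a)
    (hat : a ≤ t) (htb : t ≤ b) (hb : b ≤ T) :
    ‖U.ut t - U.ut a - (t - a) • U.utt a‖ ≤ (t - a) * ∫ r in a..b, ‖U.uttt r‖ := by
  have ha' : a ∈ Set.Icc 0 T := ⟨ha, by linarith⟩
  have ht' : t ∈ Set.Icc 0 T := ⟨by linarith, by linarith⟩
  have e : U.ut t - U.ut a - (t - a) • U.utt a = ∫ r in a..t, (U.utt r - U.utt a) := by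
    rw [intervalIntegral.integral_sub (intervalIntegrable_of_Icc h.prim_t.1 ha' ht')
      intervalIntegrable_const, intervalIntegral.integral_const, ← h.prim_t.sub_eq ha' ht']
  rw [e]
  refine (intervalIntegral.norm_integral_le_of_norm_le_const
    (C := ∫ r in a..b, ‖U.uttt r‖) fun r hr => ?_).trans_eq ?_
  · rw [Set.uIoc_of_le hat] at hr
    exact h.norm_utt_sub_le ha hr.1.le (hr.2.trans htb) hb
  · rw [abs_of_nonneg (by linarith), mul_comm]

theorem TimeJet.IsH3.norm_taylor_u_le [CompleteSpace Y] (h : U.IsH3 T) {a t b : ℝ} (ha : 0 ≤ a)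
    (hat : a ≤ t) (htb : t ≤ b) (hb : b ≤ T) :
    ‖U.u t - U.u a - (t - a) • U.ut a - ((t - a) ^ 2 / 2) • U.utt a‖
      ≤ (t - a) ^ 2 * ∫ r in a..b, ‖U.uttt r‖ := by
  have ha' : a ∈ Set.Icc 0 T := ⟨ha, by linarith⟩
  have ht' : t ∈ Set.Icc 0 T := ⟨by linarith, by linarith⟩
  have hb' : b ∈ Set.Icc 0 T := ⟨by linarith, by linarith⟩
  have i1 := intervalIntegrable_of_Icc h.prim.1 ha' ht'
  have i2 : IntervalIntegrable (fun r => (r - a) • U.utt a) volume a t :=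
    Continuous.intervalIntegrable (by fun_prop) _ _
  have e0 : ∫ r in a..t, (r - a) = (t - a) ^ 2 / 2 := by
    rw [intervalIntegral.integral_sub (by simp) (by simp)]
    simp
    ring
  have e : U.u t - U.u a - (t - a) • U.ut a - ((t - a) ^ 2 / 2) • U.utt a
      = ∫ r in a..t, (U.ut r - U.ut a - (r - a) • U.utt a) := by
    rw [intervalIntegral.integral_sub (i1.sub intervalIntegrable_const) i2,
      intervalIntegral.integral_sub i1 intervalIntegrable_const, intervalIntegral.integral_const,
      intervalIntegral.integral_smul_const, e0, ← h.prim.sub_eq ha' ht']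
  have hI : 0 ≤ ∫ r in a..b, ‖U.uttt r‖ :=
    intervalIntegral.integral_nonneg (hat.trans htb) fun _ _ => norm_nonneg _
  rw [e]
  refine (intervalIntegral.norm_integral_le_of_norm_le_const
    (C := (t - a) * ∫ r in a..b, ‖U.uttt r‖) fun r hr => ?_).trans_eq ?_
  · rw [Set.uIoc_of_le hat] at hr
    refine (h.norm_taylor_ut_le ha hr.1.le (hr.2.trans htb) hb).trans ?_
    exact mul_le_mul_of_nonneg_right (by linarith [hr.2]) hI
  · rw [abs_of_nonneg (by linarith)]
    ring

/-- The Taylor remainder at the time level `m + i`, with base point at level `m`. -/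
theorem TimeJet.IsH3.exists_remainder [CompleteSpace Y] (h : U.IsH3 T) {Δt : ℝ} (hΔ : 0 < Δt)
    {m : ℕ} (hm : ((m + 3 : ℕ) : ℝ) * Δt ≤ T) (i : ℕ) (hi : i ≤ 3) :
    ∃ R : Y, U.u (((m + i : ℕ) : ℝ) * Δt) = U.u (m * Δt) + (i * Δt) • U.ut (m * Δt)
        + ((i * Δt) ^ 2 / 2) • U.utt (m * Δt) + R ∧
      ‖R‖ ≤ (i * Δt) ^ 2 * ∫ r in (m * Δt)..(((m + 3 : ℕ) : ℝ) * Δt), ‖U.uttt r‖ := by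
  refine ⟨U.u (((m + i : ℕ) : ℝ) * Δt) - U.u (m * Δt) - (i * Δt) • U.ut (m * Δt)
        - ((i * Δt) ^ 2 / 2) • U.utt (m * Δt), by abel, ?_⟩
  have hi' : (i : ℝ) ≤ 3 := by exact_mod_cast hi
  have e : ((m + i : ℕ) : ℝ) * Δt - m * Δt = i * Δt := by push_cast; ring
  have := h.norm_taylor_u_le (a := m * Δt) (t := ((m + i : ℕ) : ℝ) * Δt)
    (b := ((m + 3 : ℕ) : ℝ) * Δt) (by positivity)
    (by gcongr; simp) (by gcongr) hm
  rwa [e] at this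

theorem TimeJet.IsH3.sq_window_le (h : U.IsH3 T) {Δt : ℝ} (hΔ : 0 < Δt)
    {m : ℕ} (hm : ((m + 3 : ℕ) : ℝ) * Δt ≤ T) :
    (∫ r in (m * Δt)..(((m + 3 : ℕ) : ℝ) * Δt), ‖U.uttt r‖) ^ 2
      ≤ 3 * Δt * ∫ r in (m * Δt)..(((m + 3 : ℕ) : ℝ) * Δt), ‖U.uttt r‖ ^ 2 := by
  have h1 : (m : ℝ) * Δt ≤ ((m + 3 : ℕ) : ℝ) * Δt := by gcongr; simp
  have ha : (m : ℝ) * Δt ∈ Set.Icc 0 T := ⟨by positivity, h1.trans hm⟩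
  have hb : ((m + 3 : ℕ) : ℝ) * Δt ∈ Set.Icc 0 T := ⟨by positivity, hm⟩
  refine (sq_integral_le h1 (intervalIntegrable_of_Icc h.prim_tt.1.norm ha hb)
    (intervalIntegrable_of_Icc h.integrableOn_sq ha hb)).trans_eq ?_
  congr 1
  push_cast
  ring

/-- Third differences annihilate the quadratic Taylor polynomial, so only remainders are left. Their
weights give `9 + 3·4 + 3·1 = 24`, and `1728 = 3·24²` after Cauchy–Schwarz on a window of length `3
Δt`. -/
theorem TimeJet.IsH3.thirdDiff_sq_le [CompleteSpace Y] (h : U.IsH3 T) {Δt : ℝ} (hΔ : 0 < Δt)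
    {m : ℕ} (hm : ((m + 3 : ℕ) : ℝ) * Δt ≤ T) :
    ‖thirdDiff (fun n : ℕ => U.u (n * Δt)) (m + 2)‖ ^ 2
      ≤ 1728 * Δt ^ 5 * ∫ r in (m * Δt)..(((m + 3 : ℕ) : ℝ) * Δt), ‖U.uttt r‖ ^ 2 := by
  obtain ⟨R₁, e1, b1⟩ := h.exists_remainder hΔ hm 1 (by norm_num)
  obtain ⟨R₂, e2, b2⟩ := h.exists_remainder hΔ hm 2 (by norm_num)
  obtain ⟨R₃, e3, b3⟩ := h.exists_remainder hΔ hm 3 (by norm_num)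
  have hw := h.sq_window_le hΔ hm
  set I := ∫ r in (m * Δt)..(((m + 3 : ℕ) : ℝ) * Δt), ‖U.uttt r‖ with hI
  have e : thirdDiff (fun n : ℕ => U.u (n * Δt)) (m + 2)
      = R₃ - (3 : ℝ) • R₂ + (3 : ℝ) • R₁ := by
    simp only [thirdDiff, show m + 2 - 1 = m + 1 from rfl, show m + 2 - 2 = m from rfl,
      show m + 2 + 1 = m + 3 from rfl]
    rw [e1, e2, e3]
    push_cast
    module
  have hb : ‖thirdDiff (fun n : ℕ => U.u (n * Δt)) (m + 2)‖ ≤ 24 * Δt ^ 2 * I := by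
    rw [e]
    have t1 : ‖R₃ - (3 : ℝ) • R₂ + (3 : ℝ) • R₁‖ ≤ ‖R₃‖ + 3 * ‖R₂‖ + 3 * ‖R₁‖ := by
      refine (norm_add_le _ _).trans (add_le_add ((norm_sub_le _ _).trans ?_) ?_) <;>
        simp [norm_smul]
    push_cast at b1 b2 b3
    nlinarith
  calc _ ≤ (24 * Δt ^ 2 * I) ^ 2 := pow_le_pow_left₀ (norm_nonneg _) hb 2
    _ = 576 * Δt ^ 4 * I ^ 2 := by ring
    _ ≤ 576 * Δt ^ 4 * (3 * Δt * ∫ r in (m * Δt)..(((m + 3 : ℕ) : ℝ) * Δt), ‖U.uttt r‖ ^ 2) := by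
        gcongr
    _ = _ := by ring

/-- The quotient is exact for quadratic polynomials. The remainders contribute `(10·9 + 15·4 +
6·1)/6 = 26`, the remainder of the derivative 3, and `2523 = 3·29²`. -/
theorem TimeJet.IsH3.blendedBDF_sub_sq_le [CompleteSpace Y] (h : U.IsH3 T) {Δt : ℝ} (hΔ : 0 < Δt)
    {m : ℕ} (hm : ((m + 3 : ℕ) : ℝ) * Δt ≤ T) :
    ‖blendedBDF Δt (fun n : ℕ => U.u (n * Δt)) (m + 2) - U.ut (((m + 3 : ℕ) : ℝ) * Δt)‖ ^ 2
      ≤ 2523 * Δt ^ 3 * ∫ r in (m * Δt)..(((m + 3 : ℕ) : ℝ) * Δt), ‖U.uttt r‖ ^ 2 := by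
  obtain ⟨R₁, e1, b1⟩ := h.exists_remainder hΔ hm 1 (by norm_num)
  obtain ⟨R₂, e2, b2⟩ := h.exists_remainder hΔ hm 2 (by norm_num)
  obtain ⟨R₃, e3, b3⟩ := h.exists_remainder hΔ hm 3 (by norm_num)
  have hw := h.sq_window_le hΔ hm
  have hS := h.norm_taylor_ut_le (a := m * Δt) (t := ((m + 3 : ℕ) : ℝ) * Δt)
    (b := ((m + 3 : ℕ) : ℝ) * Δt) (by positivity) (by gcongr; simp) le_rfl hm
  set I := ∫ r in (m * Δt)..(((m + 3 : ℕ) : ℝ) * Δt), ‖U.uttt r‖ with hI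
  set S := U.ut (((m + 3 : ℕ) : ℝ) * Δt) - U.ut (m * Δt)
    - (((m + 3 : ℕ) : ℝ) * Δt - m * Δt) • U.utt (m * Δt) with hSdef
  have hut : U.ut (((m + 3 : ℕ) : ℝ) * Δt) = U.ut (m * Δt) + (3 * Δt) • U.utt (m * Δt) + S := by
    rw [hSdef]
    push_cast
    module
  have hS' : ‖S‖ ≤ 3 * Δt * I := by
    refine hS.trans_eq ?_
    push_cast
    ring
  have e : blendedBDF Δt (fun n : ℕ => U.u (n * Δt)) (m + 2) - U.ut (((m + 3 : ℕ) : ℝ) * Δt)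
      = (6 * Δt)⁻¹ • ((10 : ℝ) • R₃ - (15 : ℝ) • R₂ + (6 : ℝ) • R₁) - S := by
    simp only [blendedBDF, show m + 2 - 1 = m + 1 from rfl, show m + 2 - 2 = m from rfl,
      show m + 2 + 1 = m + 3 from rfl]
    rw [e1, e2, e3, hut]
    have hne : Δt ≠ 0 := hΔ.ne'
    push_cast
    match_scalars <;> field_simp <;> ring
  have hb : ‖blendedBDF Δt (fun n : ℕ => U.u (n * Δt)) (m + 2) - U.ut (((m + 3 : ℕ) : ℝ) * Δt)‖
      ≤ 29 * Δt * I := by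
    rw [e]
    have t1 : ‖(10 : ℝ) • R₃ - (15 : ℝ) • R₂ + (6 : ℝ) • R₁‖
        ≤ 10 * ‖R₃‖ + 15 * ‖R₂‖ + 6 * ‖R₁‖ := by
      refine (norm_add_le _ _).trans (add_le_add ((norm_sub_le _ _).trans ?_) ?_) <;>
        simp [norm_smul]
    have t2 : ‖(10 : ℝ) • R₃ - (15 : ℝ) • R₂ + (6 : ℝ) • R₁‖ ≤ 156 * Δt ^ 2 * I := by
      push_cast at b1 b2 b3
      nlinarith
    have t3 : ‖(6 * Δt)⁻¹ • ((10 : ℝ) • R₃ - (15 : ℝ) • R₂ + (6 : ℝ) • R₁)‖ ≤ 26 * Δt * I := by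
      rw [norm_smul, Real.norm_of_nonneg (by positivity), inv_mul_le_iff₀ (by positivity)]
      linarith
    refine (norm_sub_le _ _).trans ?_
    linarith
  calc _ ≤ (29 * Δt * I) ^ 2 := pow_le_pow_left₀ (norm_nonneg _) hb 2
    _ = 841 * Δt ^ 2 * I ^ 2 := by ring
    _ ≤ 841 * Δt ^ 2 * (3 * Δt * ∫ r in (m * Δt)..(((m + 3 : ℕ) : ℝ) * Δt), ‖U.uttt r‖ ^ 2) := by
        gcongr
    _ = _ := by ring

/-- The windows `[t^m, t^{m+3}]` cover `[0,T]` at most three times. -/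
theorem sum_window_le {F : ℝ → ℝ} (hF0 : ∀ t, 0 ≤ F t) (hF : IntegrableOn F (Set.Icc 0 T))
    {Δt : ℝ} (hΔ : 0 < Δt) {M : ℕ} (hM : ((M + 2 : ℕ) : ℝ) * Δt ≤ T) :
    ∑ m ∈ range M, ∫ r in (m * Δt)..(((m + 3 : ℕ) : ℝ) * Δt), F r ≤ 3 * ∫ r in (0 : ℝ)..T, F r := by
  have hmem : ∀ n : ℕ, n ≤ M + 2 → (n : ℝ) * Δt ∈ Set.Icc 0 T := by
    intro n hn
    refine ⟨by positivity, le_trans ?_ hM⟩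
    gcongr
  have hT : 0 ≤ T := (hmem 0 (by omega)).1.trans (hmem 0 (by omega)).2
  have hii : ∀ a b : ℕ, a ≤ M + 2 → b ≤ M + 2 → IntervalIntegrable F volume (a * Δt) (b * Δt) :=
    fun a b ha hb => intervalIntegrable_of_Icc hF (hmem a ha) (hmem b hb)
  -- Each window consists of three steps; for a fixed position in the window the steps are adjacent
  -- and their integrals join into one.
  have hlevel : ∀ i ≤ 2, ∑ m ∈ range M, ∫ r in (((m + i : ℕ) : ℝ) * Δt)..(((m + i + 1 : ℕ) : ℝ) * Δt), F r
      ≤ ∫ r in (0 : ℝ)..T, F r := by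
    intro i hi
    have h1 := intervalIntegral.sum_integral_adjacent_intervals (μ := volume) (f := F)
      (a := fun m : ℕ => ((m + i : ℕ) : ℝ) * Δt) (n := M)
      (fun m hm => hii (m + i) (m + 1 + i) (by omega) (by omega))
    have e : ∀ m : ℕ, m + i + 1 = m + 1 + i := fun m => by omega
    simp only [e]
    rw [h1]
    refine intervalIntegral.integral_mono_interval (hmem _ (by omega)).1 (by gcongr; omega)
      (hmem _ (by omega)).2 (Filter.Eventually.of_forall hF0) ?_
    exact intervalIntegrable_of_Icc hF ⟨le_rfl, hT⟩ ⟨hT, le_rfl⟩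
  have hsplit : ∀ m ∈ range M, ∫ r in (m * Δt)..(((m + 3 : ℕ) : ℝ) * Δt), F r
      = (∫ r in (((m + 0 : ℕ) : ℝ) * Δt)..(((m + 0 + 1 : ℕ) : ℝ) * Δt), F r)
        + (∫ r in (((m + 1 : ℕ) : ℝ) * Δt)..(((m + 1 + 1 : ℕ) : ℝ) * Δt), F r)
        + ∫ r in (((m + 2 : ℕ) : ℝ) * Δt)..(((m + 2 + 1 : ℕ) : ℝ) * Δt), F r := by
    intro m hm
    rw [mem_range] at hm
    rw [intervalIntegral.integral_add_adjacent_intervals (hii _ _ (by omega) (by omega))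
      (hii _ _ (by omega) (by omega)),
      intervalIntegral.integral_add_adjacent_intervals (hii _ _ (by omega) (by omega))
      (hii _ _ (by omega) (by omega))]
    rfl
  rw [Finset.sum_congr rfl hsplit, Finset.sum_add_distrib, Finset.sum_add_distrib]
  have := hlevel 0 (by omega)
  have := hlevel 1 (by omega)
  have := hlevel 2 (by omega)
  linarith

end Time

end EnBDF
end

noncomputable section

namespace EnBDF

/-! ### A lower bound for the discrete norm of a regular function -/

section LowerBound

variable {Z : Type*} [NormedAddCommGroup Z] [NormedSpace ℝ Z] {T : ℝ} {G : TimeJet Z}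

/-- The squared discrete `L²` norm of `G` together with the squared norm of its third derivative. -/
def jetSize (G : TimeJet Z) (T Δt : ℝ) (NT : ℕ) : ℝ :=
  ∑ n ∈ range (NT + 1), Δt * ‖G.u (n * Δt)‖ ^ 2 + Δt ^ 6 * ∫ t in (0 : ℝ)..T, ‖G.uttt t‖ ^ 2

/-- A quadratic polynomial in time that vanishes at three time levels is zero. -/
theorem TimeJet.IsH3.jetSize_pos [CompleteSpace Z] (h : G.IsH3 T)
    (hne : ∃ t ∈ Set.Icc 0 T, G.u t ≠ 0) {NT : ℕ} (hNT : 3 ≤ NT) {Δt : ℝ} (hΔ : 0 < Δt)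
    (hT : NT * Δt = T) : 0 < jetSize G T Δt NT := by
  have hT0 : 0 < T := by
    rw [← hT]
    have : 0 < NT := by omega
    positivity
  have hI0 : 0 ≤ ∫ t in (0 : ℝ)..T, ‖G.uttt t‖ ^ 2 :=
    intervalIntegral.integral_nonneg hT0.le fun _ _ => by positivity
  have hS0 : 0 ≤ ∑ n ∈ range (NT + 1), Δt * ‖G.u (n * Δt)‖ ^ 2 :=
    Finset.sum_nonneg fun _ _ => by positivity
  by_contra hle
  push Not at hle
  rw [jetSize] at hle
  have hp : 0 ≤ Δt ^ 6 * ∫ t in (0 : ℝ)..T, ‖G.uttt t‖ ^ 2 := by positivity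
  have hS : ∑ n ∈ range (NT + 1), Δt * ‖G.u (n * Δt)‖ ^ 2 = 0 := by linarith
  have hI : ∫ t in (0 : ℝ)..T, ‖G.uttt t‖ ^ 2 = 0 := by
    have h6 : Δt ^ 6 * ∫ t in (0 : ℝ)..T, ‖G.uttt t‖ ^ 2 = 0 := by linarith
    rcases mul_eq_zero.1 h6 with h' | h'
    · exact absurd h' (by positivity)
    · exact h'
  have hnode : ∀ n : ℕ, n ≤ NT → G.u (n * Δt) = 0 := by
    intro n hn
    have := (Finset.sum_eq_zero_iff_of_nonneg fun _ _ => by positivity).1 hS n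
      (by rw [mem_range]; omega)
    rcases mul_eq_zero.1 this with h' | h'
    · exact absurd h' hΔ.ne'
    · simpa using h'
  have h0 : (0 : ℝ) ∈ Set.Icc 0 T := ⟨le_rfl, hT0.le⟩
  have h1 : T ∈ Set.Icc 0 T := ⟨hT0.le, le_rfl⟩
  have hI1 : ∫ t in (0 : ℝ)..T, ‖G.uttt t‖ = 0 := by
    have := sq_integral_le hT0.le (intervalIntegrable_of_Icc h.prim_tt.1.norm h0 h1)
      (intervalIntegrable_of_Icc h.integrableOn_sq h0 h1)
    rw [hI, mul_zero] at this
    exact pow_eq_zero_iff (two_ne_zero) |>.1 (le_antisymm this (sq_nonneg _))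
  -- If the size were zero, the third derivative would vanish almost everywhere and the function
  -- would be a quadratic polynomial with zeros at the time levels 0, 1 and 2.
  have htaylor : ∀ t ∈ Set.Icc 0 T, G.u t = G.u 0 + t • G.ut 0 + (t ^ 2 / 2) • G.utt 0 := by
    intro t ht
    have := h.norm_taylor_u_le (a := 0) (t := t) (b := T) le_rfl ht.1 ht.2 le_rfl
    rw [hI1, mul_zero, sub_zero] at this
    have := norm_le_zero_iff.1 this
    rw [sub_sub, sub_sub, sub_eq_zero] at this
    rw [this]
    abel
  have hm : ∀ n : ℕ, n ≤ NT → (n : ℝ) * Δt ∈ Set.Icc 0 T := by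
    intro n hn
    refine ⟨by positivity, ?_⟩
    rw [← hT]
    gcongr
  have e0 := hnode 0 (by omega)
  have e1 := hnode 1 (by omega)
  have e2 := hnode 2 (by omega)
  rw [htaylor _ (hm 1 (by omega))] at e1
  rw [htaylor _ (hm 2 (by omega))] at e2
  simp only [Nat.cast_zero, zero_mul, Nat.cast_one, one_mul, Nat.cast_ofNat] at e0 e1 e2
  rw [e0, zero_add] at e1 e2
  have hutt : G.utt 0 = 0 := by
    have e3 : (Δt ^ 2) • G.utt 0 = ((2 * Δt) • G.ut 0 + ((2 * Δt) ^ 2 / 2) • G.utt 0)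
        - (2 : ℝ) • (Δt • G.ut 0 + (Δt ^ 2 / 2) • G.utt 0) := by module
    rw [e1, e2, smul_zero, sub_zero] at e3
    exact (smul_eq_zero.1 e3).resolve_left (by positivity)
  have hut : G.ut 0 = 0 := by
    rw [hutt, smul_zero, add_zero] at e1
    exact (smul_eq_zero.1 e1).resolve_left hΔ.ne'
  obtain ⟨t, ht, hne⟩ := hne
  apply hne
  rw [htaylor t ht, e0, hut, hutt]
  simp

/-- Continuity at a point where the function does not vanish. The interval is placed on the side of
that point facing the middle of `[0,T]`, which keeps it inside. -/
theorem TimeJet.IsH3.exists_interval (h : G.IsH3 T) (hT0 : 0 < T)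
    (hne : ∃ t ∈ Set.Icc 0 T, G.u t ≠ 0) :
    ∃ a ℓ γ : ℝ, 0 ≤ a ∧ 0 < ℓ ∧ a + ℓ ≤ T ∧ 0 < γ ∧
      ∀ t ∈ Set.Icc a (a + ℓ), γ ≤ ‖G.u t‖ ^ 2 := by
  obtain ⟨t₀, ht₀, hne⟩ := hne
  have hc : ContinuousOn (fun t => ‖G.u t‖ ^ 2) (Set.Icc 0 T) :=
    (h.prim.continuousOn hT0.le).norm.pow 2
  have hpos : 0 < ‖G.u t₀‖ ^ 2 := by positivity
  obtain ⟨δ, hδ, hball⟩ := Metric.continuousWithinAt_iff.1 (hc t₀ ht₀) (‖G.u t₀‖ ^ 2 / 2)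
    (by positivity)
  have hlow : ∀ t ∈ Set.Icc 0 T, |t - t₀| < δ → ‖G.u t₀‖ ^ 2 / 2 ≤ ‖G.u t‖ ^ 2 := by
    intro t ht htd
    have := hball ht (by rwa [Real.dist_eq])
    rw [Real.dist_eq, abs_lt] at this
    linarith [this.1]
  set ℓ := min (δ / 2) (T / 2) with hℓ
  have hℓ0 : 0 < ℓ := lt_min (by positivity) (by positivity)
  have hℓ1 : ℓ ≤ δ / 2 := min_le_left _ _
  have hℓ2 : ℓ ≤ T / 2 := min_le_right _ _
  rcases le_total t₀ (T / 2) with hcase | hcase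
  · refine ⟨t₀, ℓ, ‖G.u t₀‖ ^ 2 / 2, ht₀.1, hℓ0, by linarith, by positivity, fun t ht => ?_⟩
    refine hlow t ⟨by linarith [ht.1, ht₀.1], by linarith [ht.2]⟩ ?_
    rw [abs_lt]
    constructor <;> linarith [ht.1, ht.2]
  · refine ⟨t₀ - ℓ, ℓ, ‖G.u t₀‖ ^ 2 / 2, by linarith, hℓ0, by linarith [ht₀.2], by positivity,
      fun t ht => ?_⟩
    refine hlow t ⟨by linarith [ht.1], by linarith [ht.2, ht₀.2]⟩ ?_
    rw [abs_lt]
    constructor <;> linarith [ht.1, ht.2]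

/-- The first node not before `a` and its successors, `⌊ℓ/Δt⌋` of them in total, stay in the
interval. Their number times `Δt` is at least `ℓ - Δt ≥ ℓ/2`. -/
theorem le_riemann_sum {g : ℝ → ℝ} (hg : ∀ t, 0 ≤ g t) {a ℓ γ Δt : ℝ} {NT : ℕ} (ha : 0 ≤ a)
    (hγ : 0 < γ) (hΔ : 0 < Δt) (haT : a + ℓ ≤ NT * Δt) (hℓ : 2 * Δt ≤ ℓ)
    (hlow : ∀ t ∈ Set.Icc a (a + ℓ), γ ≤ g t) :
    γ * (ℓ / 2) ≤ ∑ n ∈ range (NT + 1), Δt * g (n * Δt) := by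
  set m := ⌈a / Δt⌉₊ with hm
  set K := ⌊ℓ / Δt⌋₊ with hK
  have hm1 : a ≤ m * Δt := (div_le_iff₀ hΔ).1 (Nat.le_ceil _)
  have hm2 : (m : ℝ) * Δt < a + Δt := by
    have := Nat.ceil_lt_add_one (div_nonneg ha hΔ.le)
    have := mul_lt_mul_of_pos_right this hΔ
    rwa [add_mul, div_mul_cancel₀ _ hΔ.ne', one_mul] at this
  have hℓ0 : 0 ≤ ℓ / Δt := div_nonneg (by linarith) hΔ.le
  have hK1 : (K : ℝ) * Δt ≤ ℓ := (le_div_iff₀ hΔ).1 (Nat.floor_le hℓ0)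
  have hK2 : ℓ - Δt ≤ K * Δt := by
    have := Nat.lt_floor_add_one (ℓ / Δt)
    have := mul_lt_mul_of_pos_right this hΔ
    rw [add_mul, div_mul_cancel₀ _ hΔ.ne', one_mul] at this
    linarith
  have hnode : ∀ n ∈ Ico m (m + K), (n : ℝ) * Δt ∈ Set.Icc a (a + ℓ) := by
    intro n hn
    rw [mem_Ico] at hn
    have h1 : (m : ℝ) ≤ n := by exact_mod_cast hn.1
    have h2 : (n : ℝ) + 1 ≤ m + K := by exact_mod_cast hn.2
    have h3 := mul_le_mul_of_nonneg_right h1 hΔ.le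
    have h4 := mul_le_mul_of_nonneg_right h2 hΔ.le
    constructor <;> linarith
  have hsub : Ico m (m + K) ⊆ range (NT + 1) := by
    intro n hn
    have := (hnode n hn).2.trans haT
    have : (n : ℝ) ≤ NT := le_of_mul_le_mul_right this hΔ
    rw [mem_range]
    have : n ≤ NT := by exact_mod_cast this
    omega
  calc γ * (ℓ / 2) ≤ γ * (K * Δt) := by
        refine mul_le_mul_of_nonneg_left ?_ hγ.le
        linarith
    _ = ∑ n ∈ Ico m (m + K), Δt * γ := by
        simp
        ring
    _ ≤ ∑ n ∈ Ico m (m + K), Δt * g (n * Δt) :=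
        Finset.sum_le_sum fun n hn => mul_le_mul_of_nonneg_left (hlow _ (hnode n hn)) hΔ.le
    _ ≤ _ := Finset.sum_le_sum_of_subset_of_nonneg hsub fun n _ _ => mul_nonneg hΔ.le (hg _)

theorem exists_pos_le_of_forall_pos {S : ℕ → ℝ} (N : ℕ) (h : ∀ n, 3 ≤ n → 0 < S n) :
    ∃ c, 0 < c ∧ ∀ n < N, 3 ≤ n → c ≤ S n := by
  induction N with
  | zero => exact ⟨1, one_pos, fun n hn => absurd hn (Nat.not_lt_zero n)⟩
  | succ N ih =>
    obtain ⟨c, hc, hle⟩ := ih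
    by_cases hN : 3 ≤ N
    · refine ⟨min c (S N), lt_min hc (h N hN), fun n hn h3 => ?_⟩
      rcases Nat.lt_succ_iff_lt_or_eq.1 hn with h' | rfl
      · exact (min_le_left _ _).trans (hle n h' h3)
      · exact min_le_right _ _
    · refine ⟨c, hc, fun n hn h3 => hle n ?_ h3⟩
      omega

/-- For a function that does not vanish identically, `jetSize` is bounded below uniformly in the
number of time steps. -/
theorem TimeJet.IsH3.exists_le_jetSize [CompleteSpace Z] (h : G.IsH3 T) (hT0 : 0 < T)
    (hne : ∃ t ∈ Set.Icc 0 T, G.u t ≠ 0) :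
    ∃ c, 0 < c ∧ ∀ (NT : ℕ) (Δt : ℝ), 3 ≤ NT → 0 < Δt → NT * Δt = T → c ≤ jetSize G T Δt NT := by
  obtain ⟨a, ℓ, γ, ha, hℓ, haT, hγ, hlow⟩ := h.exists_interval hT0 hne
  -- Fine grids resolve the interval found above. Only finitely many coarse grids remain, since the
  -- number of steps determines `Δt`; for these the strict positivity on each grid suffices.
  obtain ⟨c, hc, hle⟩ := exists_pos_le_of_forall_pos (S := fun n => jetSize G T (T / n) n)
    (⌈2 * T / ℓ⌉₊) (fun n hn => by
      have hn0 : (0 : ℝ) < n := by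
        have : 0 < n := by omega
        exact_mod_cast this
      exact h.jetSize_pos hne hn (by positivity) (by field_simp))
  refine ⟨min c (γ * (ℓ / 2)), lt_min hc (by positivity), fun NT Δt h3 hΔ hTe => ?_⟩
  have hNT0 : (0 : ℝ) < NT := by
    have : 0 < NT := by omega
    exact_mod_cast this
  have hΔe : T / NT = Δt := by
    rw [← hTe]
    field_simp
  by_cases hcase : NT < ⌈2 * T / ℓ⌉₊
  · refine (min_le_left _ _).trans ?_
    have := hle NT hcase h3
    rwa [hΔe] at this
  · refine (min_le_right _ _).trans ?_
    have h1 : 2 * T / ℓ ≤ NT := (Nat.le_ceil _).trans (by exact_mod_cast not_lt.1 hcase)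
    have h2 : 2 * Δt ≤ ℓ := by
      rw [← hΔe, ← mul_div_assoc, div_le_iff₀ hNT0]
      rw [div_le_iff₀ hℓ] at h1
      linarith
    have h3 := le_riemann_sum (g := fun t => ‖G.u t‖ ^ 2) (fun _ => by positivity) ha hγ hΔ
      (haT.trans_eq hTe.symm) h2 hlow
    have hI0 : 0 ≤ ∫ t in (0 : ℝ)..T, ‖G.uttt t‖ ^ 2 :=
      intervalIntegral.integral_nonneg hT0.le fun _ _ => by positivity
    have hp : 0 ≤ Δt ^ 6 * ∫ t in (0 : ℝ)..T, ‖G.uttt t‖ ^ 2 := by positivity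
    rw [jetSize]
    linarith

end LowerBound

end EnBDF
end

noncomputable section

namespace EnBDF

variable {d : ℕ} {Ω : Set (Pt d)}

/-! ### One step of the error analysis -/

/-- The `G`-stability identity of the blended difference quotient. -/
theorem inner_blended {H : Type*} [NormedAddCommGroup H] [InnerProductSpace ℝ H] (a b c e : H) :
    inner ℝ ((10 : ℝ) • a - (15 : ℝ) • b + (6 : ℝ) • c - e) a
      = (1 / 2 * ‖a‖ ^ 2 + 1 / 2 * ‖(3 : ℝ) • a - b‖ ^ 2
          + 1 / 2 * ‖(3 : ℝ) • a - (3 : ℝ) • b + c‖ ^ 2)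
        - (1 / 2 * ‖b‖ ^ 2 + 1 / 2 * ‖(3 : ℝ) • b - c‖ ^ 2
          + 1 / 2 * ‖(3 : ℝ) • b - (3 : ℝ) • c + e‖ ^ 2)
        + 1 / 2 * ‖a - (3 : ℝ) • b + (3 : ℝ) • c - e‖ ^ 2 := by
  simp only [← real_inner_self_eq_norm_sq, inner_add_left, inner_add_right, inner_sub_left,
    inner_sub_right, real_inner_smul_left, real_inner_smul_right]
  rw [real_inner_comm a b, real_inner_comm a c, real_inner_comm a e, real_inner_comm b c,
    real_inner_comm b e, real_inner_comm c e]
  ring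

/-- The decomposition of the nonlinear consistency error, with
`u_h = u - η - ξ`, `𝓔 u_h = Eu - Eη - Eξ`. -/
theorem TriBound.nonlinear_eq {C : ℝ} (hT : TriBound Ω C) {u Eu η Eη ξ Eξ w : SobolevV Ω 1}
    (hu : u ∈ X Ω) (hEu : Eu ∈ X Ω) (hη : η ∈ X Ω) (hEη : Eη ∈ X Ω) (hξ : ξ ∈ X Ω)
    (hEξ : Eξ ∈ X Ω) (hw : w ∈ X Ω) :
    bStar u u ξ - bStar (Eu - Eη - Eξ - w) (u - η - ξ) ξ - bStar w (Eu - Eη - Eξ) ξ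
      = bStar (u - Eu) u ξ + bStar Eη u ξ + bStar Eξ u ξ + bStar Eu η ξ - bStar Eη η ξ
        - bStar Eξ η ξ + bStar w (u - Eu) ξ - bStar w (η - Eη) ξ - bStar w (ξ - Eξ) ξ := by
  have m1 := (X Ω).sub_mem hEu hEη
  have m2 := (X Ω).sub_mem m1 hEξ
  have m3 := (X Ω).sub_mem hu hη
  have m4 := (X Ω).sub_mem m3 hξ
  rw [hT.bStar_sub_left m2 hw m4 hξ, hT.bStar_sub_mid m2 m3 hξ hξ, hT.bStar_sub_mid m2 hu hη hξ,
    bStar_self, hT.bStar_sub_left m1 hEξ hu hξ, hT.bStar_sub_left hEu hEη hu hξ,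
    hT.bStar_sub_left m1 hEξ hη hξ, hT.bStar_sub_left hEu hEη hη hξ,
    hT.bStar_sub_mid hw m3 hξ hξ, hT.bStar_sub_mid hw hu hη hξ, bStar_self,
    hT.bStar_sub_mid hw m1 hEξ hξ, hT.bStar_sub_mid hw hEu hEη hξ,
    hT.bStar_sub_left hu hEu hu hξ, hT.bStar_sub_mid hw hu hEu hξ, hT.bStar_sub_mid hw hη hEη hξ,
    hT.bStar_sub_mid hw hξ hEξ hξ, bStar_self]
  ring

theorem abs_nine_le {a b c e f g h k l A B C E F G H K L : ℝ} (h1 : |a| ≤ A) (h2 : |b| ≤ B)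
    (h3 : |c| ≤ C) (h4 : |e| ≤ E) (h5 : |f| ≤ F) (h6 : |g| ≤ G) (h7 : |h| ≤ H) (h8 : |k| ≤ K)
    (h9 : |l| ≤ L) :
    |a + b + c + e - f - g + h - k - l| ≤ A + B + C + E + F + G + H + K + L := by
  rw [abs_le] at *
  constructor <;> linarith [h1.1, h1.2, h2.1, h2.2, h3.1, h3.2, h4.1, h4.2, h5.1, h5.2, h6.1, h6.2,
    h7.1, h7.2, h8.1, h8.2, h9.1, h9.2]

theorem FormBound.full_le {B : ℝ} (hB : FormBound Ω B) {u v w : SobolevV Ω 1} (hu : u ∈ X Ω)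
    (hv : v ∈ X Ω) (hw : w ∈ X Ω) {a b : ℝ} (ha : gn u ≤ a) (hb : gn v ≤ b) :
    |bStar u v w| ≤ B * a * b * gn w := by
  have := hB.pos
  have := gn_nonneg u
  have := gn_nonneg v
  have := gn_nonneg w
  refine (hB.full u hu v hv w hw).trans ?_
  have : 0 ≤ a := by linarith
  gcongr

theorem FormBound.left_le {B : ℝ} (hB : FormBound Ω B) {u v w : SobolevV Ω 1} (hu : u ∈ X Ω)
    (hv : v ∈ X Ω) (hw : w ∈ X Ω) {b : ℝ} (hb : gn v ≤ b) :
    |bStar u v w| ≤ B * Real.sqrt (vn u * gn u) * b * gn w := by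
  have := hB.pos
  have := gn_nonneg w
  refine (hB.left u hu v hv w hw).trans ?_
  gcongr

theorem FormBound.mid_le {B : ℝ} (hB : FormBound Ω B) {u v w : SobolevV Ω 1} (hu : u ∈ X Ω)
    (hv : v ∈ X Ω) (hw : w ∈ X Ω) :
    |bStar u v w| ≤ B * gn u * (Real.sqrt B * gn v) * gn w := by
  have hB0 := hB.pos
  have := gn_nonneg u
  have := gn_nonneg w
  have h1 := sqrt_mul_le_of_le hB0.le (gn_nonneg v) (hB.poincare _ hv)
  refine (hB.mid u hu v hv w hw).trans ?_
  gcongr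

/-- The terms with `Eξ` keep half a derivative free for Gronwall, and the term with `ξ - Eξ` keeps
it free for the inverse inequality. All other terms are consistency or approximation errors and may
be bounded by full gradients. -/
theorem FormBound.nonlinear_le {B : ℝ} (hB : FormBound Ω B)
    {u Eu η Eη ξ Eξ w : SobolevV Ω 1} {M : ℝ}
    (hu : u ∈ X Ω) (hEu : Eu ∈ X Ω) (hη : η ∈ X Ω) (hEη : Eη ∈ X Ω) (hξ : ξ ∈ X Ω)
    (hEξ : Eξ ∈ X Ω) (hw : w ∈ X Ω) (hM : gn u ≤ M) (hM7 : gn Eu ≤ 7 * M)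
    (hMη : gn η ≤ M) :
    |bStar (u - Eu) u ξ + bStar Eη u ξ + bStar Eξ u ξ + bStar Eu η ξ - bStar Eη η ξ
        - bStar Eξ η ξ + bStar w (u - Eu) ξ - bStar w (η - Eη) ξ - bStar w (ξ - Eξ) ξ|
      ≤ B * M * (gn (u - Eu) + 2 * gn Eη + 7 * gn η) * gn ξ
        + 2 * B * M * Real.sqrt (vn Eξ * gn Eξ) * gn ξ
        + B * Real.sqrt B * gn w * (gn (u - Eu) + gn (η - Eη)) * gn ξ
        + B * gn w * Real.sqrt (vn (ξ - Eξ) * gn (ξ - Eξ)) * gn ξ := by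
  have δu := (X Ω).sub_mem hu hEu
  have δη := (X Ω).sub_mem hη hEη
  have δξ := (X Ω).sub_mem hξ hEξ
  have b1 := hB.full_le δu hu hξ le_rfl hM
  have b2 := hB.full_le hEη hu hξ le_rfl hM
  have b3 := hB.left_le hEξ hu hξ hM
  have b4 := hB.full_le hEu hη hξ hM7 le_rfl
  have b5 := hB.full_le hEη hη hξ le_rfl hMη
  have b6 := hB.left_le hEξ hη hξ hMη
  have b7 := hB.mid_le hw δu hξ
  have b8 := hB.mid_le hw δη hξ
  have b9 := hB.mid _ hw _ δξ _ hξ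
  refine (abs_nine_le b1 b2 b3 b4 b5 b6 b7 b8 b9).trans_eq ?_
  ring

theorem two_mul_le_of_sq {p q a b : ℝ} (hp : 0 < p) (h : b ^ 2 ≤ p * q) :
    2 * b * a ≤ p * a ^ 2 + q := by
  have h1 : 0 ≤ (p * a - b) ^ 2 := sq_nonneg _
  have h2 : p * (2 * b * a) ≤ p * (p * a ^ 2 + q) := by nlinarith
  exact le_of_mul_le_mul_left h2 hp

/-- Young's inequalities of one step. -/
theorem step_absorb {E₁ E₀ D Dg a x x' wn q R rhs ν Δt h B M Cinv : ℝ} (hν : 0 < ν) (hΔ : 0 < Δt)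
    (hh : 0 < h) (hB : 0 < B) (hCinv : 0 < Cinv) (hD : 0 ≤ D)
    (hx : 0 ≤ x) (hx' : 0 ≤ x') (hDg : h * Dg ≤ Cinv * D)
    (hCFL : 36 * B ^ 2 * Cinv * (Δt / (ν * h)) * wn ^ 2 ≤ 1)
    (hid : E₁ - E₀ + 1 / 2 * D ^ 2 + 6 * Δt * (ν * a ^ 2) = 6 * Δt * rhs)
    (hrhs : rhs ≤ R * a + 2 * B * M * Real.sqrt (x * x') * a + B * Real.sqrt B * wn * q * a
      + B * wn * Real.sqrt (D * Dg) * a) :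
    E₁ + 1 / 4 * D ^ 2 + 4 * ν * Δt * a ^ 2
      ≤ E₀ + ν * Δt / 27 * x' ^ 2 + 27 / (4 * ν) * (108 * B ^ 2 * M ^ 2 / ν) ^ 2 * Δt * x ^ 2
        + 27 / ν * Δt * R ^ 2 + 3 * B / (4 * Cinv) * h * q ^ 2 := by
  have hwn2 : 36 * B ^ 2 * Cinv * Δt * wn ^ 2 ≤ ν * h := by
    have h1 : 36 * B ^ 2 * Cinv * (Δt / (ν * h)) * wn ^ 2
        = 36 * B ^ 2 * Cinv * Δt * wn ^ 2 / (ν * h) := by ring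
    rw [h1, div_le_one (by positivity)] at hCFL
    exact hCFL
  -- Of the dissipation `6 ν Δt a²`, the estimates `t1`, `t2` and `t4` use one third of `ν Δt a²`
  -- each and `t5` uses a full one, which leaves the factor 4. Half of `½ D²` is spent in `t5`.
  have t1 : 6 * R * a ≤ ν / 3 * a ^ 2 + 27 / ν * R ^ 2 := by
    have := two_mul_le_of_sq (a := a) (b := 3 * R) (p := ν / 3) (q := 27 / ν * R ^ 2)
      (by positivity) (le_of_eq (by field_simp; ring))
    linarith
  have t2 : 12 * B * M * Real.sqrt (x * x') * a
      ≤ ν / 3 * a ^ 2 + 108 * B ^ 2 * M ^ 2 / ν * (x * x') := by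
    have := two_mul_le_of_sq (a := a) (b := 6 * B * M * Real.sqrt (x * x')) (p := ν / 3)
      (q := 108 * B ^ 2 * M ^ 2 / ν * (x * x')) (by positivity) (by
        rw [mul_pow, Real.sq_sqrt (by positivity)]
        exact le_of_eq (by field_simp; ring))
    linarith
  have t3 : 108 * B ^ 2 * M ^ 2 / ν * (x * x')
      ≤ ν / 27 * x' ^ 2 + 27 / (4 * ν) * (108 * B ^ 2 * M ^ 2 / ν) ^ 2 * x ^ 2 := by
    have := two_mul_le_of_sq (a := x') (b := 108 * B ^ 2 * M ^ 2 / ν * x / 2) (p := ν / 27)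
      (q := 27 / (4 * ν) * (108 * B ^ 2 * M ^ 2 / ν) ^ 2 * x ^ 2) (by positivity)
      (le_of_eq (by field_simp; ring))
    linarith
  -- No bound on the fluctuation itself is available; the time step condition trades `Δt wn²` for `ν
  -- h`, which explains the weight `h` of `q²`.
  have t4 : 6 * Δt * (B * Real.sqrt B * wn * q) * a
      ≤ Δt * ν / 3 * a ^ 2 + 3 * B / (4 * Cinv) * h * q ^ 2 := by
    have hs : Real.sqrt B ^ 2 = B := Real.sq_sqrt hB.le
    have := two_mul_le_of_sq (a := a) (b := 3 * Δt * (B * Real.sqrt B * wn * q)) (p := Δt * ν / 3)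
      (q := 3 * B / (4 * Cinv) * h * q ^ 2) (by positivity) (by
        have e1 : (3 * Δt * (B * Real.sqrt B * wn * q)) ^ 2
            = Δt * B * q ^ 2 / (4 * Cinv) * (36 * B ^ 2 * Cinv * Δt * wn ^ 2) := by
          have : (3 * Δt * (B * Real.sqrt B * wn * q)) ^ 2
            = 9 * Δt ^ 2 * B ^ 2 * Real.sqrt B ^ 2 * wn ^ 2 * q ^ 2 := by ring
          rw [this, hs]
          field_simp
          ring
        rw [e1]
        calc _ ≤ Δt * B * q ^ 2 / (4 * Cinv) * (ν * h) := by gcongr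
          _ = _ := by field_simp)
    linarith
  -- The inverse inequality turns `D * Dg` into `D²/h`, and the factor 36 in the time step condition
  -- is exactly what makes the result fit below `¼ D²`.
  have t5 : 6 * Δt * (B * wn * Real.sqrt (D * Dg)) * a ≤ ν * Δt * a ^ 2 + 1 / 4 * D ^ 2 := by
    have hDg' : D * Dg ≤ Cinv / h * D ^ 2 := by
      have : Dg ≤ Cinv * D / h := by
        rw [le_div_iff₀ hh]
        linarith
      calc D * Dg ≤ D * (Cinv * D / h) := by gcongr
        _ = _ := by ring
    have hsq : Real.sqrt (D * Dg) ^ 2 ≤ Cinv / h * D ^ 2 := by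
      rcases le_total 0 (D * Dg) with h0 | h0
      · rwa [Real.sq_sqrt h0]
      · rw [Real.sqrt_eq_zero_of_nonpos h0]
        simp only [ne_eq, OfNat.ofNat_ne_zero, not_false_eq_true, zero_pow]
        positivity
    have := two_mul_le_of_sq (a := a) (b := 3 * Δt * (B * wn * Real.sqrt (D * Dg))) (p := ν * Δt)
      (q := 1 / 4 * D ^ 2) (by positivity) (by
        have e1 : (3 * Δt * (B * wn * Real.sqrt (D * Dg))) ^ 2
            = 9 * Δt ^ 2 * B ^ 2 * wn ^ 2 * Real.sqrt (D * Dg) ^ 2 := by ring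
        rw [e1]
        calc _ ≤ 9 * Δt ^ 2 * B ^ 2 * wn ^ 2 * (Cinv / h * D ^ 2) := by gcongr
          _ = Δt * D ^ 2 / (4 * h) * (36 * B ^ 2 * Cinv * Δt * wn ^ 2) := by field_simp; ring
          _ ≤ Δt * D ^ 2 / (4 * h) * (ν * h) := by gcongr
          _ = _ := by field_simp)
    linarith
  have u1 := mul_le_mul_of_nonneg_left t1 hΔ.le
  have u2 := mul_le_mul_of_nonneg_left t2 hΔ.le
  have u3 := mul_le_mul_of_nonneg_left t3 hΔ.le
  have u4 := mul_le_mul_of_nonneg_left hrhs (by positivity : 0 ≤ 6 * Δt)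
  have key : E₁ + 1 / 2 * D ^ 2 + 6 * Δt * (ν * a ^ 2)
      ≤ E₀ + Δt * (6 * R * a) + Δt * (12 * B * M * Real.sqrt (x * x') * a)
        + 6 * Δt * (B * Real.sqrt B * wn * q) * a + 6 * Δt * (B * wn * Real.sqrt (D * Dg)) * a := by
    linarith
  linarith

end EnBDF
end

noncomputable section

namespace EnBDF

/-! ### Linearity of extrapolation and difference operators -/

section Sequences

variable {E : Type*} [AddCommGroup E] [Module ℝ E]

theorem thirdDiff_eq (u : ℕ → E) (n : ℕ) : thirdDiff u n = u (n + 1) - extrap u n := by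
  simp only [thirdDiff, extrap]
  abel

theorem extrap_mem (S : Submodule ℝ E) {u : ℕ → E} {n : ℕ} (h : ∀ i ≤ n, u i ∈ S) :
    extrap u n ∈ S :=
  S.add_mem (S.sub_mem (S.smul_mem _ (h _ le_rfl)) (S.smul_mem _ (h _ (Nat.sub_le _ _))))
    (h _ (Nat.sub_le _ _))

theorem thirdDiff_mem (S : Submodule ℝ E) {u : ℕ → E} {n : ℕ} (h : ∀ i ≤ n + 1, u i ∈ S) :
    thirdDiff u n ∈ S := by
  rw [thirdDiff_eq]
  exact S.sub_mem (h _ le_rfl) (extrap_mem S fun i hi => h i (hi.trans (Nat.le_succ n)))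

theorem blendedBDF_mem (S : Submodule ℝ E) (Δt : ℝ) {u : ℕ → E} {n : ℕ}
    (h : ∀ i ≤ n + 1, u i ∈ S) : blendedBDF Δt u n ∈ S :=
  S.smul_mem _ (S.sub_mem (S.add_mem (S.sub_mem (S.smul_mem _ (h _ le_rfl))
    (S.smul_mem _ (h _ (by omega)))) (S.smul_mem _ (h _ (by omega)))) (h _ (by omega)))

theorem extrap_sub_sub {u v η ξ : ℕ → E} (h : ∀ n, u n = v n + η n + ξ n) (n : ℕ) :
    extrap v n = extrap u n - extrap η n - extrap ξ n := by
  simp only [extrap, h]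
  module

theorem blendedBDF_sub_sub (Δt : ℝ) {u v η ξ : ℕ → E} (h : ∀ n, u n = v n + η n + ξ n) (n : ℕ) :
    blendedBDF Δt v n = blendedBDF Δt u n - blendedBDF Δt η n - blendedBDF Δt ξ n := by
  simp only [blendedBDF, h]
  module

theorem map_extrap {F : Type*} [AddCommGroup F] [Module ℝ F] (L : E →ₗ[ℝ] F) (u : ℕ → E) (n : ℕ) :
    L (extrap u n) = extrap (fun i => L (u i)) n := by
  simp [extrap]

theorem map_thirdDiff {F : Type*} [AddCommGroup F] [Module ℝ F] (L : E →ₗ[ℝ] F) (u : ℕ → E)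
    (n : ℕ) : L (thirdDiff u n) = thirdDiff (fun i => L (u i)) n := by
  simp [thirdDiff]

theorem map_blendedBDF {F : Type*} [AddCommGroup F] [Module ℝ F] (L : E →ₗ[ℝ] F) (Δt : ℝ)
    (u : ℕ → E) (n : ℕ) : L (blendedBDF Δt u n) = blendedBDF Δt (fun i => L (u i)) n := by
  simp [blendedBDF]

end Sequences

/-! ### The energy inequality of one time step -/

variable {d : ℕ} {Ω : Set (Pt d)}

theorem gn_smul (r : ℝ) (v : SobolevV Ω 1) : gn (r • v) = |r| * gn v := by
  rw [gn, map_smul, norm_smul, Real.norm_eq_abs, gn]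

theorem gn_add_le (v w : SobolevV Ω 1) : gn (v + w) ≤ gn v + gn w := by
  rw [gn, map_add]
  exact norm_add_le _ _

theorem gn_sub_le (v w : SobolevV Ω 1) : gn (v - w) ≤ gn v + gn w := by
  rw [gn, map_sub]
  exact norm_sub_le _ _

theorem vn_add_le (v w : SobolevV Ω 1) : vn (v + w) ≤ vn v + vn w := by
  rw [vn, map_add]
  exact norm_add_le _ _

theorem gn_extrap_le (u : ℕ → SobolevV Ω 1) (n : ℕ) :
    gn (extrap u n) ≤ 3 * gn (u n) + 3 * gn (u (n - 1)) + gn (u (n - 2)) := by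
  refine (gn_add_le _ _).trans (add_le_add_left ((gn_sub_le _ _).trans ?_) _)
  rw [gn_smul, gn_smul, abs_of_nonneg (by norm_num : (0 : ℝ) ≤ 3)]

/-- The part of the energy that does not involve gradients. -/
def valEnergy (e : ℕ → SobolevV Ω 1) (N : ℕ) : ℝ :=
  1 / 2 * nsq (e N) + 1 / 2 * nsq ((3 : ℝ) • e N - e (N - 1)) + 1 / 2 * nsq (extrap e N)

theorem inner_blendedBDF {Δt : ℝ} (hΔ : 0 < Δt) (ξ : ℕ → SobolevV Ω 1) (m : ℕ) :
    6 * Δt * inner ℝ (valM (blendedBDF Δt ξ (m + 2))) (valM (ξ (m + 3)))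
      = valEnergy ξ (m + 3) - valEnergy ξ (m + 2) + 1 / 2 * vn (thirdDiff ξ (m + 2)) ^ 2 := by
  have key := inner_blended (valM (ξ (m + 3))) (valM (ξ (m + 2))) (valM (ξ (m + 1))) (valM (ξ m))
  have hmul : ∀ x : ℝ, 6 * Δt * ((6 * Δt)⁻¹ * x) = x := fun x => by field_simp
  have e : valM (blendedBDF Δt ξ (m + 2)) = (6 * Δt)⁻¹ • ((10 : ℝ) • valM (ξ (m + 3))
      - (15 : ℝ) • valM (ξ (m + 2)) + (6 : ℝ) • valM (ξ (m + 1)) - valM (ξ m)) :=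
    map_blendedBDF valM Δt ξ (m + 2)
  rw [e, real_inner_smul_left, hmul, key]
  simp only [valEnergy, nsq_eq_vn, vn, extrap, thirdDiff, map_sub, map_add, map_smul]
  rfl

theorem norm_dvg_le (v : SobolevV Ω 1) : ‖dvg v‖ ≤ ‖traceL Ω‖ * gn v := by
  rw [dvg_eq]
  exact (traceL Ω).le_opNorm _

theorem real_inner_le_of_norm_le {H : Type*} [NormedAddCommGroup H] [InnerProductSpace ℝ H]
    {x y : H} {a b : ℝ} (ha : ‖x‖ ≤ a) (hb : ‖y‖ ≤ b) : inner ℝ x y ≤ a * b :=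
  (real_inner_le_norm x y).trans
    (mul_le_mul ha hb (norm_nonneg _) ((norm_nonneg _).trans ha))

theorem inner_valV_sub_sub (a b c z : SobolevV Ω 1) : inner ℝ (valV (a - b - c)) (valV z)
    = inner ℝ (valM a) (valM z) - inner ℝ (valM b) (valM z) - inner ℝ (valM c) (valM z) := by
  rw [← inner_sub_left, ← inner_sub_left, ← map_sub, ← map_sub]
  rfl

theorem inner_sub_sub_self {H : Type*} [NormedAddCommGroup H] [InnerProductSpace ℝ H]
    {x y z : H} (h : inner ℝ y z = 0) : inner ℝ (x - y - z) z = inner ℝ x z - ‖z‖ ^ 2 := by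
  rw [inner_sub_left, inner_sub_left, h, sub_zero, real_inner_self_eq_norm_sq]

theorem gradInner_sub_sub {u η ξ : SobolevV Ω 1} (h : inner ℝ (gradM η) (gradM ξ) = 0) :
    gradInner (u - η - ξ) ξ = gradInner u ξ - gn ξ ^ 2 := by
  rw [gradInner_eq, gradInner_eq, map_sub, map_sub]
  exact inner_sub_sub_self h

theorem inner_sub_sub_le {H : Type*} [NormedAddCommGroup H] [InnerProductSpace ℝ H]
    {x y z w : H} {a b : ℝ} (hz : ‖z‖ ≤ a) (hw : ‖w‖ ≤ b) :
    inner ℝ x w - inner ℝ y w - inner ℝ z w ≤ (‖x - y‖ + a) * b := by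
  rw [← inner_sub_left, ← inner_sub_left]
  exact real_inner_le_of_norm_le ((norm_sub_le _ _).trans (add_le_add_right hz _)) hw

/-- The relations among the arguments are hypotheses here, so that the bound applies to members of
sequences without rewriting inside the forms. The advecting field `A` enters only through `A + w =
z`. -/
theorem FormBound.nonlinear_le_of_eq {B C : ℝ} (hB : FormBound Ω B) (hT : TriBound Ω C)
    {u Eu η Eη ξ Eξ w y z A δu δη δξ : SobolevV Ω 1} {M : ℝ}
    (hu : u ∈ X Ω) (hEu : Eu ∈ X Ω) (hη : η ∈ X Ω) (hEη : Eη ∈ X Ω) (hξ : ξ ∈ X Ω)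
    (hEξ : Eξ ∈ X Ω) (hw : w ∈ X Ω) (hM : gn u ≤ M) (hM7 : gn Eu ≤ 7 * M) (hMη : gn η ≤ M)
    (hy : u = y + η + ξ) (hz : z = Eu - Eη - Eξ) (hA : A + w = z) (hδu : δu = u - Eu)
    (hδη : δη = η - Eη) (hδξ : δξ = ξ - Eξ) :
    |bStar u u ξ - bStar A y ξ - bStar w z ξ|
      ≤ B * M * (gn δu + 2 * gn Eη + 7 * gn η) * gn ξ
        + 2 * B * M * Real.sqrt (vn Eξ * gn Eξ) * gn ξ
        + B * Real.sqrt B * gn w * (gn δu + gn δη) * gn ξ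
        + B * gn w * Real.sqrt (vn δξ * gn δξ) * gn ξ := by
  obtain rfl : y = u - η - ξ := by
    rw [hy]
    abel
  obtain rfl : A = z - w := eq_sub_of_add_eq hA
  subst hz hδu hδη hδξ
  rw [hT.nonlinear_eq hu hEu hη hEη hξ hEξ hw]
  exact hB.nonlinear_le hu hEu hη hEη hξ hEξ hw hM hM7 hMη

/-- The size of the consistency errors in one step. -/
def stepResidual (B M Δt : ℝ) (u η : ℕ → SobolevV Ω 1) (ut : L2V Ω) (r : L2 Ω) (n : ℕ) : ℝ :=
  B * (‖valM (blendedBDF Δt u n) - ut‖ + B * gn (blendedBDF Δt η n)) + ‖traceL Ω‖ * ‖r‖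
    + B * M * (gn (thirdDiff u n) + 2 * gn (extrap η n) + 7 * gn (η (n + 1)))

-- Exact minus discrete equation, tested with the newest `ξ`. Orthogonality of the projection
-- removes `∇η` from the viscous term, and discrete incompressibility of the test field removes `ph`
-- and allows `q` to be subtracted from `p`.
set_option maxHeartbeats 1000000 in
theorem energy_step {k s : ℕ} {Cinv β Capp h ν Δt B C M : ℝ} (hΩo : IsOpen Ω)
    (hΩb : Bornology.IsBounded Ω) (hT : TriBound Ω C) (hB : FormBound Ω B)
    {Xh : Submodule ℝ (SobolevV Ω 1)} {Qh : Submodule ℝ (L2 Ω)}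
    (hF : IsFEPair Ω k s Cinv β Capp h Xh Qh) (hν : 0 < ν) (hΔ : 0 < Δt) (hCinv : 0 < Cinv)
    {m : ℕ} {u η ξ v : ℕ → SobolevV Ω 1} {A w : SobolevV Ω 1}
    (hdec : ∀ n, u n = v n + η n + ξ n) (hu : ∀ n ≤ m + 3, u n ∈ X Ω)
    (hη : ∀ n ≤ m + 3, η n ∈ X Ω) (hξ : ∀ n ≤ m + 3, ξ n ∈ Xh)
    (hξV : ξ (m + 3) ∈ discDivFree Xh Qh) (hw : w ∈ X Ω) (hA : A + w = extrap v (m + 2))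
    (horth : inner ℝ (gradM (η (m + 3))) (gradM (ξ (m + 3))) = 0) (hdiv : dvg (u (m + 3)) = 0)
    {ut F : L2V Ω} {p ph q : L2 Ω} (hph : ph ∈ Qh) (hq : q ∈ Qh)
    (hexact : inner ℝ ut (valV (ξ (m + 3))) + conv (u (m + 3)) (u (m + 3)) (ξ (m + 3))
      + ν * gradInner (u (m + 3)) (ξ (m + 3)) - inner ℝ p (dvg (ξ (m + 3)))
      = inner ℝ F (valV (ξ (m + 3))))
    (hdisc : inner ℝ (valV (blendedBDF Δt v (m + 2))) (valV (ξ (m + 3)))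
      + bStar A (v (m + 3)) (ξ (m + 3)) + bStar w (extrap v (m + 2)) (ξ (m + 3))
      - inner ℝ ph (dvg (ξ (m + 3))) + ν * gradInner (v (m + 3)) (ξ (m + 3))
      = inner ℝ F (valV (ξ (m + 3))))
    (hM : ∀ n ≤ m + 3, gn (u n) ≤ M) (hMη : gn (η (m + 3)) ≤ M)
    (hCFL : 36 * B ^ 2 * Cinv * (Δt / (ν * h)) * gradNsq w ≤ 1) :
    valEnergy ξ (m + 3) + 1 / 4 * vn (thirdDiff ξ (m + 2)) ^ 2
        + 4 * ν * Δt * gn (ξ (m + 3)) ^ 2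
      ≤ valEnergy ξ (m + 2) + ν * Δt / 27 * gn (extrap ξ (m + 2)) ^ 2
        + 27 / (4 * ν) * (108 * B ^ 2 * M ^ 2 / ν) ^ 2 * Δt * vn (extrap ξ (m + 2)) ^ 2
        + 27 / ν * Δt * stepResidual B M Δt u η ut (p - q) (m + 2) ^ 2
        + 3 * B / (4 * Cinv) * h
          * (gn (thirdDiff u (m + 2)) + gn (thirdDiff η (m + 2))) ^ 2 := by
  have hX := hF.conforming_X
  have hB0 := hB.pos
  have hξX : ∀ n ≤ m + 3, ξ n ∈ X Ω := fun n hn => hX (hξ n hn)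
  have m1 := hu (m + 3) le_rfl
  have m2 : extrap u (m + 2) ∈ X Ω := extrap_mem _ fun i hi => hu i (by omega)
  have m3 := hη (m + 3) le_rfl
  have m4 : extrap η (m + 2) ∈ X Ω := extrap_mem _ fun i hi => hη i (by omega)
  have m5 := hξX (m + 3) le_rfl
  have m6 : extrap ξ (m + 2) ∈ X Ω := extrap_mem _ fun i hi => hξX i (by omega)
  have hM7 : gn (extrap u (m + 2)) ≤ 7 * M := by
    have h0 := gn_extrap_le u (m + 2)
    have h1 := hM (m + 2) (by omega)
    have h2 := hM (m + 2 - 1) (by omega)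
    have h3 := hM (m + 2 - 2) (by omega)
    linarith
  have eu : thirdDiff u (m + 2) = u (m + 3) - extrap u (m + 2) := thirdDiff_eq _ _
  have eη : thirdDiff η (m + 2) = η (m + 3) - extrap η (m + 2) := thirdDiff_eq _ _
  have eξ : thirdDiff ξ (m + 2) = ξ (m + 3) - extrap ξ (m + 2) := thirdDiff_eq _ _
  have ev : extrap v (m + 2) = extrap u (m + 2) - extrap η (m + 2) - extrap ξ (m + 2) :=
    extrap_sub_sub hdec _
  have ev3 : v (m + 3) = u (m + 3) - η (m + 3) - ξ (m + 3) := by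
    rw [hdec (m + 3)]
    abel
  have hNL := hB.nonlinear_le_of_eq hT m1 m2 m3 m4 m5 m6 hw (hM _ le_rfl) hM7 hMη (hdec (m + 3))
    ev hA eu eη eξ
  rw [← bStar_eq_conv hΩo hΩb hT m1 m1 m5 hdiv] at hexact
  have hgrad : gradInner (v (m + 3)) (ξ (m + 3))
      = gradInner (u (m + 3)) (ξ (m + 3)) - gn (ξ (m + 3)) ^ 2 := by
    rw [ev3]
    exact gradInner_sub_sub horth
  have hval : inner ℝ (valV (blendedBDF Δt v (m + 2))) (valV (ξ (m + 3)))
      = inner ℝ (valM (blendedBDF Δt u (m + 2))) (valM (ξ (m + 3)))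
        - inner ℝ (valM (blendedBDF Δt η (m + 2))) (valM (ξ (m + 3)))
        - inner ℝ (valM (blendedBDF Δt ξ (m + 2))) (valM (ξ (m + 3))) := by
    rw [blendedBDF_sub_sub Δt hdec]
    exact inner_valV_sub_sub _ _ _ _
  have hQ : ∀ r ∈ Qh, inner ℝ r (dvg (ξ (m + 3))) = 0 := fun r hr =>
    (real_inner_comm _ _).trans (hξV.2 r hr)
  rw [hgrad, hval, hQ ph hph] at hdisc
  have hqz : inner ℝ p (dvg (ξ (m + 3))) = inner ℝ (p - q) (dvg (ξ (m + 3))) := by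
    rw [inner_sub_left, hQ q hq, sub_zero]
  rw [hqz] at hexact
  -- The difference quotient of `η` is measured by its gradient through Poincaré's inequality, so no
  -- separate `L²` estimate of the projection is needed.
  have hr1 : inner ℝ (valM (blendedBDF Δt u (m + 2))) (valM (ξ (m + 3)))
      - inner ℝ ut (valV (ξ (m + 3)))
      - inner ℝ (valM (blendedBDF Δt η (m + 2))) (valM (ξ (m + 3)))
      ≤ (‖valM (blendedBDF Δt u (m + 2)) - ut‖ + B * gn (blendedBDF Δt η (m + 2)))
        * (B * gn (ξ (m + 3))) :=
    inner_sub_sub_le (hB.poincare _ (blendedBDF_mem _ _ fun i hi => hη i (by omega)))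
      (hB.poincare _ m5)
  have hr2 : inner ℝ (p - q) (dvg (ξ (m + 3))) ≤ ‖p - q‖ * (‖traceL Ω‖ * gn (ξ (m + 3))) :=
    real_inner_le_of_norm_le le_rfl (norm_dvg_le _)
  have hinv : h * gn (thirdDiff ξ (m + 2)) ≤ Cinv * vn (thirdDiff ξ (m + 2)) := by
    have := hF.inverse _ (thirdDiff_mem Xh (u := ξ) (n := m + 2) fun i hi => hξ i (by omega))
    rwa [gradNsq_eq_gn, nsq_eq_vn, Real.sqrt_sq (gn_nonneg _), Real.sqrt_sq (vn_nonneg _)] at this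
  rw [gradNsq_eq_gn] at hCFL
  have hen := inner_blendedBDF hΔ ξ m
  have hNL' := (abs_le.1 hNL).1
  refine step_absorb hν hΔ hF.h_pos hB0 hCinv (vn_nonneg _) (vn_nonneg _)
    (gn_nonneg _) hinv hCFL (rhs := inner ℝ (valM (blendedBDF Δt ξ (m + 2))) (valM (ξ (m + 3)))
      + ν * gn (ξ (m + 3)) ^ 2) ?_ ?_
  · rw [mul_add, hen]
  · simp only [stepResidual]
    linarith only [hNL', hr1, hr2, hexact, hdisc]

end EnBDF
end

noncomputable section

namespace EnBDF

variable {d : ℕ} {Ω : Set (Pt d)}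

/-! ### Summation over the time steps -/

/-- The explicit form: `1 + κ ≤ exp κ` is all that is used, so `κ` need not be small. -/
theorem discrete_gronwall {S r : ℕ → ℝ} {κ : ℝ} (hκ : 0 ≤ κ) (hS : ∀ m, 0 ≤ S m)
    (hr : ∀ m, 0 ≤ r m) {M : ℕ} (h : ∀ m < M, S (m + 1) ≤ S m + κ * S m + r m) :
    S M ≤ Real.exp (κ * M) * (S 0 + ∑ m ∈ range M, r m) := by
  induction M with
  | zero => simp
  | succ M ih =>
    have ih' := ih fun m hm => h m (hm.trans (Nat.lt_succ_self M))
    have h1 := h M (Nat.lt_succ_self M)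
    have h2 : S (M + 1) ≤ Real.exp κ * S M + r M := by
      have := mul_le_mul_of_nonneg_right (Real.add_one_le_exp κ) (hS M)
      linarith
    have h3 : Real.exp (κ * (M + 1 : ℕ)) = Real.exp κ * Real.exp (κ * M) := by
      rw [← Real.exp_add]
      congr 1
      push_cast
      ring
    have h4 : (1 : ℝ) ≤ Real.exp (κ * (M + 1 : ℕ)) := Real.one_le_exp (by positivity)
    have h5 := mul_le_mul_of_nonneg_right h4 (hr M)
    have h6 := mul_le_mul_of_nonneg_left ih' (Real.exp_pos κ).le
    rw [Finset.sum_range_succ]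
    calc S (M + 1) ≤ Real.exp κ * S M + r M := h2
      _ ≤ Real.exp κ * (Real.exp (κ * M) * (S 0 + ∑ m ∈ range M, r m))
          + Real.exp (κ * (M + 1 : ℕ)) * r M := by linarith
      _ = _ := by rw [h3]; ring

theorem sq_add_le_two (a b : ℝ) : (a + b) ^ 2 ≤ 2 * a ^ 2 + 2 * b ^ 2 := by
  nlinarith [sq_nonneg (a - b)]

theorem nsq_add_le (v w : SobolevV Ω 1) : nsq (v + w) ≤ 2 * nsq v + 2 * nsq w := by
  rw [nsq_eq_vn, nsq_eq_vn, nsq_eq_vn]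
  exact (pow_le_pow_left₀ (vn_nonneg _) (vn_add_le v w) 2).trans (sq_add_le_two _ _)

theorem gradNsq_add_le (v w : SobolevV Ω 1) : gradNsq (v + w) ≤ 2 * gradNsq v + 2 * gradNsq w := by
  rw [gradNsq_eq_gn, gradNsq_eq_gn, gradNsq_eq_gn]
  exact (pow_le_pow_left₀ (gn_nonneg _) (gn_add_le v w) 2).trans (sq_add_le_two _ _)

theorem levelEnergy_eq (ν Δt : ℝ) (e : ℕ → SobolevV Ω 1) (N : ℕ) :
    levelEnergy ν Δt e N = valEnergy e N + ν * Δt * (9 / 16 * gradNsq (e N)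
      + 3 / 8 * gradNsq (e (N - 1)) + 3 / 16 * gradNsq (e (N - 2))) := by
  simp only [levelEnergy, valEnergy]
  ring

theorem valEnergy_nonneg (e : ℕ → SobolevV Ω 1) (N : ℕ) : 0 ≤ valEnergy e N := by
  have := nsq_nonneg (e N)
  have := nsq_nonneg ((3 : ℝ) • e N - e (N - 1))
  have := nsq_nonneg (extrap e N)
  simp only [valEnergy]
  linarith

theorem levelEnergy_nonneg {ν Δt : ℝ} (hν : 0 < ν) (hΔ : 0 < Δt) (e : ℕ → SobolevV Ω 1) (N : ℕ) :
    0 ≤ levelEnergy ν Δt e N := by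
  rw [levelEnergy_eq, gradNsq_eq_gn, gradNsq_eq_gn, gradNsq_eq_gn]
  have h1 := valEnergy_nonneg e N
  have h2 : 0 ≤ ν * Δt * (9 / 16 * gn (e N) ^ 2 + 3 / 8 * gn (e (N - 1)) ^ 2
      + 3 / 16 * gn (e (N - 2)) ^ 2) := by positivity
  linarith

/-- The error measure bounded in the theorem. -/
def totalError (ν Δt : ℝ) (e : ℕ → SobolevV Ω 1) (N : ℕ) : ℝ :=
  levelEnergy ν Δt e N + 1 / 4 * ∑ n ∈ Finset.Ico 2 N, nsq (thirdDiff e n)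
    + ν * ∑ n ∈ Finset.Ico 2 N, Δt * gradNsq (e (n + 1))

theorem levelEnergy_add_le {ν Δt : ℝ} (hν : 0 < ν) (hΔ : 0 < Δt) {e a b : ℕ → SobolevV Ω 1}
    (h : ∀ n, e n = a n + b n) (N : ℕ) :
    levelEnergy ν Δt e N ≤ 2 * levelEnergy ν Δt a N + 2 * levelEnergy ν Δt b N := by
  have h1 : nsq (e N) ≤ 2 * nsq (a N) + 2 * nsq (b N) := by
    rw [h]
    exact nsq_add_le _ _
  have h2 : nsq ((3 : ℝ) • e N - e (N - 1)) ≤ 2 * nsq ((3 : ℝ) • a N - a (N - 1))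
      + 2 * nsq ((3 : ℝ) • b N - b (N - 1)) := by
    rw [show (3 : ℝ) • e N - e (N - 1)
      = ((3 : ℝ) • a N - a (N - 1)) + ((3 : ℝ) • b N - b (N - 1)) by rw [h, h]; module]
    exact nsq_add_le _ _
  have h3 : nsq (extrap e N) ≤ 2 * nsq (extrap a N) + 2 * nsq (extrap b N) := by
    rw [show extrap e N = extrap a N + extrap b N by simp only [extrap, h]; module]
    exact nsq_add_le _ _
  have h4 : ∀ n, gradNsq (e n) ≤ 2 * gradNsq (a n) + 2 * gradNsq (b n) := by
    intro n
    rw [h]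
    exact gradNsq_add_le _ _
  have k1 := h4 N
  have k2 := h4 (N - 1)
  have k3 := h4 (N - 2)
  rw [levelEnergy_eq, levelEnergy_eq, levelEnergy_eq]
  have key : 9 / 16 * gradNsq (e N) + 3 / 8 * gradNsq (e (N - 1)) + 3 / 16 * gradNsq (e (N - 2))
      ≤ 2 * (9 / 16 * gradNsq (a N) + 3 / 8 * gradNsq (a (N - 1)) + 3 / 16 * gradNsq (a (N - 2)))
        + 2 * (9 / 16 * gradNsq (b N) + 3 / 8 * gradNsq (b (N - 1))
          + 3 / 16 * gradNsq (b (N - 2))) := by linarith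
  have := mul_le_mul_of_nonneg_left key (mul_pos hν hΔ).le
  simp only [valEnergy]
  linarith

theorem totalError_add_le {ν Δt : ℝ} (hν : 0 < ν) (hΔ : 0 < Δt) {e a b : ℕ → SobolevV Ω 1}
    (h : ∀ n, e n = a n + b n) (N : ℕ) :
    totalError ν Δt e N ≤ 2 * totalError ν Δt a N + 2 * totalError ν Δt b N := by
  have h0 := levelEnergy_add_le hν hΔ h N
  have h1 : ∑ n ∈ Finset.Ico 2 N, nsq (thirdDiff e n)
      ≤ 2 * ∑ n ∈ Finset.Ico 2 N, nsq (thirdDiff a n)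
        + 2 * ∑ n ∈ Finset.Ico 2 N, nsq (thirdDiff b n) := by
    rw [Finset.mul_sum, Finset.mul_sum, ← Finset.sum_add_distrib]
    refine Finset.sum_le_sum fun n _ => ?_
    rw [show thirdDiff e n = thirdDiff a n + thirdDiff b n by simp only [thirdDiff, h]; module]
    exact nsq_add_le _ _
  have h2 : ∑ n ∈ Finset.Ico 2 N, Δt * gradNsq (e (n + 1))
      ≤ 2 * ∑ n ∈ Finset.Ico 2 N, Δt * gradNsq (a (n + 1))
        + 2 * ∑ n ∈ Finset.Ico 2 N, Δt * gradNsq (b (n + 1)) := by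
    rw [Finset.mul_sum, Finset.mul_sum, ← Finset.sum_add_distrib]
    refine Finset.sum_le_sum fun n _ => ?_
    have := gradNsq_add_le (a (n + 1)) (b (n + 1))
    rw [← h] at this
    have := mul_le_mul_of_nonneg_left this hΔ.le
    linarith
  have h3 := mul_le_mul_of_nonneg_left h2 hν.le
  simp only [totalError]
  linarith

/-- The energy with the gradient terms that are needed for the extrapolated convection. -/
def shiftedEnergy (ν Δt : ℝ) (ξ : ℕ → SobolevV Ω 1) (m : ℕ) : ℝ :=
  valEnergy ξ (m + 2)
    + ν * Δt * (3 * gn (ξ (m + 2)) ^ 2 + 2 * gn (ξ (m + 1)) ^ 2 + gn (ξ m) ^ 2)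

/-- Cauchy–Schwarz would give 19; the factor 27 cancels the `1/27` in the energy step. -/
theorem gn_extrap_sq_le (ξ : ℕ → SobolevV Ω 1) (m : ℕ) :
    gn (extrap ξ (m + 2)) ^ 2
      ≤ 27 * (gn (ξ (m + 2)) ^ 2 + gn (ξ (m + 1)) ^ 2 + gn (ξ m) ^ 2) := by
  have h1 : gn (extrap ξ (m + 2)) ≤ 3 * gn (ξ (m + 2)) + 3 * gn (ξ (m + 1)) + gn (ξ m) :=
    gn_extrap_le ξ (m + 2)
  refine (pow_le_pow_left₀ (gn_nonneg _) h1 2).trans ?_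
  nlinarith [sq_nonneg (gn (ξ (m + 2)) - gn (ξ (m + 1))), sq_nonneg (gn (ξ (m + 2)) - gn (ξ m)),
    sq_nonneg (gn (ξ (m + 1)) - gn (ξ m)), sq_nonneg (gn (ξ m)), sq_nonneg (gn (ξ (m + 1))),
    sq_nonneg (gn (ξ (m + 2)))]

/-- The gradient weights 3, 2, 1 of `shiftedEnergy` drop by one with each step, which pays for one
copy of `‖∇ξ‖²` at each of the three levels of the extrapolation. Of the four copies gained at the
new level, three enter the energy and one is summed up. -/
theorem totalError_le_of_step {ν Δt κ : ℝ} (hν : 0 < ν) (hΔ : 0 < Δt) (hκ : 0 ≤ κ)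
    {ξ : ℕ → SobolevV Ω 1} {ρ : ℕ → ℝ} (hρ : ∀ m, 0 ≤ ρ m) {M : ℕ}
    (hstep : ∀ m < M, valEnergy ξ (m + 3) + 1 / 4 * vn (thirdDiff ξ (m + 2)) ^ 2
        + 4 * ν * Δt * gn (ξ (m + 3)) ^ 2
      ≤ valEnergy ξ (m + 2) + ν * Δt / 27 * gn (extrap ξ (m + 2)) ^ 2
        + κ * Δt * vn (extrap ξ (m + 2)) ^ 2 + ρ m) :
    totalError ν Δt ξ (M + 2) ≤ Real.exp (2 * κ * Δt * M)
      * (6 * levelEnergy ν Δt ξ 2 + ∑ m ∈ range M, ρ m) := by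
  set S : ℕ → ℝ := fun m => shiftedEnergy ν Δt ξ m
    + ∑ i ∈ range m, (1 / 4 * vn (thirdDiff ξ (i + 2)) ^ 2 + ν * Δt * gn (ξ (i + 3)) ^ 2) with hSdef
  have hνΔ : 0 < ν * Δt := mul_pos hν hΔ
  have hsum0 : ∀ m, 0 ≤ ∑ i ∈ range m,
      (1 / 4 * vn (thirdDiff ξ (i + 2)) ^ 2 + ν * Δt * gn (ξ (i + 3)) ^ 2) := fun m =>
    Finset.sum_nonneg fun i _ => by positivity
  have hsh : ∀ m, valEnergy ξ (m + 2) ≤ shiftedEnergy ν Δt ξ m := by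
    intro m
    simp only [shiftedEnergy]
    have : 0 ≤ ν * Δt * (3 * gn (ξ (m + 2)) ^ 2 + 2 * gn (ξ (m + 1)) ^ 2 + gn (ξ m) ^ 2) := by
      positivity
    linarith
  have hvS : ∀ m, valEnergy ξ (m + 2) ≤ S m := fun m => by
    have := hsh m
    have := hsum0 m
    simp only [hSdef]
    linarith
  have hS0 : ∀ m, 0 ≤ S m := fun m => (valEnergy_nonneg ξ (m + 2)).trans (hvS m)
  have hgr := discrete_gronwall (S := S) (r := ρ) (κ := 2 * κ * Δt) (M := M) (by positivity) hS0 hρ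
    (fun m hm => by
      have h1 := hstep m hm
      -- Half the squared extrapolation is itself part of the energy at the old level, so Gronwall's
      -- lemma applies explicitly.
      have h2 : vn (extrap ξ (m + 2)) ^ 2 ≤ 2 * S m := by
        have := hvS m
        have k1 := nsq_nonneg (ξ (m + 2))
        have k2 := nsq_nonneg ((3 : ℝ) • ξ (m + 2) - ξ (m + 2 - 1))
        simp only [valEnergy] at this
        rw [← nsq_eq_vn]
        linarith
      have h3 := mul_le_mul_of_nonneg_left h2 (mul_nonneg hκ hΔ.le)
      have h4 := mul_le_mul_of_nonneg_left (gn_extrap_sq_le ξ m) hνΔ.le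
      simp only [hSdef] at h3 ⊢
      rw [Finset.sum_range_succ]
      simp only [shiftedEnergy, show m + 1 + 2 = m + 3 from rfl, show m + 1 + 1 = m + 2 from rfl]
        at h3 ⊢
      linarith)
  -- The factor 6 covers the worst ratio of gradient weights, `3 / (9/16) = 16/3`, which also occurs
  -- at the other two levels.
  have hS00 : S 0 ≤ 6 * levelEnergy ν Δt ξ 2 := by
    simp only [hSdef, Finset.range_zero, Finset.sum_empty, add_zero, shiftedEnergy]
    rw [levelEnergy_eq, gradNsq_eq_gn, gradNsq_eq_gn, gradNsq_eq_gn]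
    have h1 := valEnergy_nonneg ξ 2
    simp only [zero_add, show 2 - 1 = 1 from rfl, show 2 - 2 = 0 from rfl]
    have h2 : 3 * gn (ξ 2) ^ 2 + 2 * gn (ξ 1) ^ 2 + gn (ξ 0) ^ 2
        ≤ 6 * (9 / 16 * gn (ξ 2) ^ 2 + 3 / 8 * gn (ξ 1) ^ 2 + 3 / 16 * gn (ξ 0) ^ 2) := by
      have := sq_nonneg (gn (ξ 2))
      have := sq_nonneg (gn (ξ 1))
      have := sq_nonneg (gn (ξ 0))
      linarith
    have h3 := mul_le_mul_of_nonneg_left h2 hνΔ.le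
    linarith
  have hSM : totalError ν Δt ξ (M + 2) ≤ S M := by
    simp only [totalError, hSdef]
    rw [Finset.sum_Ico_eq_sum_range, Finset.sum_Ico_eq_sum_range, Finset.sum_add_distrib,
      levelEnergy_eq]
    have e1 : 1 / 4 * ∑ i ∈ range (M + 2 - 2), nsq (thirdDiff ξ (2 + i))
        = ∑ i ∈ range M, 1 / 4 * vn (thirdDiff ξ (i + 2)) ^ 2 := by
      rw [Finset.mul_sum]
      refine Finset.sum_congr rfl fun i _ => ?_
      rw [add_comm, nsq_eq_vn]
    have e2 : ν * ∑ i ∈ range (M + 2 - 2), Δt * gradNsq (ξ (2 + i + 1))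
        = ∑ i ∈ range M, ν * Δt * gn (ξ (i + 3)) ^ 2 := by
      rw [Finset.mul_sum]
      refine Finset.sum_congr rfl fun i _ => ?_
      rw [show 2 + i + 1 = i + 3 by omega, gradNsq_eq_gn]
      ring
    rw [e1, e2]
    simp only [shiftedEnergy, gradNsq_eq_gn, show M + 2 - 1 = M + 1 from rfl,
      show M + 2 - 2 = M from rfl]
    have h2 : 9 / 16 * gn (ξ (M + 2)) ^ 2 + 3 / 8 * gn (ξ (M + 1)) ^ 2 + 3 / 16 * gn (ξ M) ^ 2
        ≤ 3 * gn (ξ (M + 2)) ^ 2 + 2 * gn (ξ (M + 1)) ^ 2 + gn (ξ M) ^ 2 := by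
      have := sq_nonneg (gn (ξ (M + 2)))
      have := sq_nonneg (gn (ξ (M + 1)))
      have := sq_nonneg (gn (ξ M))
      linarith
    have h3 := mul_le_mul_of_nonneg_left h2 hνΔ.le
    linarith
  refine hSM.trans (hgr.trans ?_)
  gcongr

end EnBDF
end

noncomputable section

namespace EnBDF

variable {d : ℕ} {Ω : Set (Pt d)}

/-! ### Approximation errors and the data terms -/

theorem gradNsq_toH1_integral_nonneg {k : ℕ} {T : ℝ} (hT : 0 ≤ T)
    (w : ℝ → SobolevV Ω (k + 1)) : 0 ≤ ∫ t in (0 : ℝ)..T, gradNsq (toH1 (w t)) :=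
  intervalIntegral.integral_nonneg hT fun _ _ => gradNsq_nonneg _

/-- Lower bounds for `dataTerms`. -/
structure DataBound {k s : ℕ} (ν T Δt h : ℝ) (NT : ℕ) (U : TimeJet (SobolevV Ω (k + 1)))
    (p : ℝ → Sobolev Ω (s + 1)) (D : ℝ) : Prop where
  nonneg : 0 ≤ D
  grad_ttt : Δt ^ 6 * (∫ t in (0 : ℝ)..T, gradNsq (toH1 (U.uttt t))) ≤ ν * D
  grad : h ^ (2 * k) * (∑ n ∈ range (NT + 1), Δt * gradNsq (toH1 (U.u (n * Δt)))) ≤ ν * D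
  grad_ttt_mesh : Δt ^ 5 * h * (∫ t in (0 : ℝ)..T, gradNsq (toH1 (U.uttt t))) ≤ D
  pressure : h ^ (2 * s + 2) * (∑ n ∈ range (NT + 1), Δt * ‖p (n * Δt)‖ ^ 2) ≤ ν * D
  ttt : Δt ^ 4 * (∫ t in (0 : ℝ)..T, nsq (U.uttt t)) ≤ ν * D

theorem dataBound_dataTerms {k s : ℕ} {ν T Δt h : ℝ} {NT : ℕ} {U : TimeJet (SobolevV Ω (k + 1))}
    {p : ℝ → Sobolev Ω (s + 1)} (hν : 0 < ν) (hT : 0 ≤ T) (hΔ : 0 < Δt) (hh : 0 < h) :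
    DataBound ν T Δt h NT U p (dataTerms ν T Δt h NT U p) := by
  have i1 := gradNsq_toH1_integral_nonneg hT U.uttt
  have i2 : 0 ≤ ∫ t in (0 : ℝ)..T, gradNsq (U.uttt t) :=
    intervalIntegral.integral_nonneg hT fun _ _ => gradNsq_nonneg _
  have i3 : 0 ≤ ∫ t in (0 : ℝ)..T, ‖U.ut t‖ ^ 2 :=
    intervalIntegral.integral_nonneg hT fun _ _ => by positivity
  have i4 : 0 ≤ ∫ t in (0 : ℝ)..T, nsq (U.uttt t) :=
    intervalIntegral.integral_nonneg hT fun _ _ => nsq_nonneg _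
  have s1 : 0 ≤ ∑ n ∈ range (NT + 1), Δt * ‖U.u (n * Δt)‖ ^ 2 :=
    Finset.sum_nonneg fun _ _ => by positivity
  have s2 : 0 ≤ ∑ n ∈ range (NT + 1), Δt * gradNsq (U.u (n * Δt)) :=
    Finset.sum_nonneg fun _ _ => mul_nonneg hΔ.le (gradNsq_nonneg _)
  have s3 : 0 ≤ ∑ n ∈ range (NT + 1), Δt * ‖p (n * Δt)‖ ^ 2 :=
    Finset.sum_nonneg fun _ _ => by positivity
  have s4 : ∑ n ∈ range (NT + 1), Δt * gradNsq (toH1 (U.u (n * Δt)))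
      ≤ ∑ n ∈ range (NT + 1), Δt * gradNsq (U.u (n * Δt)) :=
    Finset.sum_le_sum fun _ _ => mul_le_mul_of_nonneg_left (gradNsq_toH1_le _) hΔ.le
  have m1 : 0 ≤ ⨆ n : Fin (NT + 1), gradNsq (toH1 (U.u (n * Δt))) :=
    Real.iSup_nonneg fun _ => gradNsq_nonneg _
  simp only [dataTerms]
  have t1 : 0 ≤ h ^ (2 * k) / ν * (⨆ n : Fin (NT + 1), gradNsq (toH1 (U.u (n * Δt))))
      * ∑ n ∈ range (NT + 1), Δt * ‖U.u (n * Δt)‖ ^ 2 :=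
    mul_nonneg (mul_nonneg (by positivity) m1) s1
  have t2 : 0 ≤ Δt ^ 6 / ν * ∫ t in (0 : ℝ)..T, gradNsq (toH1 (U.uttt t)) :=
    mul_nonneg (by positivity) i1
  have t3 : 0 ≤ h ^ (2 * k) / ν * ∑ n ∈ range (NT + 1), Δt * gradNsq (U.u (n * Δt)) :=
    mul_nonneg (by positivity) s2
  have t4 : 0 ≤ Δt ^ 4 * h ^ (2 * k + 1) * ∫ t in (0 : ℝ)..T, gradNsq (U.uttt t) :=
    mul_nonneg (by positivity) i2
  have t5 : 0 ≤ Δt ^ 5 * h * ∫ t in (0 : ℝ)..T, gradNsq (toH1 (U.uttt t)) :=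
    mul_nonneg (by positivity) i1
  have t6 : 0 ≤ h ^ (2 * s + 2) / ν * ∑ n ∈ range (NT + 1), Δt * ‖p (n * Δt)‖ ^ 2 :=
    mul_nonneg (by positivity) s3
  have t7 : 0 ≤ h ^ (2 * k + 2) / ν * ∫ t in (0 : ℝ)..T, ‖U.ut t‖ ^ 2 :=
    mul_nonneg (by positivity) i3
  have t8 : 0 ≤ ν * h ^ (2 * k) * ∑ n ∈ range (NT + 1), Δt * gradNsq (U.u (n * Δt)) :=
    mul_nonneg (by positivity) s2
  have t9 : 0 ≤ Δt ^ 4 / ν * ∫ t in (0 : ℝ)..T, nsq (U.uttt t) :=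
    mul_nonneg (by positivity) i4
  have e : ∀ x y : ℝ, x * y = ν * (x / ν * y) := fun x y => by field_simp
  refine ⟨by linarith, ?_, ?_, by linarith, ?_, ?_⟩
  · rw [e]
    exact mul_le_mul_of_nonneg_left (by linarith) hν.le
  · refine (mul_le_mul_of_nonneg_left s4 (by positivity)).trans ?_
    rw [e]
    exact mul_le_mul_of_nonneg_left (by linarith) hν.le
  · rw [e]
    exact mul_le_mul_of_nonneg_left (by linarith) hν.le
  · rw [e]
    exact mul_le_mul_of_nonneg_left (by linarith) hν.le

/-- The divergence free fields in `X`; if `Z` holds, those with zero gradient. -/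
def divFreeSpace (Ω : Set (Pt d)) (Z : Prop) : Submodule ℝ (SobolevV Ω 1) where
  carrier := {w | w ∈ X Ω ∧ traceL Ω (gradM w) = 0 ∧ (Z → gradM w = 0)}
  zero_mem' := ⟨(X Ω).zero_mem, by rw [map_zero, map_zero], fun _ => map_zero _⟩
  add_mem' := by
    rintro a b ⟨h1, h2, h3⟩ ⟨k1, k2, k3⟩
    exact ⟨(X Ω).add_mem h1 k1, by rw [map_add, map_add, h2, k2, add_zero],
      fun z => by rw [map_add, h3 z, k3 z, add_zero]⟩
  smul_mem' := by
    rintro r a ⟨h1, h2, h3⟩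
    exact ⟨(X Ω).smul_mem r h1, by rw [map_smul, map_smul, h2, smul_zero],
      fun z => by rw [map_smul, h3 z, smul_zero]⟩

/-- The fields in `H^{k+1}` whose image in `H^1` lies in `divFreeSpace`. -/
def solutionSpace (Ω : Set (Pt d)) (k : ℕ) (Z : Prop) : Submodule ℝ (SobolevV Ω (k + 1)) :=
  (divFreeSpace Ω Z).comap (toH1L k)

/-- `w ↦ w - P w` on `H^{k+1}`. -/
def approxError (k : ℕ) (P : SobolevV Ω 1 →ₗ[ℝ] SobolevV Ω 1) :
    SobolevV Ω (k + 1) →ₗ[ℝ] SobolevV Ω 1 :=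
  (LinearMap.id - P) ∘ₗ toH1L k

theorem approxError_apply (k : ℕ) (P : SobolevV Ω 1 →ₗ[ℝ] SobolevV Ω 1)
    (w : SobolevV Ω (k + 1)) : approxError k P w = toH1 w - P (toH1 w) := rfl

/-- If `Z` holds, comparison with the zero field shows that the error has no gradient, and nothing
is asked of `h`. This case must be separated because no bound of `h ^ (2 * k)` by the data is
available when `∇u` vanishes. -/
theorem IsFEPair.gn_approxError_sq_le {k s : ℕ} {Cinv β Capp h : ℝ}
    {Xh : Submodule ℝ (SobolevV Ω 1)} {Qh : Submodule ℝ (L2 Ω)}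
    (hF : IsFEPair Ω k s Cinv β Capp h Xh Qh) (hβ : 0 < β)
    {P : SobolevV Ω 1 →ₗ[ℝ] SobolevV Ω 1}
    (hP : ∀ w, ∀ v ∈ discDivFree Xh Qh, gn (w - P w) ≤ gn (w - v)) {Z : Prop} {K D : ℝ}
    (hK : 0 ≤ K) (hD : 0 ≤ D) (hZ : ¬Z → h ^ (2 * k) ≤ K * D) {w : SobolevV Ω (k + 1)}
    (hw : w ∈ solutionSpace Ω k Z) :
    gn (approxError k P w) ^ 2 ≤ ((1 + ‖traceL Ω‖ / β) * Capp) ^ 2 * K * ‖w‖ ^ 2 * D := by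
  have h1 : toH1 w ∈ X Ω := hw.1
  have h2 : traceL Ω (gradM (toH1 w)) = 0 := hw.2.1
  have h3 : Z → gradM (toH1 w) = 0 := hw.2.2
  rw [approxError_apply]
  by_cases z : Z
  · have h4 := hP (toH1 w) 0 (Submodule.zero_mem _)
    rw [sub_zero] at h4
    have h5 : gn (toH1 w) = 0 := by
      rw [gn, h3 z, norm_zero]
    rw [h5] at h4
    have h6 : gn (toH1 w - P (toH1 w)) = 0 := le_antisymm h4 (gn_nonneg _)
    rw [h6, zero_pow two_ne_zero]
    positivity
  · have hdiv : dvg (toH1 w) = 0 := by rw [dvg_eq, h2]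
    obtain ⟨v, hv, happ⟩ := hF.exists_discDivFree_approx hβ h1 hdiv
    have h4 := (hP (toH1 w) v hv).trans happ
    calc gn (toH1 w - P (toH1 w)) ^ 2
        ≤ ((1 + ‖traceL Ω‖ / β) * (Capp * h ^ k * ‖w‖)) ^ 2 :=
          pow_le_pow_left₀ (gn_nonneg _) h4 2
      _ = ((1 + ‖traceL Ω‖ / β) * Capp) ^ 2 * ‖w‖ ^ 2 * h ^ (2 * k) := by ring
      _ ≤ ((1 + ‖traceL Ω‖ / β) * Capp) ^ 2 * ‖w‖ ^ 2 * (K * D) :=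
          mul_le_mul_of_nonneg_left (hZ z) (by positivity)
      _ = _ := by ring

/-! ### Differences of smooth functions at the time levels -/

section Norms

variable {Y : Type*} [NormedAddCommGroup Y] [NormedSpace ℝ Y] {v : ℕ → Y} {A L Δt : ℝ} {m : ℕ}

theorem norm_extrap_le (h : ∀ n ≤ m + 2, ‖v n‖ ≤ A) : ‖extrap v (m + 2)‖ ≤ 7 * A := by
  have h1 := h (m + 2) le_rfl
  have h2 := h (m + 2 - 1) (by omega)
  have h3 := h (m + 2 - 2) (by omega)
  have : ‖extrap v (m + 2)‖ ≤ 3 * ‖v (m + 2)‖ + 3 * ‖v (m + 2 - 1)‖ + ‖v (m + 2 - 2)‖ := by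
    refine (norm_add_le _ _).trans (add_le_add_left ((norm_sub_le _ _).trans ?_) _)
    simp [norm_smul]
  linarith

theorem norm_thirdDiff_le (h : ∀ n ≤ m + 2, ‖v (n + 1) - v n‖ ≤ L * Δt) :
    ‖thirdDiff v (m + 2)‖ ≤ 4 * (L * Δt) := by
  have h1 := h (m + 2) le_rfl
  have h2 := h (m + 1) (by omega)
  have h3 := h m (by omega)
  have e : thirdDiff v (m + 2) = (v (m + 2 + 1) - v (m + 2)) - (2 : ℝ) • (v (m + 1 + 1) - v (m + 1))
      + (v (m + 1) - v m) := by
    simp only [thirdDiff, show m + 2 - 1 = m + 1 from rfl, show m + 2 - 2 = m from rfl,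
      show m + 1 + 1 = m + 2 from rfl]
    module
  rw [e]
  refine (norm_add_le _ _).trans ?_
  have : ‖(v (m + 2 + 1) - v (m + 2)) - (2 : ℝ) • (v (m + 1 + 1) - v (m + 1))‖
      ≤ ‖v (m + 2 + 1) - v (m + 2)‖ + 2 * ‖v (m + 1 + 1) - v (m + 1)‖ := by
    refine (norm_sub_le _ _).trans (le_of_eq ?_)
    rw [norm_smul, Real.norm_of_nonneg (by norm_num)]
  linarith

/-- The coefficients sum to zero, so the quotient is a combination of first differences with weights
10, -5, 1; the resulting `16/6` is rounded up. -/
theorem norm_blendedBDF_le (hΔ : 0 < Δt) (h : ∀ n ≤ m + 2, ‖v (n + 1) - v n‖ ≤ L * Δt) :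
    ‖blendedBDF Δt v (m + 2)‖ ≤ 3 * L := by
  have h1 := h (m + 2) le_rfl
  have h2 := h (m + 1) (by omega)
  have h3 := h m (by omega)
  have e : blendedBDF Δt v (m + 2) = (6 * Δt)⁻¹ • ((10 : ℝ) • (v (m + 2 + 1) - v (m + 2))
      - (5 : ℝ) • (v (m + 1 + 1) - v (m + 1)) + (v (m + 1) - v m)) := by
    simp only [blendedBDF, show m + 2 - 1 = m + 1 from rfl, show m + 2 - 2 = m from rfl,
      show m + 1 + 1 = m + 2 from rfl]
    module
  rw [e, norm_smul, Real.norm_of_nonneg (by positivity), inv_mul_le_iff₀ (by positivity)]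
  refine (norm_add_le _ _).trans ?_
  have : ‖(10 : ℝ) • (v (m + 2 + 1) - v (m + 2)) - (5 : ℝ) • (v (m + 1 + 1) - v (m + 1))‖
      ≤ 10 * ‖v (m + 2 + 1) - v (m + 2)‖ + 5 * ‖v (m + 1 + 1) - v (m + 1)‖ := by
    refine (norm_sub_le _ _).trans (le_of_eq ?_)
    rw [norm_smul, norm_smul, Real.norm_of_nonneg (by norm_num), Real.norm_of_nonneg (by norm_num)]
  have hL : 0 ≤ L * Δt := (norm_nonneg _).trans h1
  linarith

theorem IsPrimitive.exists_lipschitz {T : ℝ} (hT : 0 ≤ T) {u u' u'' : ℝ → Y}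
    (h : IsPrimitive T u u') (h' : IsPrimitive T u' u'') :
    ∃ L, 0 ≤ L ∧ ∀ a ∈ Set.Icc 0 T, ∀ b ∈ Set.Icc 0 T, ‖u b - u a‖ ≤ L * |b - a| := by
  obtain ⟨L, hL⟩ := isCompact_Icc.exists_bound_of_continuousOn (h'.continuousOn hT)
  refine ⟨L, (norm_nonneg _).trans (hL 0 ⟨le_rfl, hT⟩), fun a ha b hb => ?_⟩
  rw [h.sub_eq ha hb]
  refine intervalIntegral.norm_integral_le_of_norm_le_const fun r hr => hL r ?_
  exact Set.ordConnected_Icc.uIcc_subset ha hb (Set.uIoc_subset_uIcc hr)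

theorem node_mem {T Δt : ℝ} {NT : ℕ} (hΔ : 0 < Δt) (hTe : NT * Δt = T) {n : ℕ} (hn : n ≤ NT) :
    (n : ℝ) * Δt ∈ Set.Icc 0 T := by
  refine ⟨by positivity, ?_⟩
  rw [← hTe]
  gcongr

/-- A quadratic functional of a smooth function: values and differences at the time levels. -/
theorem TimeJet.IsH3.exists_differences_le {U : TimeJet Y} {T : ℝ} (hU : U.IsH3 T) (hT : 0 < T) :
    ∃ K, 0 ≤ K ∧ ∀ {E : Type*} [AddCommGroup E] [Module ℝ E] (S : Submodule ℝ Y)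
      (F : Y →ₗ[ℝ] E) (g : E → ℝ) (Q : ℝ), 0 ≤ Q → (∀ w ∈ S, g (F w) ≤ Q * ‖w‖ ^ 2) →
      ∀ (NT : ℕ) (Δt : ℝ), 0 < Δt → NT * Δt = T → (∀ n : ℕ, n ≤ NT → U.u (n * Δt) ∈ S) →
      (∀ n : ℕ, n ≤ NT → g (F (U.u (n * Δt))) ≤ Q * K) ∧
      ∀ m, m + 3 ≤ NT → g (extrap (fun n : ℕ => F (U.u (n * Δt))) (m + 2)) ≤ Q * K ∧
        g (blendedBDF Δt (fun n : ℕ => F (U.u (n * Δt))) (m + 2)) ≤ Q * K ∧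
        g (thirdDiff (fun n : ℕ => F (U.u (n * Δt))) (m + 2)) ≤ Δt * (Q * K) := by
  obtain ⟨A, hA⟩ := isCompact_Icc.exists_bound_of_continuousOn (hU.prim.continuousOn hT.le)
  obtain ⟨L, hL0, hL⟩ := hU.prim.exists_lipschitz hT.le hU.prim_t
  refine ⟨49 * A ^ 2 + 9 * L ^ 2 + 16 * L ^ 2 * T, by positivity, ?_⟩
  intro E _ _ S F g Q hQ hg NT Δt hΔ hTe hmem
  have hnorm : ∀ n : ℕ, n ≤ NT → ‖U.u (n * Δt)‖ ≤ A := fun n hn => hA _ (node_mem hΔ hTe hn)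
  have hlip : ∀ n : ℕ, n + 1 ≤ NT →
      ‖U.u (((n + 1 : ℕ) : ℝ) * Δt) - U.u (n * Δt)‖ ≤ L * Δt := by
    intro n hn
    refine (hL _ (node_mem hΔ hTe (by omega)) _ (node_mem hΔ hTe hn)).trans_eq ?_
    congr 1
    rw [show ((n + 1 : ℕ) : ℝ) * Δt - n * Δt = Δt by push_cast; ring, abs_of_pos hΔ]
  have hg' : ∀ w ∈ S, ∀ b, ‖w‖ ≤ b → g (F w) ≤ Q * b ^ 2 := fun w hw b hb =>
    (hg w hw).trans (by gcongr)
  have q1 : 0 ≤ Q * A ^ 2 := by positivity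
  have q2 : 0 ≤ Q * L ^ 2 := by positivity
  have q3 : 0 ≤ Q * L ^ 2 * T := by positivity
  refine ⟨fun n hn => (hg' _ (hmem n hn) A (hnorm n hn)).trans (by linarith), fun m hm => ?_⟩
  refine ⟨?_, ?_, ?_⟩
  · rw [← map_extrap F fun n : ℕ => U.u (n * Δt)]
    refine (hg' _ (extrap_mem _ fun i hi => hmem i (by omega)) (7 * A)
      (norm_extrap_le fun n hn => hnorm n (by omega))).trans ?_
    linarith
  · rw [← map_blendedBDF F Δt fun n : ℕ => U.u (n * Δt)]
    refine (hg' _ (blendedBDF_mem _ _ fun i hi => hmem i (by omega)) (3 * L)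
      (norm_blendedBDF_le hΔ fun n hn => hlip n (by omega))).trans ?_
    linarith
  · rw [← map_thirdDiff F fun n : ℕ => U.u (n * Δt)]
    refine (hg' _ (thirdDiff_mem _ fun i hi => hmem i (by omega)) (4 * (L * Δt))
      (norm_thirdDiff_le fun n hn => hlip n (by omega))).trans ?_
    -- The Lipschitz bound gives `Δt²`. One factor is enough for sums without a weight `Δt`, so the
    -- other is replaced by `T`.
    have hΔT : Δt ≤ T := by
      have := (node_mem hΔ hTe (n := 1) (by omega)).2
      simpa using this
    have h1 : Q * (4 * (L * Δt)) ^ 2 = Δt * (16 * (Q * L ^ 2) * Δt) := by ring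
    have h2 : Δt * (16 * (Q * L ^ 2) * Δt) ≤ Δt * (16 * (Q * L ^ 2) * T) := by
      gcongr
    have h3 : 0 ≤ Δt * (Q * A ^ 2) := by positivity
    have h4 : 0 ≤ Δt * (Q * L ^ 2) := by positivity
    rw [h1]
    linarith

end Norms

/-! ### Approximation errors bounded by the data terms -/

/-- The `L²` gradient of a time jet. -/
def gradJet {k : ℕ} (U : TimeJet (SobolevV Ω (k + 1))) : TimeJet (GradSpace Ω) :=
  ⟨fun t => gradM (toH1 (U.u t)), fun t => gradM (toH1 (U.ut t)), fun t => gradM (toH1 (U.utt t)),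
    fun t => gradM (toH1 (U.uttt t))⟩

/-- The `L²` values of a time jet. -/
def valJet {k : ℕ} (U : TimeJet (SobolevV Ω (k + 1))) : TimeJet (L2V Ω) :=
  ⟨fun t => valM (toH1 (U.u t)), fun t => valM (toH1 (U.ut t)), fun t => valM (toH1 (U.utt t)),
    fun t => valM (toH1 (U.uttt t))⟩

theorem TimeJet.IsH3.gradJet {k : ℕ} {T : ℝ} {U : TimeJet (SobolevV Ω (k + 1))} (hU : U.IsH3 T) :
    (EnBDF.gradJet U).IsH3 T :=
  TimeJet.IsH3.map (Y := SobolevV Ω (k + 1)) (Z := GradSpace Ω) hU (gradL k)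

theorem TimeJet.IsH3.valJet {k : ℕ} {T : ℝ} {U : TimeJet (SobolevV Ω (k + 1))} (hU : U.IsH3 T) :
    (EnBDF.valJet U).IsH3 T :=
  TimeJet.IsH3.map (Y := SobolevV Ω (k + 1)) (Z := L2V Ω) hU (valL (k + 1))

/-- The mesh width to the power `2 k` is controlled by the data terms, unless `∇u` vanishes. -/
theorem exists_pow_le_data {k s : ℕ} {ν T : ℝ} (hν : 0 < ν) (hT : 0 < T)
    {U : TimeJet (SobolevV Ω (k + 1))} (hU : U.IsH3 T) :
    ∃ K, 0 ≤ K ∧ ∀ (h Δt : ℝ) (NT : ℕ) (p : ℝ → Sobolev Ω (s + 1)) (D : ℝ), 0 < h →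
      h ≤ Metric.diam Ω → 3 ≤ NT → 0 < Δt → NT * Δt = T → DataBound ν T Δt h NT U p D →
      (¬∀ t ∈ Set.Icc 0 T, gradM (toH1 (U.u t)) = 0) → h ^ (2 * k) ≤ K * D := by
  by_cases hne : ∀ t ∈ Set.Icc 0 T, gradM (toH1 (U.u t)) = 0
  · exact ⟨0, le_rfl, fun _ _ _ _ _ _ _ _ _ _ _ h' => absurd hne h'⟩
  have hne' : ∃ t ∈ Set.Icc 0 T, (gradJet U).u t ≠ 0 := by
    by_contra hcon
    push Not at hcon
    exact hne hcon
  obtain ⟨c, hc, hle⟩ := hU.gradJet.exists_le_jetSize hT hne'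
  -- The discrete norm of `∇u` carries `h ^ (2 * k)` in the data terms already. The integral of the
  -- third derivative does not, and there `h` is bounded by the diameter.
  refine ⟨(1 + Metric.diam Ω ^ (2 * k)) * ν / c, ?_, ?_⟩
  · have : 0 ≤ Metric.diam Ω := Metric.diam_nonneg
    positivity
  intro h Δt NT p D hh hdiam hNT hΔ hTe hD _
  have h1 := hle NT Δt hNT hΔ hTe
  have e1 : ∑ n ∈ range (NT + 1), Δt * ‖(gradJet U).u (n * Δt)‖ ^ 2
      = ∑ n ∈ range (NT + 1), Δt * gradNsq (toH1 (U.u (n * Δt))) := by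
    refine Finset.sum_congr rfl fun n _ => ?_
    rw [gradNsq_eq]
    rfl
  have e2 : ∫ t in (0 : ℝ)..T, ‖(gradJet U).uttt t‖ ^ 2
      = ∫ t in (0 : ℝ)..T, gradNsq (toH1 (U.uttt t)) := by
    congr 1
    funext t
    rw [gradNsq_eq]
    rfl
  rw [jetSize, e1, e2] at h1
  have h2 := hD.grad
  have h3 := hD.grad_ttt
  have hp : h ^ (2 * k) ≤ Metric.diam Ω ^ (2 * k) := pow_le_pow_left₀ hh.le hdiam _
  have hνD : 0 ≤ ν * D := mul_nonneg hν.le hD.nonneg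
  have i1 := gradNsq_toH1_integral_nonneg hT.le U.uttt
  have h4 : h ^ (2 * k) * (Δt ^ 6 * ∫ t in (0 : ℝ)..T, gradNsq (toH1 (U.uttt t)))
      ≤ Metric.diam Ω ^ (2 * k) * (ν * D) :=
    mul_le_mul hp h3 (by positivity) (by positivity)
  have h5 := mul_le_mul_of_nonneg_left h1 (by positivity : 0 ≤ h ^ (2 * k))
  rw [div_mul_eq_mul_div, le_div_iff₀ hc]
  linarith

/-- Bounds of the approximation error `η` by the data terms. -/
structure ApproxBound (η : ℕ → SobolevV Ω 1) (Δt : ℝ) (NT : ℕ) (D : ℝ) : Prop where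
  level : ∀ n ≤ NT, gn (η n) ^ 2 ≤ D
  extrap : ∀ m, m + 3 ≤ NT → gn (EnBDF.extrap η (m + 2)) ^ 2 ≤ D
  bdf : ∀ m, m + 3 ≤ NT → gn (blendedBDF Δt η (m + 2)) ^ 2 ≤ D
  third : ∀ m, m + 3 ≤ NT → gn (thirdDiff η (m + 2)) ^ 2 ≤ Δt * D

-- By linearity, extrapolations and differences of `η` are approximation errors of the same
-- combinations of `u`, which lie in `solutionSpace` again. Their `H^{k+1}` norms depend on the
-- fixed solution only, and `exists_pow_le_data` converts `h ^ (2 * k)` into the data terms.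
set_option maxHeartbeats 1000000 in
theorem exists_approxBound {k s : ℕ} {β Capp ν T : ℝ} (hβ : 0 < β) (hν : 0 < ν) (hT : 0 < T)
    {U : TimeJet (SobolevV Ω (k + 1))} {p : ℝ → Sobolev Ω (s + 1)} {f : ℝ → L2V Ω}
    (hsol : IsNSESolution Ω k s ν T U p f) :
    ∃ K, 0 ≤ K ∧ ∀ (Cinv h : ℝ) (Xh : Submodule ℝ (SobolevV Ω 1)) (Qh : Submodule ℝ (L2 Ω))
      (_ : IsFEPair Ω k s Cinv β Capp h Xh Qh) (Δt : ℝ) (NT : ℕ) (_ : 0 < Δt) (_ : NT * Δt = T)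
      (_ : 3 ≤ NT) (P : SobolevV Ω 1 →ₗ[ℝ] SobolevV Ω 1)
      (_ : ∀ w, ∀ v ∈ discDivFree Xh Qh, gn (w - P w) ≤ gn (w - v)) (D : ℝ)
      (_ : DataBound ν T Δt h NT U p D),
      ApproxBound (fun n : ℕ => approxError k P (U.u (n * Δt))) Δt NT (K * D) := by
  obtain ⟨K, hK, hpow⟩ := exists_pow_le_data (s := s) hν hT hsol.regular_u
  obtain ⟨K', hK', hdiff⟩ := hsol.regular_u.exists_differences_le hT
  refine ⟨((1 + ‖traceL Ω‖ / β) * Capp) ^ 2 * K * K', by positivity, ?_⟩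
  intro Cinv h Xh Qh hF Δt NT hΔ hTe hNT P hP D hD
  have hD0 := hD.nonneg
  have hmem : ∀ n : ℕ, n ≤ NT → U.u (n * Δt)
      ∈ solutionSpace Ω k (∀ t ∈ Set.Icc 0 T, gradM (toH1 (U.u t)) = 0) := by
    intro n hn
    have ht := node_mem hΔ hTe hn
    have h1 := hsol.divFree _ ht
    rw [dvg_eq] at h1
    exact ⟨hsol.boundary _ ht, h1, fun z => z _ ht⟩
  have hmain : ∀ w ∈ solutionSpace Ω k (∀ t ∈ Set.Icc 0 T, gradM (toH1 (U.u t)) = 0),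
      gn (approxError k P w) ^ 2
        ≤ ((1 + ‖traceL Ω‖ / β) * Capp) ^ 2 * K * D * ‖w‖ ^ 2 := fun w hw =>
    (hF.gn_approxError_sq_le hβ hP hK hD0
      (hpow h Δt NT p D hF.h_pos hF.h_le hNT hΔ hTe hD) hw).trans_eq (by ring)
  have key := hdiff _ (approxError k P) (fun w => gn w ^ 2) _ (by positivity) hmain NT Δt hΔ hTe hmem
  have e : ((1 + ‖traceL Ω‖ / β) * Capp) ^ 2 * K * K' * D
      = ((1 + ‖traceL Ω‖ / β) * Capp) ^ 2 * K * D * K' := by ring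
  rw [e]
  exact ⟨key.1, fun m hm => (key.2 m hm).1, fun m hm => (key.2 m hm).2.1,
    fun m hm => (key.2 m hm).2.2⟩

end EnBDF
end

noncomputable section

namespace EnBDF

variable {d : ℕ} {Ω : Set (Pt d)}

/-! ### Summation of the consistency errors -/

/-- The exact solution at the time levels. -/
def nodal {k : ℕ} (U : TimeJet (SobolevV Ω (k + 1))) (Δt : ℝ) (n : ℕ) : SobolevV Ω 1 :=
  toH1 (U.u (n * Δt))

theorem sq_sum_six_le (a b c e f g : ℝ) : (a + b + c + e + f + g) ^ 2
    ≤ 6 * (a ^ 2 + b ^ 2 + c ^ 2 + e ^ 2 + f ^ 2 + g ^ 2) := by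
  have h := sq_sum_le_card_mul_sum_sq (s := Finset.univ) (f := ![a, b, c, e, f, g])
  simp only [Fin.sum_univ_six, Finset.card_univ, Fintype.card_fin] at h
  simpa using h

theorem stepResidual_sq_le (B M Δt : ℝ) (u η : ℕ → SobolevV Ω 1) (ut : L2V Ω) (r : L2 Ω) (n : ℕ) :
    stepResidual B M Δt u η ut r n ^ 2
      ≤ 6 * (B ^ 2 * ‖valM (blendedBDF Δt u n) - ut‖ ^ 2 + B ^ 4 * gn (blendedBDF Δt η n) ^ 2
        + ‖traceL Ω‖ ^ 2 * ‖r‖ ^ 2 + B ^ 2 * M ^ 2 * gn (thirdDiff u n) ^ 2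
        + 4 * B ^ 2 * M ^ 2 * gn (extrap η n) ^ 2 + 49 * B ^ 2 * M ^ 2 * gn (η (n + 1)) ^ 2) := by
  have h := sq_sum_six_le (B * ‖valM (blendedBDF Δt u n) - ut‖) (B ^ 2 * gn (blendedBDF Δt η n))
    (‖traceL Ω‖ * ‖r‖) (B * M * gn (thirdDiff u n)) (2 * B * M * gn (extrap η n))
    (7 * B * M * gn (η (n + 1)))
  simp only [stepResidual]
  refine le_trans (le_of_eq ?_) (h.trans (le_of_eq ?_)) <;> ring

variable {k s : ℕ} {ν T Δt h : ℝ} {NT : ℕ} {U : TimeJet (SobolevV Ω (k + 1))}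
  {p : ℝ → Sobolev Ω (s + 1)} {D : ℝ}

theorem sum_const_le {g : ℕ → ℝ} {c : ℝ} (hc : 0 ≤ c) (hΔ : 0 < Δt) (hTe : NT * Δt = T) {M : ℕ}
    (hM : M + 2 ≤ NT) (hg : ∀ m < M, g m ≤ c) : Δt * ∑ m ∈ range M, g m ≤ T * c := by
  have h1 : ∑ m ∈ range M, g m ≤ M * c := by
    refine (Finset.sum_le_sum fun m hm => hg m (Finset.mem_range.1 hm)).trans_eq ?_
    simp
  have h2 : (M : ℝ) ≤ NT := by exact_mod_cast (by omega : M ≤ NT)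
  calc Δt * ∑ m ∈ range M, g m ≤ Δt * (NT * c) := by gcongr; exact h1.trans (by gcongr)
    _ = T * c := by rw [← hTe]; ring

/-- The estimate of one window applied to the gradient of `u`; windows overlap at most three times,
so `5184 = 3·1728`. -/
theorem sum_gn_thirdDiff_le (hU : U.IsH3 T) (hΔ : 0 < Δt) (hTe : NT * Δt = T) {M : ℕ}
    (hM : M + 2 ≤ NT) :
    ∑ m ∈ range M, gn (thirdDiff (nodal U Δt) (m + 2)) ^ 2
      ≤ 5184 * Δt ^ 5 * ∫ t in (0 : ℝ)..T, gradNsq (toH1 (U.uttt t)) := by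
  have hG := hU.gradJet
  have hMT : ((M + 2 : ℕ) : ℝ) * Δt ≤ T := (node_mem hΔ hTe hM).2
  have h1 := sum_window_le (fun t => by positivity) hG.integrableOn_sq hΔ hMT
  have h2 : ∀ m ∈ range M, gn (thirdDiff (nodal U Δt) (m + 2)) ^ 2
      ≤ 1728 * Δt ^ 5 * ∫ r in ((m : ℝ) * Δt)..(((m + 3 : ℕ) : ℝ) * Δt),
        ‖(gradJet U).uttt r‖ ^ 2 := by
    intro m hm
    have hm' := Finset.mem_range.1 hm
    rw [gn, map_thirdDiff gradM (nodal U Δt)]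
    exact hG.thirdDiff_sq_le hΔ (node_mem hΔ hTe (by omega)).2
  have e2 : ∫ t in (0 : ℝ)..T, ‖(gradJet U).uttt t‖ ^ 2
      = ∫ t in (0 : ℝ)..T, gradNsq (toH1 (U.uttt t)) := by
    congr 1
    funext t
    rw [gradNsq_eq]
    rfl
  rw [e2] at h1
  refine (Finset.sum_le_sum h2).trans ?_
  rw [← Finset.mul_sum]
  refine (mul_le_mul_of_nonneg_left h1 (by positivity)).trans_eq (by ring)

theorem sum_blendedBDF_sub_le (hU : U.IsH3 T) (hΔ : 0 < Δt) (hTe : NT * Δt = T) {M : ℕ}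
    (hM : M + 2 ≤ NT) :
    ∑ m ∈ range M, ‖valM (blendedBDF Δt (nodal U Δt) (m + 2))
        - valV (U.ut (((m + 3 : ℕ) : ℝ) * Δt))‖ ^ 2
      ≤ 7569 * Δt ^ 3 * ∫ t in (0 : ℝ)..T, nsq (U.uttt t) := by
  have hG := hU.valJet
  have hMT : ((M + 2 : ℕ) : ℝ) * Δt ≤ T := (node_mem hΔ hTe hM).2
  have h1 := sum_window_le (fun t => by positivity) hG.integrableOn_sq hΔ hMT
  have h2 : ∀ m ∈ range M, ‖valM (blendedBDF Δt (nodal U Δt) (m + 2))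
        - valV (U.ut (((m + 3 : ℕ) : ℝ) * Δt))‖ ^ 2
      ≤ 2523 * Δt ^ 3 * ∫ r in ((m : ℝ) * Δt)..(((m + 3 : ℕ) : ℝ) * Δt),
        ‖(valJet U).uttt r‖ ^ 2 := by
    intro m hm
    have hm' := Finset.mem_range.1 hm
    rw [map_blendedBDF valM Δt (nodal U Δt)]
    exact hG.blendedBDF_sub_sq_le hΔ (node_mem hΔ hTe (by omega)).2
  have e2 : ∫ t in (0 : ℝ)..T, ‖(valJet U).uttt t‖ ^ 2
      = ∫ t in (0 : ℝ)..T, nsq (U.uttt t) := rfl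
  rw [e2] at h1
  refine (Finset.sum_le_sum h2).trans ?_
  rw [← Finset.mul_sum]
  refine (mul_le_mul_of_nonneg_left h1 (by positivity)).trans_eq (by ring)

theorem DataBound.sum_pressure_le (hD : DataBound ν T Δt h NT U p D) (hh : 0 < h) (hΔ : 0 < Δt)
    {Capp : ℝ} {M : ℕ} (hM : M + 2 ≤ NT) {r : ℕ → ℝ} (hr0 : ∀ m, 0 ≤ r m)
    (hr : ∀ m < M, r m ≤ Capp * h ^ (s + 1) * ‖p (((m + 3 : ℕ) : ℝ) * Δt)‖) :
    Δt * ∑ m ∈ range M, r m ^ 2 ≤ Capp ^ 2 * (ν * D) := by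
  have h1 : ∀ m ∈ range M, Δt * r m ^ 2 ≤ Capp ^ 2 * h ^ (2 * s + 2)
      * (Δt * ‖p (((m + 3 : ℕ) : ℝ) * Δt)‖ ^ 2) := by
    intro m hm
    have h2 := pow_le_pow_left₀ (hr0 m) (hr m (Finset.mem_range.1 hm)) 2
    refine (mul_le_mul_of_nonneg_left h2 hΔ.le).trans_eq ?_
    ring
  have h3 : ∑ m ∈ range M, Δt * ‖p (((m + 3 : ℕ) : ℝ) * Δt)‖ ^ 2
      ≤ ∑ n ∈ range (NT + 1), Δt * ‖p (n * Δt)‖ ^ 2 := by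
    rw [← Finset.sum_image (f := fun n : ℕ => Δt * ‖p (n * Δt)‖ ^ 2) (g := fun m => m + 3)
      (s := range M) (by intro a _ b _ hab; simpa using hab)]
    refine Finset.sum_le_sum_of_subset_of_nonneg ?_ fun _ _ _ => by positivity
    intro n hn
    obtain ⟨m, hm, rfl⟩ := Finset.mem_image.1 hn
    have := Finset.mem_range.1 hm
    exact Finset.mem_range.2 (by omega)
  rw [Finset.mul_sum]
  refine (Finset.sum_le_sum h1).trans ?_
  rw [← Finset.mul_sum]
  calc _ ≤ Capp ^ 2 * h ^ (2 * s + 2) * ∑ n ∈ range (NT + 1), Δt * ‖p (n * Δt)‖ ^ 2 := by gcongr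
    _ = Capp ^ 2 * (h ^ (2 * s + 2) * ∑ n ∈ range (NT + 1), Δt * ‖p (n * Δt)‖ ^ 2) := by ring
    _ ≤ _ := mul_le_mul_of_nonneg_left hD.pressure (by positivity)

/-- The sum of the right-hand sides of the energy steps. -/
theorem sum_residual_le (hU : U.IsH3 T) (hν : 0 < ν) (hΔ : 0 < Δt) (hTe : NT * Δt = T)
    (hh : 0 < h) (hhd : h ≤ Metric.diam Ω) (hD : DataBound ν T Δt h NT U p D)
    {η : ℕ → SobolevV Ω 1} {D' : ℝ} (hD' : 0 ≤ D') (hη : ApproxBound η Δt NT D') {B M c Capp : ℝ}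
    (hc : 0 ≤ c) {M₀ : ℕ} (hM₀ : M₀ + 2 ≤ NT) {r : ℕ → L2 Ω}
    (hr : ∀ m < M₀, ‖r m‖ ≤ Capp * h ^ (s + 1) * ‖p (((m + 3 : ℕ) : ℝ) * Δt)‖) :
    ∑ m ∈ range M₀, (27 / ν * Δt * stepResidual B M Δt (nodal U Δt) η
          (valV (U.ut (((m + 3 : ℕ) : ℝ) * Δt))) (r m) (m + 2) ^ 2
        + c * h * (gn (thirdDiff (nodal U Δt) (m + 2)) + gn (thirdDiff η (m + 2))) ^ 2)
      ≤ 162 / ν * (B ^ 2 * (7569 * (ν * D)) + B ^ 4 * (T * D') + ‖traceL Ω‖ ^ 2 * (Capp ^ 2 * (ν * D))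
          + B ^ 2 * M ^ 2 * (5184 * (ν * D)) + 53 * B ^ 2 * M ^ 2 * (T * D'))
        + 2 * c * (5184 * D + Metric.diam Ω * (T * D')) := by
  have a1 := sum_blendedBDF_sub_le hU hΔ hTe hM₀
  have a2 := sum_gn_thirdDiff_le hU hΔ hTe hM₀
  have a3 := hD.sum_pressure_le hh hΔ hM₀ (fun m => norm_nonneg (r m)) hr
  have a4 := sum_const_le (g := fun m => gn (blendedBDF Δt η (m + 2)) ^ 2) hD' hΔ hTe hM₀
    fun m hm => hη.bdf m (by omega)
  have a5 := sum_const_le (g := fun m => gn (extrap η (m + 2)) ^ 2) hD' hΔ hTe hM₀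
    fun m hm => hη.extrap m (by omega)
  have a6 := sum_const_le (g := fun m => gn (η (m + 2 + 1)) ^ 2) hD' hΔ hTe hM₀
    fun m hm => hη.level _ (by omega)
  -- This sum carries no weight `Δt`; the weight is supplied by the extra `Δt` in
  -- `ApproxBound.third`.
  have a7 : ∑ m ∈ range M₀, gn (thirdDiff η (m + 2)) ^ 2 ≤ T * D' := by
    have := sum_const_le (g := fun m => Δt⁻¹ * gn (thirdDiff η (m + 2)) ^ 2) hD' hΔ hTe hM₀
      fun m hm => by
        rw [inv_mul_le_iff₀ hΔ]
        exact hη.third m (by omega)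
    rwa [← Finset.mul_sum, mul_inv_cancel_left₀ hΔ.ne'] at this
  have b1 : Δt * ∑ m ∈ range M₀, ‖valM (blendedBDF Δt (nodal U Δt) (m + 2))
      - valV (U.ut (((m + 3 : ℕ) : ℝ) * Δt))‖ ^ 2 ≤ 7569 * (ν * D) := by
    have := mul_le_mul_of_nonneg_left a1 hΔ.le
    have := hD.ttt
    linarith
  have b2 : Δt * ∑ m ∈ range M₀, gn (thirdDiff (nodal U Δt) (m + 2)) ^ 2 ≤ 5184 * (ν * D) := by
    have := mul_le_mul_of_nonneg_left a2 hΔ.le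
    have := hD.grad_ttt
    linarith
  have b3 : h * ∑ m ∈ range M₀, gn (thirdDiff (nodal U Δt) (m + 2)) ^ 2 ≤ 5184 * D := by
    have := mul_le_mul_of_nonneg_left a2 hh.le
    have := hD.grad_ttt_mesh
    linarith
  have b4 : h * ∑ m ∈ range M₀, gn (thirdDiff η (m + 2)) ^ 2 ≤ Metric.diam Ω * (T * D') :=
    mul_le_mul hhd a7 (Finset.sum_nonneg fun _ _ => by positivity) Metric.diam_nonneg
  have hstep : ∀ m ∈ range M₀, 27 / ν * Δt * stepResidual B M Δt (nodal U Δt) η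
          (valV (U.ut (((m + 3 : ℕ) : ℝ) * Δt))) (r m) (m + 2) ^ 2
        + c * h * (gn (thirdDiff (nodal U Δt) (m + 2)) + gn (thirdDiff η (m + 2))) ^ 2
      ≤ 27 / ν * Δt * (6 * (B ^ 2 * ‖valM (blendedBDF Δt (nodal U Δt) (m + 2))
            - valV (U.ut (((m + 3 : ℕ) : ℝ) * Δt))‖ ^ 2
          + B ^ 4 * gn (blendedBDF Δt η (m + 2)) ^ 2 + ‖traceL Ω‖ ^ 2 * ‖r m‖ ^ 2
          + B ^ 2 * M ^ 2 * gn (thirdDiff (nodal U Δt) (m + 2)) ^ 2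
          + 4 * B ^ 2 * M ^ 2 * gn (extrap η (m + 2)) ^ 2
          + 49 * B ^ 2 * M ^ 2 * gn (η (m + 2 + 1)) ^ 2))
        + c * h * (2 * gn (thirdDiff (nodal U Δt) (m + 2)) ^ 2
          + 2 * gn (thirdDiff η (m + 2)) ^ 2) := by
    intro m _
    refine add_le_add (mul_le_mul_of_nonneg_left (stepResidual_sq_le _ _ _ _ _ _ _ _) ?_)
      (mul_le_mul_of_nonneg_left (sq_add_le_two _ _) (by positivity))
    positivity
  refine (Finset.sum_le_sum hstep).trans ?_
  simp only [Finset.sum_add_distrib, ← Finset.mul_sum]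
  have c1 := mul_le_mul_of_nonneg_left b1 (sq_nonneg B)
  have c2 := mul_le_mul_of_nonneg_left a4 (by positivity : 0 ≤ B ^ 4)
  have c3 := mul_le_mul_of_nonneg_left a3 (sq_nonneg ‖traceL Ω‖)
  have c4 := mul_le_mul_of_nonneg_left b2 (by positivity : 0 ≤ B ^ 2 * M ^ 2)
  have c5 := mul_le_mul_of_nonneg_left a5 (by positivity : 0 ≤ 4 * B ^ 2 * M ^ 2)
  have c6 := mul_le_mul_of_nonneg_left a6 (by positivity : 0 ≤ 49 * B ^ 2 * M ^ 2)
  have c7 := mul_le_mul_of_nonneg_left (add_le_add b3 b4) (by positivity : 0 ≤ 2 * c)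
  have c8 := mul_le_mul_of_nonneg_left
    (add_le_add (add_le_add (add_le_add (add_le_add (add_le_add c1 c2) c3) c4) c5) c6)
    (by positivity : 0 ≤ 162 / ν)
  refine le_trans (le_of_eq ?_) ((add_le_add c8 c7).trans (le_of_eq ?_)) <;> ring

/-! ### The approximation error -/

theorem FormBound.nsq_le {B : ℝ} (hB : FormBound Ω B) {v : SobolevV Ω 1} (hv : v ∈ X Ω) :
    nsq v ≤ B ^ 2 * gn v ^ 2 := by
  rw [nsq_eq_vn, ← mul_pow]
  exact pow_le_pow_left₀ (vn_nonneg _) (hB.poincare v hv) 2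

/-- Poincaré reduces every term to gradients: `51 = ½(1 + 20 + 81)` collects the three squares, and
`9/8` is the sum of the gradient weights. -/
theorem ApproxBound.levelEnergy_le {η : ℕ → SobolevV Ω 1} {D' : ℝ} (hη : ApproxBound η Δt NT D')
    {B : ℝ} (hB : FormBound Ω B) (hX : ∀ n ≤ NT, η n ∈ X Ω) (hν : 0 < ν) (hΔ : 0 < Δt)
    (hΔT : Δt ≤ T) {N : ℕ} (hN2 : 2 ≤ N) (hN : N ≤ NT) :
    levelEnergy ν Δt η N ≤ (51 * B ^ 2 + 9 / 8 * (ν * T)) * D' := by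
  obtain ⟨m, rfl⟩ := Nat.exists_eq_add_of_le' hN2
  rw [levelEnergy_eq]
  simp only [valEnergy, gradNsq_eq_gn, show m + 2 - 1 = m + 1 from rfl, show m + 2 - 2 = m from rfl]
  have g0 := hη.level m (by omega)
  have g1 := hη.level (m + 1) (by omega)
  have g2 := hη.level (m + 2) (by omega)
  have x0 := hX m (by omega)
  have x1 := hX (m + 1) (by omega)
  have x2 := hX (m + 2) (by omega)
  have hB2 := sq_nonneg B
  have v1 := (hB.nsq_le x2).trans (mul_le_mul_of_nonneg_left g2 hB2)
  have v2 : nsq ((3 : ℝ) • η (m + 2) - η (m + 1)) ≤ B ^ 2 * (20 * D') := by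
    refine (hB.nsq_le ((X Ω).sub_mem ((X Ω).smul_mem _ x2) x1)).trans
      (mul_le_mul_of_nonneg_left ?_ hB2)
    have h1 := gn_sub_le ((3 : ℝ) • η (m + 2)) (η (m + 1))
    rw [gn_smul, abs_of_pos (by norm_num : (0 : ℝ) < 3)] at h1
    have h2 := (pow_le_pow_left₀ (gn_nonneg _) h1 2).trans (sq_add_le_two _ _)
    linarith
  have v3 : nsq (EnBDF.extrap η (m + 2)) ≤ B ^ 2 * (81 * D') := by
    refine (hB.nsq_le (extrap_mem _ fun i hi => hX i (by omega))).trans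
      (mul_le_mul_of_nonneg_left ?_ hB2)
    have := gn_extrap_sq_le η m
    linarith
  have v4 : ν * Δt * (9 / 16 * gn (η (m + 2)) ^ 2 + 3 / 8 * gn (η (m + 1)) ^ 2
      + 3 / 16 * gn (η m) ^ 2) ≤ ν * T * (9 / 8 * D') := by
    have hT : 0 < T := hΔ.trans_le hΔT
    exact mul_le_mul (mul_le_mul_of_nonneg_left hΔT hν.le) (by linarith) (by positivity)
      (by positivity)
  linarith

theorem ApproxBound.totalError_le {η : ℕ → SobolevV Ω 1} {D' : ℝ} (hη : ApproxBound η Δt NT D')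
    {B : ℝ} (hB : FormBound Ω B) (hX : ∀ n ≤ NT, η n ∈ X Ω) (hν : 0 < ν) (hΔ : 0 < Δt)
    (hTe : NT * Δt = T) (hD' : 0 ≤ D') {N : ℕ} (hN2 : 2 ≤ N) (hN : N ≤ NT) :
    totalError ν Δt η N ≤ (51 * B ^ 2 + 9 / 8 * (ν * T) + 1 / 4 * B ^ 2 * T + ν * T) * D' := by
  have hΔT : Δt ≤ T := by
    have := (node_mem hΔ hTe (n := 1) (by omega)).2
    simpa using this
  have h0 := hη.levelEnergy_le hB hX hν hΔ hΔT hN2 hN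
  obtain ⟨m, rfl⟩ := Nat.exists_eq_add_of_le' hN2
  simp only [totalError]
  rw [Finset.sum_Ico_eq_sum_range, Finset.sum_Ico_eq_sum_range]
  simp only [show m + 2 - 2 = m from rfl]
  have h1 : ∑ i ∈ range m, nsq (thirdDiff η (2 + i)) ≤ T * (B ^ 2 * D') := by
    have := sum_const_le (g := fun i => Δt⁻¹ * nsq (thirdDiff η (2 + i))) (c := B ^ 2 * D')
      (by positivity) hΔ hTe hN fun i hi => by
        rw [inv_mul_le_iff₀ hΔ, add_comm 2 i]
        refine (hB.nsq_le (thirdDiff_mem _ fun l hl => hX l (by omega))).trans ?_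
        refine (mul_le_mul_of_nonneg_left (hη.third i (by omega)) (sq_nonneg B)).trans_eq (by ring)
    rwa [← Finset.mul_sum, mul_inv_cancel_left₀ hΔ.ne'] at this
  have h2 : ∑ i ∈ range m, Δt * gradNsq (η (2 + i + 1)) ≤ T * D' := by
    rw [← Finset.mul_sum]
    refine sum_const_le hD' hΔ hTe hN fun i hi => ?_
    rw [gradNsq_eq_gn]
    exact hη.level _ (by omega)
  have h3 := mul_le_mul_of_nonneg_left h2 hν.le
  linarith

theorem nsq_neg (v : SobolevV Ω 1) : nsq (-v) = nsq v := by
  rw [nsq_eq_vn, vn, map_neg, norm_neg, nsq_eq_vn, vn]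

theorem gradNsq_neg (v : SobolevV Ω 1) : gradNsq (-v) = gradNsq v := by
  rw [gradNsq_eq_gn, gn, map_neg, norm_neg, gradNsq_eq_gn, gn]

theorem levelEnergy_neg (ν Δt : ℝ) (a : ℕ → SobolevV Ω 1) (N : ℕ) :
    levelEnergy ν Δt (fun n => -a n) N = levelEnergy ν Δt a N := by
  have h1 : (3 : ℝ) • -a N - -a (N - 1) = -((3 : ℝ) • a N - a (N - 1)) := by module
  have h2 : extrap (fun n => -a n) N = -extrap a N := by
    simp only [extrap]
    module
  simp only [levelEnergy, h1, h2, nsq_neg, gradNsq_neg]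

end EnBDF
end

noncomputable section

namespace EnBDF

variable {d : ℕ} {Ω : Set (Pt d)}

/-! ### The error estimate for one member of the ensemble -/

-- Mean and fluctuation appear as arbitrary sequences `A` and `w` whose sum is the extrapolation of
-- `v`. The other members of the ensemble matter only through them, so each member can be estimated
-- on its own.
set_option maxHeartbeats 1000000 in
theorem exists_totalError_le {k s : ℕ} {Cinv β Capp ν T B C : ℝ} (hΩo : IsOpen Ω)
    (hΩb : Bornology.IsBounded Ω) (hC : TriBound Ω C) (hB : FormBound Ω B) (hCinv : 0 < Cinv)
    (hβ : 0 < β) (hν : 0 < ν) (hT : 0 < T) {U : TimeJet (SobolevV Ω (k + 1))}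
    {p : ℝ → Sobolev Ω (s + 1)} {f : ℝ → L2V Ω} (hsol : IsNSESolution Ω k s ν T U p f) :
    ∃ K₁ K₂, 0 ≤ K₁ ∧ 0 ≤ K₂ ∧ ∀ (h : ℝ) (Xh : Submodule ℝ (SobolevV Ω 1))
      (Qh : Submodule ℝ (L2 Ω)) (_ : IsFEPair Ω k s Cinv β Capp h Xh Qh) (Δt : ℝ) (NT : ℕ)
      (_ : 0 < Δt) (_ : NT * Δt = T) (v A w : ℕ → SobolevV Ω 1) (ph : ℕ → L2 Ω)
      (_ : ∀ n ≤ NT, v n ∈ Xh) (_ : ∀ n, 2 ≤ n → n < NT → w n ∈ X Ω)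
      (_ : ∀ n, A n + w n = extrap v n) (_ : ∀ n, 2 ≤ n → n < NT → ph (n + 1) ∈ Qh)
      (_ : ∀ n, 2 ≤ n → n < NT → ∀ z ∈ Xh, inner ℝ (valV (blendedBDF Δt v n)) (valV z)
        + bStar (A n) (v (n + 1)) z + bStar (w n) (extrap v n) z - inner ℝ (ph (n + 1)) (dvg z)
        + ν * gradInner (v (n + 1)) z = inner ℝ (f (((n + 1 : ℕ) : ℝ) * Δt)) (valV z))
      (_ : ∀ n, 2 ≤ n → n < NT → ∀ q ∈ Qh, inner ℝ (dvg (v (n + 1))) q = 0)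
      (_ : ∀ n, 2 ≤ n → n < NT → 36 * B ^ 2 * Cinv * (Δt / (ν * h)) * gradNsq (w n) ≤ 1)
      (e : ℕ → SobolevV Ω 1) (_ : ∀ n, e n = nodal U Δt n - v n) (N : ℕ) (_ : 2 < N) (_ : N ≤ NT),
      totalError ν Δt e N
        ≤ K₁ * levelEnergy ν Δt e 2 + K₂ * dataTerms ν T Δt h NT U p := by
  obtain ⟨K, hK, happ⟩ := exists_approxBound (Capp := Capp) hβ hν hT hsol
  obtain ⟨M, hM⟩ := isCompact_Icc.exists_bound_of_continuousOn
    (hsol.regular_u.gradJet.prim.continuousOn hT.le)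
  have hB0 := hB.pos
  set κ := 27 / (4 * ν) * (108 * B ^ 2 * M ^ 2 / ν) ^ 2 with hκ
  have hκ0 : 0 ≤ κ := by positivity
  set c := 3 * B / (4 * Cinv) with hc
  have hc0 : 0 ≤ c := by positivity
  set G := Real.exp (2 * κ * T) with hG
  have hG0 : 0 < G := Real.exp_pos _
  set R := 162 / ν * (B ^ 2 * (7569 * ν) + B ^ 4 * (T * K) + ‖traceL Ω‖ ^ 2 * (Capp ^ 2 * ν)
          + B ^ 2 * M ^ 2 * (5184 * ν) + 53 * B ^ 2 * M ^ 2 * (T * K))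
        + 2 * c * (5184 + Metric.diam Ω * (T * K)) with hR
  have hdiam : 0 ≤ Metric.diam Ω := Metric.diam_nonneg
  have hR0 : 0 ≤ R := by positivity
  -- `24 = 2·6·2`: splitting the error, comparing the initial energies of `ξ`, and passing from `ξ`
  -- back to `e - η` at the starting level.
  refine ⟨24 * G, 2 * (51 * B ^ 2 + 9 / 8 * (ν * T) + 1 / 4 * B ^ 2 * T + ν * T) * K
    + G * (24 * ((51 * B ^ 2 + 9 / 8 * (ν * T)) * K) + 2 * R), by positivity, by positivity, ?_⟩
  intro h Xh Qh hF Δt NT hΔ hTe v A w ph hv hw hA hph hdisc hdivv hCFL e he N hN2 hN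
  have hD := dataBound_dataTerms (NT := NT) (U := U) (p := p) hν hT.le hΔ hF.h_pos
  generalize dataTerms ν T Δt h NT U p = D at hD ⊢
  have hD0 := hD.nonneg
  have hfin := hF.finite_X
  have hVX : discDivFree Xh Qh ≤ Xh := fun z hz => hz.1
  have : FiniteDimensional ℝ (discDivFree Xh Qh) := Submodule.finiteDimensional_of_le hVX
  obtain ⟨P, hPmem, hPorth, hPmin⟩ :=
    exists_linear_projection (E := SobolevV Ω 1) gradM (discDivFree Xh Qh)
  obtain ⟨η, hη, hηdef⟩ : ∃ η : ℕ → SobolevV Ω 1, ApproxBound η Δt NT (K * D)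
      ∧ ∀ n, η n = nodal U Δt n - P (nodal U Δt n) :=
    ⟨_, happ Cinv h Xh Qh hF Δt NT hΔ hTe (by omega) P hPmin D hD, fun _ => rfl⟩
  obtain ⟨ξ, hξdef⟩ : ∃ ξ : ℕ → SobolevV Ω 1, ∀ n, ξ n = P (nodal U Δt n) - v n :=
    ⟨_, fun _ => rfl⟩
  have hdec : ∀ n, nodal U Δt n = v n + η n + ξ n := fun n => by
    rw [hηdef, hξdef]
    abel
  have heη : ∀ n, e n = η n + ξ n := fun n => by
    rw [he, hηdef, hξdef]
    abel
  have hξe : ∀ n, ξ n = e n + -η n := fun n => by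
    rw [heη]
    abel
  have huX : ∀ n ≤ NT, nodal U Δt n ∈ X Ω := fun n hn => hsol.boundary _ (node_mem hΔ hTe hn)
  have hηX : ∀ n ≤ NT, η n ∈ X Ω := fun n hn => by
    rw [hηdef]
    exact (X Ω).sub_mem (huX n hn) (hF.conforming_X (hVX (hPmem _)))
  have hξX : ∀ n ≤ NT, ξ n ∈ Xh := fun n hn => by
    rw [hξdef]
    exact Xh.sub_mem (hVX (hPmem _)) (hv n hn)
  -- Only from level 3 on: the starting values need not be discretely divergence free, and `ξ` is
  -- used as a test field at computed levels only.
  have hξV : ∀ m, m + 3 ≤ NT → ξ (m + 3) ∈ discDivFree Xh Qh := fun m hm => by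
    rw [hξdef]
    exact Submodule.sub_mem _ (hPmem _) ⟨hv _ hm, hdivv (m + 2) (by omega) (by omega)⟩
  have huM : ∀ n ≤ NT, gn (nodal U Δt n) ≤ M := fun n hn => hM _ (node_mem hΔ hTe hn)
  -- The projection is compared with the zero field.
  have hηM : ∀ n ≤ NT, gn (η n) ≤ M := fun n hn => by
    have h1 := hPmin (nodal U Δt n) 0 (Submodule.zero_mem _)
    rw [sub_zero] at h1
    rw [hηdef]
    exact h1.trans (huM n hn)
  have hqex : ∀ m : ℕ, ∃ q : L2 Ω, m + 3 ≤ NT → q ∈ Qh ∧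
      ‖val (p (((m + 3 : ℕ) : ℝ) * Δt)) - q‖
        ≤ Capp * h ^ (s + 1) * ‖p (((m + 3 : ℕ) : ℝ) * Δt)‖ := by
    intro m
    by_cases hm : m + 3 ≤ NT
    · obtain ⟨q, hq, hq'⟩ := hF.approx_Q _ (hsol.pressure _ (node_mem hΔ hTe hm))
      exact ⟨q, fun _ => ⟨hq, hq'⟩⟩
    · exact ⟨0, fun h' => absurd h' hm⟩
  choose q hq using hqex
  obtain ⟨M₀, rfl⟩ := Nat.exists_eq_add_of_le' hN2.le
  have hstep : ∀ m < M₀, valEnergy ξ (m + 3) + 1 / 4 * vn (thirdDiff ξ (m + 2)) ^ 2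
        + 4 * ν * Δt * gn (ξ (m + 3)) ^ 2
      ≤ valEnergy ξ (m + 2) + ν * Δt / 27 * gn (extrap ξ (m + 2)) ^ 2
        + κ * Δt * vn (extrap ξ (m + 2)) ^ 2
        + (27 / ν * Δt * stepResidual B M Δt (nodal U Δt) η
            (valV (U.ut (((m + 3 : ℕ) : ℝ) * Δt))) (val (p (((m + 3 : ℕ) : ℝ) * Δt)) - q m)
            (m + 2) ^ 2
          + c * h * (gn (thirdDiff (nodal U Δt) (m + 2)) + gn (thirdDiff η (m + 2))) ^ 2) := by
    intro m hm
    have hm3 : m + 3 ≤ NT := by omega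
    have ht := node_mem hΔ hTe hm3
    have h1 := energy_step hΩo hΩb hC hB hF hν hΔ hCinv (m := m) (A := A (m + 2)) (w := w (m + 2))
      hdec (fun n hn => huX n (by omega)) (fun n hn => hηX n (by omega))
      (fun n hn => hξX n (by omega)) (hξV m hm3) (hw _ (by omega) (by omega)) (hA _)
      (by rw [hηdef]; exact hPorth _ _ (hξV m hm3)) (hsol.divFree _ ht)
      (hph (m + 2) (by omega) (by omega)) (hq m hm3).1
      (hsol.momentum _ ht _ (hF.conforming_X (hξX _ hm3)))
      (hdisc (m + 2) (by omega) (by omega) _ (hξX _ hm3)) (fun n hn => huM n (by omega))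
      (hηM _ hm3) (hCFL _ (by omega) (by omega))
    rw [← add_assoc]
    exact h1
  have hξ := totalError_le_of_step hν hΔ hκ0 (fun m => by have := hF.h_pos; positivity) hstep
  have hres := sum_residual_le (B := B) (M := M) (c := c) hsol.regular_u hν hΔ hTe hF.h_pos hF.h_le
    hD (mul_nonneg hK hD0) hη hc0 hN (fun m hm => (hq m (by omega)).2)
  have hres' : _ ≤ R * D := hres.trans_eq (by rw [hR]; ring)
  have hexp : Real.exp (2 * κ * Δt * M₀) ≤ G := by
    refine Real.exp_le_exp.2 ?_
    have h1 : (M₀ : ℝ) * Δt ≤ T := (node_mem hΔ hTe (by omega)).2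
    calc 2 * κ * Δt * M₀ = 2 * κ * (M₀ * Δt) := by ring
      _ ≤ 2 * κ * T := by gcongr
  have hΔT : Δt ≤ T := by
    have := (node_mem hΔ hTe (n := 1) (by omega)).2
    simpa using this
  have hLη := hη.levelEnergy_le hB hηX hν hΔ hΔT le_rfl (by omega)
  have hTη := hη.totalError_le hB hηX hν hΔ hTe (mul_nonneg hK hD0) hN2.le hN
  have hLξ := levelEnergy_add_le hν hΔ hξe 2
  rw [levelEnergy_neg] at hLξ
  have hTe' := totalError_add_le hν hΔ heη (M₀ + 2)
  have hLξ0 := levelEnergy_nonneg hν hΔ ξ 2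
  have hfinal : totalError ν Δt ξ (M₀ + 2) ≤ G * (6 * (2 * levelEnergy ν Δt e 2
      + 2 * ((51 * B ^ 2 + 9 / 8 * (ν * T)) * (K * D))) + R * D) := by
    refine hξ.trans (mul_le_mul hexp (by linarith) ?_ hG0.le)
    have := hF.h_pos
    refine add_nonneg (by positivity) (Finset.sum_nonneg fun _ _ => by positivity)
  linarith

end EnBDF
end

/-! ### Choice of the constants for the whole ensemble -/

open EnBDF
theorem theorem3 {d : ℕ} (hd : d = 2 ∨ d = 3) (Ω : Set (Pt d)) (hΩo : IsOpen Ω)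
    (hΩb : Bornology.IsBounded Ω) (Cinv : ℝ) (hCinv : 0 < Cinv) :
    ∃ Ce : ℝ, 0 < Ce ∧
      ∀ (k s : ℕ) (_ : 1 ≤ k) (β Capp : ℝ) (_ : 0 < β) (_ : 0 < Capp)
        (ν T : ℝ) (_ : 0 < ν) (_ : 0 < T) (J : ℕ)
        (U : Fin J → TimeJet (SobolevV Ω (k + 1))) (p : Fin J → ℝ → Sobolev Ω (s + 1))
        (f : Fin J → ℝ → L2V Ω) (_ : ∀ j, IsNSESolution Ω k s ν T (U j) (p j) (f j)),
      ∃ C : ℝ, 0 < C ∧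
        ∀ (h : ℝ) (Xh : Submodule ℝ (SobolevV Ω 1)) (Qh : Submodule ℝ (L2 Ω))
          (_ : IsFEPair Ω k s Cinv β Capp h Xh Qh)
          (Δt : ℝ) (NT : ℕ) (_ : 0 < Δt) (_ : NT * Δt = T)
          (uh : Fin J → ℕ → SobolevV Ω 1) (ph : Fin J → ℕ → L2 Ω)
          (_ : IsEnBlendedBDF ν Δt NT Xh Qh f uh ph)
          (_ : ∀ j n, 2 ≤ n → n < NT → Ce * (Δt / (ν * h)) * gradNsq (fluct uh j n) ≤ 1)
          (j : Fin J) (e : ℕ → SobolevV Ω 1)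
          (_ : ∀ n, e n = toH1 ((U j).u (n * Δt)) - uh j n)
          (N : ℕ) (_ : 2 < N) (_ : N ≤ NT),
        levelEnergy ν Δt e N
            + 1 / 4 * ∑ n ∈ Finset.Ico 2 N, nsq (thirdDiff e n)
            + ν * ∑ n ∈ Finset.Ico 2 N, Δt * gradNsq (e (n + 1))
          ≤ Real.exp (C * T / ν ^ 2) *
            (levelEnergy ν Δt e 2 + C * dataTerms ν T Δt h NT (U j) (p j)) := by
  obtain ⟨Ct, hCt⟩ := exists_triBound hd hΩo hΩb
  obtain ⟨B, hB⟩ := exists_formBound hd hΩo hΩb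
  have hB0 := hB.pos
  refine ⟨36 * B ^ 2 * Cinv, by positivity, ?_⟩
  intro k s _ β Capp hβ _ ν T hν hT J U p f hsol
  choose K₁ K₂ hK₁ hK₂ hmain using fun j =>
    exists_totalError_le (Capp := Capp) hΩo hΩb hCt hB hCinv hβ hν hT (hsol j)
  have hterm : ∀ j, 0 ≤ K₁ j * (ν ^ 2 / T) + K₂ j := fun j => by
    have := hK₁ j
    have := hK₂ j
    positivity
  -- The sum over the ensemble makes the constant independent of `j`. The factor `ν ^ 2 / T` ensures
  -- `K₁ j ≤ C T / ν²`, so that the exponential dominates `K₁ j` and the initial energy needs no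
  -- further constant.
  refine ⟨1 + ∑ j, (K₁ j * (ν ^ 2 / T) + K₂ j),
    add_pos_of_pos_of_nonneg one_pos (Finset.sum_nonneg fun j _ => hterm j), ?_⟩
  intro h Xh Qh hF Δt NT hΔ hTe uh ph hdisc hCFL j e he N hN2 hN
  have hCj : K₁ j * (ν ^ 2 / T) + K₂ j ≤ ∑ j, (K₁ j * (ν ^ 2 / T) + K₂ j) :=
    Finset.single_le_sum (fun j _ => hterm j) (Finset.mem_univ j)
  generalize ∑ j, (K₁ j * (ν ^ 2 / T) + K₂ j) = S at hCj ⊢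
  have hext : ∀ i n, 2 ≤ n → n < NT → extrap (uh i) n ∈ Xh := fun i n _ hn =>
    extrap_mem _ fun l hl => hdisc.mem_X i l (by omega)
  have hfl : ∀ n, 2 ≤ n → n < NT → fluct uh j n ∈ X Ω := fun n hn hn' =>
    hF.conforming_X (Xh.sub_mem (hext j n hn hn')
      (Xh.smul_mem _ (Xh.sum_mem fun i _ => hext i n hn hn')))
  have hbound := hmain j h Xh Qh hF Δt NT hΔ hTe (uh j) (ensMean uh) (fluct uh j) (ph j)
    (hdisc.mem_X j) hfl (fun n => add_sub_cancel _ _) (hdisc.mem_Q j) (hdisc.momentum j)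
    (hdisc.divFree j) (hCFL j) e he N hN2 hN
  have hD0 := (dataBound_dataTerms (NT := NT) (U := U j) (p := p j) hν hT.le hΔ hF.h_pos).nonneg
  have hL0 := levelEnergy_nonneg hν hΔ e 2
  have h1 := hK₁ j
  have h2 := hK₂ j
  have h3 : 0 ≤ K₁ j * (ν ^ 2 / T) := by positivity
  have hE1 : (1 + S) * T / ν ^ 2 + 1 ≤ Real.exp ((1 + S) * T / ν ^ 2) := Real.add_one_le_exp _
  have hE2 : K₁ j ≤ (1 + S) * T / ν ^ 2 := by
    rw [le_div_iff₀ (by positivity)]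
    have h4 : K₁ j * (ν ^ 2 / T) * T = K₁ j * ν ^ 2 := by field_simp
    rw [← h4]
    exact mul_le_mul_of_nonneg_right (by linarith) hT.le
  have hE0 : K₁ j ≤ Real.exp ((1 + S) * T / ν ^ 2) := by linarith
  have hE3 : K₂ j ≤ Real.exp ((1 + S) * T / ν ^ 2) * (1 + S) :=
    le_trans (by linarith) (le_mul_of_one_le_left (by linarith) (by linarith))
  refine hbound.trans ?_
  rw [mul_add, ← mul_assoc]
  exact add_le_add (mul_le_mul_of_nonneg_right hE0 hL0) (mul_le_mul_of_nonneg_right hE3 hD0)
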